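/- Let $K$ be a nonarchimedean local field with ring of integers $\mathcal O$, uniformizing element $\varpi$, residue field with $q$ elements, and absolute value normalized by $|\varpi|=q^{-1}$. Let $n\ge 1$, $G=\mathrm{GL}_n(K)$, $M(\mathcal O)=\mathrm{Mat}_n(\mathcal O)$, $G(\mathcal O)=\mathrm{GL}_n(\mathcal O)$, and $|x|=|\det x|$ for $x\in G$. Let $dx$ be the Haar measure on $G$ giving $G(\mathcal O)$ volume $1$. Let $A\subset G$ be the group of diagonal matrices, $N\subset G$ the group of upper triangular matrices with ones on the diagonal, $dn$ the Haar measure on $N$ giving $N\cap G(\mathcal O)$ volume $1$, $\lambda=A/(A\cap G(\mathcal O))$, $\varpi_j=\mathrm{diag}(1,\dots,\varpi,\dots,1)\in A$ with $\varpi$ in the $j$-th position, and $\delta(\mathrm{diag}(a_1,\dots,a_n))=|a_1|^{n-1}|a_2|^{n-3}\cdots|a_n|^{-(n-1)}$. Let $\mathcal H$ be the Hecke algebra of compactly supported $G(\mathcal O)$-bi-invariant functions $f:G\to\mathbb C$, with Satake transform $Sf(a)=\delta(a)^{1/2}\int_N f(an)\,dn$. Let $\pi$ be an irreducible admissible Hilbert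 representation of $G$: a continuous representation on a complex Hilbert space $V_\pi\neq 0$ having no closed invariant subspaces other than $0$ and $V_\pi$, such that the space $V_\pi^U$ of $U$-fixed vectors is finite dimensional for every open subgroup $U$ of $G$. Assume that $\pi$ is unramified (of class one), i.e. $V_\pi^{G(\mathcal O)}\ne 0$. Then there is a character $\chi_\pi\in\mathrm{Hom}(\lambda,\mathbb C^\times)$, unique up to permutation of the coordinates, such that every $f\in\mathcal H$ acts on $V_\pi^{G(\mathcal O)}$ through $\pi(f)=\int_G f(x)\pi(x)\,dx$ as the scalar $\sum_{a\in\lambda}Sf(a)\chi_\pi(a)$. Put $$L(\pi)=\prod_{j=1}^n\bigl(1-\chi_\pi(\varpi_j)\bigr)^{-1},\qquad |\pi|=\max_{1\le j\le n}|\chi_\pi(\varpi_j)| .$$ For $s\in\mathbb C$ let $\pi_s=|\cdot|^s\pi$ be the representation $g\mapsto |g|^s\pi(g)$, and let $L(\pi,s)=L(\pi_s)$. For a $G(\mathcal O)$-bi-invariant function $f$ on $G$, not necessarily compactly supported, we say that $\pi(f)$ exists if the series $\sum_D\pi(f\mathbf 1_D)$ over the double cosets $D\in G(\mathcal O)\backslash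 G/G(\mathcal O)$ converges unconditionally in the operator norm, and $\pi(f)$ is then its sum. **Corollary 2.2.** If $s\in\mathbb C$ satisfies $|\pi|<q^{\mathrm{Re}(s)}$, then the operators $\pi_s\bigl(\mathbf 1_{M(\mathcal O)}(x)|x|^{\frac{n-1}2}\bigr)$ and $\pi\bigl(\mathbf 1_{M(\mathcal O)}(x)|x|^{s+\frac{n-1}2}\bigr)$ exist and are of trace class, and $$L(\pi,s)=\mathrm{tr}\,\pi_s\Bigl(\mathbf 1_{M(\mathcal O)}(x)\,|x|^{\frac{n-1}2}\Bigr)=\mathrm{tr}\,\pi\Bigl(\mathbf 1_{M(\mathcal O)}(x)\,|x|^{s+\frac{n-1}2}\Bigr).$$ -/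

import Mathlib

open MeasureTheory Matrix
open scoped NormedField Valued MatrixGroups

namespace LocalFactor

universe u

noncomputable section

section Groups

variable (n : ℕ) (K : Type*) [NontriviallyNormedField K] [IsUltrametricDist K]

/-- The number `q` of elements of the residue class field. -/
def residueCard : ℕ := Nat.card 𝓀[K]

variable {K} in
/-- `ϖ` is a uniformizing element of `K`. -/
def IsUniformizer (ϖ : Kˣ) : Prop := ∃ p : 𝒪[K], Irreducible p ∧ (p : K) = ϖ

/-- The subgroup `GL_n(𝒪)` of `GL_n(K)`. -/
def maxCompact : Subgroup (GL (Fin n) K) :=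
  (Matrix.GeneralLinearGroup.map (n := Fin n) (algebraMap 𝒪[K] K)).range

/-- The subgroup `N` of upper triangular matrices with ones on the diagonal. -/
def unipotent : Subgroup (GL (Fin n) K) where
  carrier := {g | (∀ i, (g : Matrix (Fin n) (Fin n) K) i i = 1) ∧
    ∀ i j, j < i → (g : Matrix (Fin n) (Fin n) K) i j = 0}
  one_mem' := by
    refine ⟨fun i => by simp, fun i j h => ?_⟩
    simp [h.ne']
  mul_mem' := by
    rintro a b ⟨ha, ha'⟩ ⟨hb, hb'⟩
    have hA : (a : Matrix (Fin n) (Fin n) K).BlockTriangular id := fun i j h => ha' i j h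
    have hB : (b : Matrix (Fin n) (Fin n) K).BlockTriangular id := fun i j h => hb' i j h
    refine ⟨fun i => ?_, fun i j h => ?_⟩
    · rw [Units.val_mul, Matrix.mul_apply, Finset.sum_eq_single i]
      · simp [ha, hb]
      · intro j _ hj
        rcases lt_or_gt_of_ne hj with h | h
        · simp [ha' i j h]
        · simp [hb' j i h]
      · simp
    · rw [Units.val_mul]
      exact (hA.mul hB) h
  inv_mem' := by
    rintro a ⟨ha, ha'⟩
    have hA : (a : Matrix (Fin n) (Fin n) K).BlockTriangular id := fun i j h => ha' i j h
    have : Invertible (a : Matrix (Fin n) (Fin n) K) := a.isUnit.invertible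
    have hB : ((a⁻¹ : GL (Fin n) K) : Matrix (Fin n) (Fin n) K).BlockTriangular id := by
      rw [Matrix.coe_units_inv]
      exact Matrix.blockTriangular_inv_of_blockTriangular hA
    refine ⟨fun i => ?_, fun i j h => hB h⟩
    have h1 : ((a : Matrix (Fin n) (Fin n) K) *
        ((a⁻¹ : GL (Fin n) K) : Matrix (Fin n) (Fin n) K)) i i = 1 := by
      rw [← Units.val_mul]; simp
    rw [Matrix.mul_apply, Finset.sum_eq_single i] at h1
    · simpa [ha i] using h1
    · intro j _ hj
      rcases lt_or_gt_of_ne hj with h | h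
      · simp [ha' i j h]
      · rw [hB h, mul_zero]
    · simp

/-- The group `A` of diagonal matrices is parametrized by its diagonal entries; this is the
embedding `a ↦ diag(a_1, …, a_n)` into `GL_n(K)`. -/
def diag : (Fin n → Kˣ) →* GL (Fin n) K :=
  (Units.map (Matrix.diagonalRingHom (Fin n) K).toMonoidHom).comp
    (MulEquiv.piUnits (M := fun _ : Fin n => K)).symm.toMonoidHom

/-- The subgroup `A ∩ GL_n(𝒪)` of `A`. -/
def diagCompact : Subgroup (Fin n → Kˣ) := (maxCompact n K).comap (diag n K)

/-- The lattice `λ = A / (A ∩ GL_n(𝒪))`. -/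
abbrev Lattice : Type _ := (Fin n → Kˣ) ⧸ diagCompact n K

variable {n K}

lemma mem_maxCompact_iff (g : GL (Fin n) K) :
    g ∈ maxCompact n K ↔
      (∀ i j, ‖(g : Matrix (Fin n) (Fin n) K) i j‖ ≤ 1) ∧
      (∀ i j, ‖((g⁻¹ : GL (Fin n) K) : Matrix (Fin n) (Fin n) K) i j‖ ≤ 1) := by
  constructor
  · rintro ⟨h, rfl⟩
    refine ⟨fun i j => ?_, fun i j => ?_⟩
    · exact Valued.integer.norm_le_one ((h : Matrix (Fin n) (Fin n) 𝒪[K]) i j)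
    · rw [← map_inv]
      exact Valued.integer.norm_le_one
        (((h⁻¹ : GL (Fin n) 𝒪[K]) : Matrix (Fin n) (Fin n) 𝒪[K]) i j)
  · rintro ⟨h1, h2⟩
    have inj : Function.Injective
        (RingHom.mapMatrix (m := Fin n) (algebraMap 𝒪[K] K)) :=
      Matrix.map_injective Subtype.val_injective
    have e1 : RingHom.mapMatrix (algebraMap 𝒪[K] K)
        (Matrix.of fun i j => (⟨_, Valued.integer.mem_iff.2 (h1 i j)⟩ : 𝒪[K])) =
        (g : Matrix (Fin n) (Fin n) K) := by ext i j; rfl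
    have e2 : RingHom.mapMatrix (algebraMap 𝒪[K] K)
        (Matrix.of fun i j => (⟨_, Valued.integer.mem_iff.2 (h2 i j)⟩ : 𝒪[K])) =
        ((g⁻¹ : GL (Fin n) K) : Matrix (Fin n) (Fin n) K) := by ext i j; rfl
    refine ⟨⟨Matrix.of fun i j => (⟨_, Valued.integer.mem_iff.2 (h1 i j)⟩ : 𝒪[K]),
      Matrix.of fun i j => (⟨_, Valued.integer.mem_iff.2 (h2 i j)⟩ : 𝒪[K]), inj ?_, inj ?_⟩,
      Units.ext e1⟩
    · rw [map_mul, map_one, e1, e2, ← Units.val_mul]; simp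
    · rw [map_mul, map_one, e1, e2, ← Units.val_mul]; simp

lemma isOpen_maxCompact : IsOpen (maxCompact n K : Set (GL (Fin n) K)) := by
  have h : (maxCompact n K : Set (GL (Fin n) K)) =
      (⋂ i, ⋂ j, (fun g : GL (Fin n) K => (g : Matrix (Fin n) (Fin n) K) i j) ⁻¹'
        Metric.closedBall 0 1) ∩
      (⋂ i, ⋂ j, (fun g : GL (Fin n) K =>
        ((g⁻¹ : GL (Fin n) K) : Matrix (Fin n) (Fin n) K) i j) ⁻¹' Metric.closedBall 0 1) := by
    ext g
    simp [mem_maxCompact_iff]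
  rw [h]
  refine IsOpen.inter ?_ ?_ <;>
  refine isOpen_iInter_of_finite fun i => isOpen_iInter_of_finite fun j =>
    (IsUltrametricDist.isOpen_closedBall 0 one_ne_zero).preimage ?_
  · exact Units.continuous_val.matrix_elem i j
  · exact (Units.continuous_val.comp continuous_inv).matrix_elem i j

lemma isCompact_maxCompact [LocallyCompactSpace K] :
    IsCompact (maxCompact n K : Set (GL (Fin n) K)) := by
  have : ProperSpace K := ProperSpace.of_locallyCompactSpace K
  let B : Set (Matrix (Fin n) (Fin n) K) :=
    Set.pi Set.univ fun _ => Set.pi Set.univ fun _ => Metric.closedBall 0 1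
  have hB : IsCompact B :=
    isCompact_univ_pi fun _ => isCompact_univ_pi fun _ => isCompact_closedBall 0 1
  have hB' : IsCompact (B ×ˢ (MulOpposite.op '' B)) :=
    hB.prod (hB.image MulOpposite.continuous_op)
  have h := (Units.isClosedEmbedding_embedProduct
    (α := Matrix (Fin n) (Fin n) K)).isCompact_preimage hB'
  convert h using 1
  ext g
  have h1 : Units.embedProduct (Matrix (Fin n) (Fin n) K) g =
      ((g : Matrix (Fin n) (Fin n) K),
        MulOpposite.op ((g⁻¹ : GL (Fin n) K) : Matrix (Fin n) (Fin n) K)) := rfl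
  rw [Set.mem_preimage, h1, Set.mem_prod,
    MulOpposite.op_injective.mem_set_image, SetLike.mem_coe, mem_maxCompact_iff]
  have hm : ∀ m : Matrix (Fin n) (Fin n) K, m ∈ B ↔ ∀ i j, ‖m i j‖ ≤ 1 := fun m => by
    refine ⟨fun hm i j => mem_closedBall_zero_iff.1 (hm i trivial j trivial),
      fun hm i _ j _ => mem_closedBall_zero_iff.2 (hm i j)⟩
  rw [hm, hm]

lemma isClosed_unipotent : IsClosed (unipotent n K : Set (GL (Fin n) K)) := by
  have h : (unipotent n K : Set (GL (Fin n) K)) =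
      (⋂ i, {g : GL (Fin n) K | (g : Matrix (Fin n) (Fin n) K) i i = 1}) ∩
      (⋂ i, ⋂ j, ⋂ _ : j < i, {g : GL (Fin n) K | (g : Matrix (Fin n) (Fin n) K) i j = 0}) := by
    ext g
    simp [unipotent]
  rw [h]
  refine IsClosed.inter (isClosed_iInter fun i => ?_)
    (isClosed_iInter fun i => isClosed_iInter fun j => isClosed_iInter fun _ => ?_)
  · exact isClosed_eq (Units.continuous_val.matrix_elem i i) continuous_const
  · exact isClosed_eq (Units.continuous_val.matrix_elem i j) continuous_const

instance : MeasurableSpace (GL (Fin n) K) := borel _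
instance : BorelSpace (GL (Fin n) K) := ⟨rfl⟩

variable (n K) [LocallyCompactSpace K]

/-- The Haar measure `dx` on `GL_n(K)` giving `GL_n(𝒪)` the volume one. -/
def haarG : Measure (GL (Fin n) K) :=
  Measure.haarMeasure
    { carrier := maxCompact n K
      isCompact' := isCompact_maxCompact
      interior_nonempty' := ⟨1, by
        rw [isOpen_maxCompact.interior_eq]; exact one_mem _⟩ }

/-- The Haar measure on `N` giving `N ∩ GL_n(𝒪)` the volume one. -/
def haarN : Measure (unipotent n K) :=
  Measure.haarMeasure
    { carrier := Subtype.val ⁻¹' (maxCompact n K : Set (GL (Fin n) K))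
      isCompact' :=
        (isClosed_unipotent.isClosedEmbedding_subtypeVal).isCompact_preimage isCompact_maxCompact
      interior_nonempty' := ⟨1, by
        rw [(isOpen_maxCompact.preimage continuous_subtype_val).interior_eq]
        exact one_mem (maxCompact n K)⟩ }

end Groups

section Hecke

variable {n : ℕ} {K : Type*} [NontriviallyNormedField K] [IsUltrametricDist K]

/-- `|g| = |det g|`, as a complex number, for `g ∈ GL_n(K)`. -/
def absDet (g : GL (Fin n) K) : ℂ := ((‖(g : Matrix (Fin n) (Fin n) K).det‖ : ℝ) : ℂ)

/-- Membership in the Hecke algebra: compactly supported functions on `GL_n(K)` that are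
bi-invariant under `GL_n(𝒪)`. -/
structure IsHecke (f : GL (Fin n) K → ℂ) : Prop where
  compactSupport : HasCompactSupport f
  left_inv : ∀ k ∈ maxCompact n K, ∀ x, f (k * x) = f x
  right_inv : ∀ k ∈ maxCompact n K, ∀ x, f (x * k) = f x

/-- The modulus `δ(a) = |a_1|^{n-1} |a_2|^{n-3} ⋯ |a_n|^{-(n-1)}` (indices start at `0` here). -/
def modulus (a : Fin n → Kˣ) : ℝ :=
  ∏ j : Fin n, ‖(a j : K)‖ ^ ((n : ℤ) - 1 - 2 * ((j : ℕ) : ℤ))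

/-- The Satake transform `Sf(a) = δ(a)^{1/2} ∫_N f(an) dn`. -/
def satake [LocallyCompactSpace K] (f : GL (Fin n) K → ℂ) (a : Fin n → Kˣ) : ℂ :=
  ((Real.sqrt (modulus a) : ℝ) : ℂ) *
    ∫ u : unipotent n K, f (diag n K a * (u : GL (Fin n) K)) ∂(haarN n K)

/-- The value at `f` of the character of the Hecke algebra attached to `χ ∈ Hom(λ, ℂ^×)`: the
(finite) sum of `Sf(a) χ(a)` over `a ∈ λ`.  The function `Sf` is invariant under
`A ∩ GL_n(𝒪)`, so the representatives used do not matter. -/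
def heckeCharacter [LocallyCompactSpace K] (χ : Lattice n K →* ℂˣ) (f : GL (Fin n) K → ℂ) : ℂ :=
  ∑ᶠ l : Lattice n K, satake f (Quotient.out l) * (χ l : ℂ)

open Classical in
/-- The function `1_{M(𝒪)}(x) |x|^w` on `GL_n(K)`. -/
def integralPower (n : ℕ) (K : Type*) [NontriviallyNormedField K] [IsUltrametricDist K]
    (w : ℂ) (x : GL (Fin n) K) : ℂ :=
  if ∀ i j, (x : Matrix (Fin n) (Fin n) K) i j ∈ 𝒪[K] then absDet x ^ w else 0

/-- The element `ϖ_j = diag(1, …, ϖ, …, 1)` of `λ`, with `ϖ` in the `j`-th position. -/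
def latticeGen (ϖ : Kˣ) (j : Fin n) : Lattice n K :=
  QuotientGroup.mk (Pi.mulSingle j ϖ)

end Hecke

section TraceClass

variable {V : Type u} [NormedAddCommGroup V] [InnerProductSpace ℂ V] [CompleteSpace V]

/-- A bounded operator `T` on a Hilbert space is of trace class if `∑ ⟨e_i, |T| e_i⟩ < ∞` for
orthonormal bases `(e_i)`, where `|T| = (T^* T)^{1/2}`. -/
def IsTraceClass (T : V →L[ℂ] V) : Prop :=
  ∀ (ι : Type u) (b : HilbertBasis ι ℂ V),
    Summable fun i => RCLike.re (inner ℂ (b i) (CFC.abs T (b i)))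

/-- `T` is of trace class with trace `c`. -/
def HasTrace (T : V →L[ℂ] V) (c : ℂ) : Prop :=
  IsTraceClass T ∧
    ∀ (ι : Type u) (b : HilbertBasis ι ℂ V), HasSum (fun i => inner ℂ (b i) (T (b i))) c

end TraceClass

/-- A continuous representation of `GL_n(K)` on the Hilbert space `V`. -/
structure HilbertRep (n : ℕ) (K : Type*) [NontriviallyNormedField K]
    (V : Type u) [NormedAddCommGroup V] [InnerProductSpace ℂ V] where
  toHom : GL (Fin n) K →* (V →L[ℂ] V)
  continuous_action : Continuous fun p : GL (Fin n) K × V => toHom p.1 p.2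

namespace HilbertRep

variable {n : ℕ} {K : Type*} [NontriviallyNormedField K]
  {V : Type u} [NormedAddCommGroup V] [InnerProductSpace ℂ V]

/-- The subspace `V^U` of vectors fixed by every element of `U`. -/
def fixed (π : HilbertRep n K V) (U : Subgroup (GL (Fin n) K)) : Submodule ℂ V where
  carrier := {v | ∀ g ∈ U, π.toHom g v = v}
  add_mem' := fun ha hb g hg => by rw [map_add, ha g hg, hb g hg]
  zero_mem' := fun g _ => map_zero _
  smul_mem' := fun c v hv g hg => by rw [map_smul, hv g hg]

/-- `V ≠ 0` and the only closed invariant subspaces are `0` and `V`. -/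
def IsIrreducible (π : HilbertRep n K V) : Prop :=
  Nontrivial V ∧ ∀ W : Submodule ℂ V, IsClosed (W : Set V) →
    (∀ g, ∀ w ∈ W, π.toHom g w ∈ W) → W = ⊥ ∨ W = ⊤

/-- `V^U` is finite dimensional for every open subgroup `U`. -/
def IsAdmissible (π : HilbertRep n K V) : Prop :=
  ∀ U : Subgroup (GL (Fin n) K), IsOpen (U : Set (GL (Fin n) K)) →
    FiniteDimensional ℂ (π.fixed U)

variable [IsUltrametricDist K]

/-- Class one (unramified): there is a nonzero vector fixed under `GL_n(𝒪)`. -/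
def IsClassOne (π : HilbertRep n K V) : Prop := π.fixed (maxCompact n K) ≠ ⊥

/-- The representation `π_s = |.|^s π : g ↦ |g|^s π(g)`. -/
def twist (π : HilbertRep n K V) (s : ℂ) : HilbertRep n K V where
  toHom :=
    { toFun := fun g => (absDet g ^ s) • π.toHom g
      map_one' := by simp [absDet]
      map_mul' := fun g h => by
        have e : absDet (g * h) ^ s = absDet g ^ s * absDet h ^ s := by
          simp only [absDet, Units.val_mul, Matrix.det_mul, norm_mul, Complex.ofReal_mul]
          exact Complex.mul_cpow_ofReal_nonneg (norm_nonneg _) (norm_nonneg _) s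
        rw [map_mul, e, smul_mul_smul_comm] }
  continuous_action := by
    have h1 : Continuous fun g : GL (Fin n) K => absDet g ^ s := by
      have hc : Continuous fun g : GL (Fin n) K => absDet g :=
        Complex.continuous_ofReal.comp (Units.continuous_val.matrix_det.norm)
      refine hc.cpow continuous_const fun g => ?_
      refine Or.inl ?_
      simp only [absDet, Complex.ofReal_re]
      exact norm_pos_iff.2 ((Matrix.isUnit_iff_isUnit_det _).1 g.isUnit).ne_zero
    exact (h1.comp continuous_fst).smul π.continuous_action

variable [LocallyCompactSpace K]

/-- `T = π(f) = ∫ f(x) π(x) dx`, the integral being absolutely convergent on each vector. -/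
def IsIntegral (π : HilbertRep n K V) (f : GL (Fin n) K → ℂ) (T : V →L[ℂ] V) : Prop :=
  ∀ v, Integrable (fun x => f x • π.toHom x v) (haarG n K) ∧
    T v = ∫ x, f x • π.toHom x v ∂(haarG n K)

open Classical in
/-- `T = π(f)` for a function `f` which is bi-invariant under `GL_n(𝒪)`, but not necessarily of
compact support.  Such an `f` is the sum of its restrictions to the double cosets
`D ∈ GL_n(𝒪) \ GL_n(K) / GL_n(𝒪)`, which lie in the Hecke algebra; the operator `π(f)` exists and
equals `T` if `∑_D π(f 1_D)` converges unconditionally to `T` in the operator norm. -/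
def HasOperator (π : HilbertRep n K V) (f : GL (Fin n) K → ℂ) (T : V →L[ℂ] V) : Prop :=
  ∃ A : DoubleCoset.Quotient (maxCompact n K : Set (GL (Fin n) K))
      (maxCompact n K : Set (GL (Fin n) K)) → (V →L[ℂ] V),
    (∀ D, π.IsIntegral
      (fun x => if DoubleCoset.mk (maxCompact n K) (maxCompact n K) x = D then f x else 0)
      (A D)) ∧
    HasSum A T

/-- `χ ∈ Hom(λ, ℂ^×)` describes, through the Satake transform, the character by which the Hecke
algebra acts on the vectors fixed under `GL_n(𝒪)`. -/
def IsSatakeParameter (π : HilbertRep n K V) (χ : Lattice n K →* ℂˣ) : Prop :=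
  ∀ f : GL (Fin n) K → ℂ, IsHecke f → ∀ v ∈ π.fixed (maxCompact n K),
    ∫ x, f x • π.toHom x v ∂(haarG n K) = heckeCharacter χ f • v

open Classical in
/-- The element `χ_π ∈ Hom(λ, ℂ^×)`, which is unique up to permutation of coordinates when `π` is
irreducible, admissible and of class one (the value `1` is used if there is none). -/
def satakeParameter (π : HilbertRep n K V) : Lattice n K →* ℂˣ :=
  if h : ∃ χ, π.IsSatakeParameter χ then h.choose else 1

/-- `|π| = max_j |χ_π(ϖ_j)|`. -/
def satakeNorm (ϖ : Kˣ) (π : HilbertRep n K V) : ℝ :=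
  ⨆ j : Fin n, ‖(π.satakeParameter (latticeGen ϖ j) : ℂ)‖

/-- The local L-factor `L(π) = ∏_j (1 - χ_π(ϖ_j))⁻¹`. -/
def LFactor (ϖ : Kˣ) (π : HilbertRep n K V) : ℂ :=
  (∏ j : Fin n, (1 - (π.satakeParameter (latticeGen ϖ j) : ℂ)))⁻¹

/-- The twisted local L-factor `L(π, s) = L(|.|^s π)`. -/
def twistedLFactor (ϖ : Kˣ) (π : HilbertRep n K V) (s : ℂ) : ℂ := (π.twist s).LFactor ϖ

end HilbertRep

end

end LocalFactor

set_option linter.unusedSectionVars false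

/-! Write K₀ for `GL_n(𝒪)`. Averaging over K₀ is a bounded projection P of V onto the K₀-fixed
vectors. The Satake transform is multiplicative and injective on the Hecke algebra with a
commutative target, so the Hecke algebra is commutative. Together with irreducibility and
admissibility this makes the image of P a line (`exists_spherical_vector`). Every Hecke operator, on
all of V, is therefore a scalar times P, and c·P has rank one and trace c (`hasTrace_smul_average`).

It remains to sum scalars. On a bi-invariant f the scalar is the sum over cosets x in `GL_n(K)/K₀`
of f(x) δ^{1/2}(a) χ(a), with a the Iwasawa class of x (`lift_satakeMap`). For the indicator of the
integral matrices the cosets are listed by Hermite normal forms: an exponent vector l in ℕ^n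
together with entries above the diagonal. The number of forms with given l, times δ^{1/2}(ϖ^l), is
q^{(n-1)|l|/2} (`card_mul_sqrtModulus`), which is exactly what the factor |det|^{(n-1)/2} cancels.
What is left is a geometric series in n variables with sum ∏ (1 - χ(ϖ_j))⁻¹, absolutely convergent
when all |χ(ϖ_j)| < 1 (`hasSum_integralPower`).

The Satake parameter has to be constructed. The same count shows that the layer of integral matrices
with |det| = |ϖ|^k transforms to q^{k(n-1)/2} times the complete symmetric sum h_k in the generators
of λ. Hence ℂ[λ] is integral over the Satake image (`isIntegral_satakeImage`), and the
eigencharacter of the Hecke algebra extends to ℂ[λ] by lying over (`exists_isSatakeParameter`).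
Since `satakeParameter` is an arbitrary choice, the parameter of the twist is compared with that of
π through the sums h_k (`exists_satakeParameter_twist`); this turns the hypothesis on s into the
convergence condition for the twist. -/

namespace LocalFactor

/-! ### Elimination by row and column operations over the ring of integers. -/

section IntegralMatrices

variable {n : ℕ} {K : Type*} [NontriviallyNormedField K] [IsUltrametricDist K]

lemma norm_sub_le_max_norm (x y : K) : ‖x - y‖ ≤ max ‖x‖ ‖y‖ := by
  rw [sub_eq_add_neg, ← norm_neg y]
  exact IsUltrametricDist.norm_add_le_max _ _

lemma norm_det_le_one {m : Type*} [Fintype m] [DecidableEq m] (A : Matrix m m K)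
    (h : ∀ i j, ‖A i j‖ ≤ 1) : ‖A.det‖ ≤ 1 := by
  rw [Matrix.det_apply]
  refine IsUltrametricDist.norm_sum_le_of_forall_le_of_nonneg zero_le_one fun σ _ => ?_
  rw [Units.smul_def, zsmul_eq_mul, norm_mul, norm_prod]
  refine mul_le_one₀ ?_ (Finset.prod_nonneg fun _ _ => norm_nonneg _)
    (Finset.prod_le_one (fun _ _ => norm_nonneg _) fun _ _ => h _ _)
  exact_mod_cast IsUltrametricDist.norm_intCast_le_one K _

/-- The determinants of g and of its inverse both have norm at most one and multiply to one. -/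
lemma norm_det_of_mem {g : GL (Fin n) K} (hg : g ∈ maxCompact n K) :
    ‖(g : Matrix (Fin n) (Fin n) K).det‖ = 1 := by
  have h := (mem_maxCompact_iff g).1 hg
  refine le_antisymm (norm_det_le_one _ h.1) ?_
  have h2 := norm_det_le_one _ h.2
  have h3 : (g : Matrix (Fin n) (Fin n) K).det *
      ((g⁻¹ : GL (Fin n) K) : Matrix (Fin n) (Fin n) K).det = 1 := by
    rw [← Matrix.det_mul, ← Units.val_mul]; simp
  have h4 := congrArg norm h3
  rw [norm_mul, norm_one] at h4
  nlinarith [norm_nonneg (g : Matrix (Fin n) (Fin n) K).det]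

/-- A matrix over 𝒪 with unit determinant is invertible over 𝒪. This supplies all elements of K₀
used below without exhibiting their inverses. -/
lemma exists_mem_maxCompact (P : Matrix (Fin n) (Fin n) K) (h : ∀ i j, ‖P i j‖ ≤ 1)
    (hd : ‖P.det‖ = 1) : ∃ k ∈ maxCompact n K, (k : Matrix (Fin n) (Fin n) K) = P := by
  let M : Matrix (Fin n) (Fin n) 𝒪[K] :=
    Matrix.of fun i j => (⟨P i j, Valued.integer.mem_iff.2 (h i j)⟩ : 𝒪[K])
  have hM : M.map (algebraMap 𝒪[K] K) = P := by ext i j; rfl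
  have hdet : algebraMap 𝒪[K] K M.det = P.det := by
    rw [RingHom.map_det, ← hM]; rfl
  have hu : IsUnit M.det := by
    rw [Valued.integer.isUnit_iff_norm_eq_one, ← hd, ← hdet]; rfl
  refine ⟨Matrix.GeneralLinearGroup.map (algebraMap 𝒪[K] K)
    (Matrix.nonsingInvUnit M hu), ⟨_, rfl⟩, ?_⟩
  rw [← hM]; rfl

lemma mem_maxCompact_of_norm_det {g : GL (Fin n) K}
    (h : ∀ i j, ‖(g : Matrix (Fin n) (Fin n) K) i j‖ ≤ 1)
    (hd : ‖(g : Matrix (Fin n) (Fin n) K).det‖ = 1) : g ∈ maxCompact n K := by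
  obtain ⟨k, hk, e⟩ := exists_mem_maxCompact _ h hd
  rwa [← Units.ext e]

lemma exists_perm_mem (σ : Equiv.Perm (Fin n)) : ∃ k ∈ maxCompact n K,
    (∀ A : Matrix (Fin n) (Fin n) K, A * (k : Matrix (Fin n) (Fin n) K) = A.submatrix id σ) ∧
    (∀ A : Matrix (Fin n) (Fin n) K, (k : Matrix (Fin n) (Fin n) K) * A =
      A.submatrix σ.symm id) := by
  obtain ⟨k, hk, e⟩ := exists_mem_maxCompact (σ.symm.toPEquiv.toMatrix : Matrix (Fin n) (Fin n) K)
    (fun i j => by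
      rw [PEquiv.toMatrix_apply]; split_ifs <;> simp)
    (by
      rw [Matrix.det_permutation]
      rcases Int.units_eq_one_or (Equiv.Perm.sign σ.symm) with h | h <;> simp [h])
  refine ⟨k, hk, fun A => ?_, fun A => ?_⟩
  · rw [e, PEquiv.mul_toMatrix_toPEquiv]; rfl
  · rw [e, PEquiv.toMatrix_toPEquiv_mul]

/-- By the rank-one determinant formula the determinant is 1 - v·u = 1. With u or v a unit vector,
this clears a whole row or column at once. -/
lemma exists_elementary_mem (u v : Fin n → K) (hu : ∀ i, ‖u i‖ ≤ 1) (hv : ∀ i, ‖v i‖ ≤ 1)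
    (h : v ⬝ᵥ u = 0) : ∃ k ∈ maxCompact n K,
    (k : Matrix (Fin n) (Fin n) K) = 1 - Matrix.vecMulVec u v := by
  refine exists_mem_maxCompact _ (fun i j => ?_) ?_
  · rw [Matrix.sub_apply, Matrix.vecMulVec_apply]
    refine (norm_sub_le_max_norm _ _).trans (max_le ?_ ?_)
    · rw [Matrix.one_apply]; split_ifs <;> simp
    · rw [norm_mul]; exact mul_le_one₀ (hu i) (norm_nonneg _) (hv j)
  · have : (1 : Matrix (Fin n) (Fin n) K) - Matrix.vecMulVec u v =
        1 + replicateCol Unit (-u) * replicateRow Unit v := by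
      ext i j
      simp [Matrix.vecMulVec_apply, Matrix.mul_apply, sub_eq_add_neg]
    rw [this, Matrix.det_one_add_replicateCol_mul_replicateRow]
    simp [h]

/-- Column operations over the ring of integers bring a matrix into upper triangular form. -/
lemma exists_mul_upperTriangular (A : Matrix (Fin n) (Fin n) K) :
    ∃ k ∈ maxCompact n K, ∀ i j, j < i → (A * (k : Matrix (Fin n) (Fin n) K)) i j = 0 := by
  -- Rows are cleared from the bottom: after m steps the last m rows vanish left of the diagonal.
  suffices H : ∀ m : ℕ, m ≤ n → ∃ k ∈ maxCompact n K, ∀ i j : Fin n, n - m ≤ (i : ℕ) → j < i →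
      (A * (k : Matrix (Fin n) (Fin n) K)) i j = 0 by
    obtain ⟨k, hk, h⟩ := H n le_rfl
    exact ⟨k, hk, fun i j => h i j (by omega)⟩
  intro m
  induction m with
  | zero => exact fun _ => ⟨1, one_mem _, fun i j hi => by have := i.2; omega⟩
  | succ m ih =>
    intro hm
    obtain ⟨k, hk, h⟩ := ih (by omega)
    set B := A * (k : Matrix (Fin n) (Fin n) K) with hB
    let p : Fin n := ⟨n - (m + 1), by omega⟩
    -- The pivot has maximal norm among the entries of row p in columns up to p, so all quotients
    -- used in the elimination are integral.
    obtain ⟨q, hq, hmax⟩ := Finset.exists_max_image (Finset.Iic p) (fun j => ‖B p j‖) ⟨p, by simp⟩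
    obtain ⟨w, hw, hwr, -⟩ := exists_perm_mem (K := K) (Equiv.swap p q)
    set C := B * (w : Matrix (Fin n) (Fin n) K) with hC
    have hqp : q ≤ p := by simpa using hq
    have hswap : ∀ j, j ≤ p → Equiv.swap p q j ≤ p := by
      intro j hj
      by_cases h1 : j = p
      · subst h1; simpa using hqp
      by_cases h2 : j = q
      · subst h2; simp
      · rwa [Equiv.swap_apply_of_ne_of_ne h1 h2]
    have hCp : ∀ j, j ≤ p → ‖C p j‖ ≤ ‖C p p‖ := by
      intro j hj
      rw [hC, hwr]
      simpa using hmax _ (by simpa using hswap j hj)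
    have hC0 : ∀ i j : Fin n, p < i → j < i → C i j = 0 := by
      intro i j hi hj
      rw [hC, hwr, Matrix.submatrix_apply]
      refine h _ _ (by have := Fin.lt_def.1 hi; simp only [p, id_eq] at this ⊢; omega) ?_
      by_cases hjp : j ≤ p
      · exact (hswap j hjp).trans_lt hi
      · have h1 : j ≠ p := fun e => hjp e.le
        have h2 : j ≠ q := fun e => hjp (e ▸ hqp)
        rw [Equiv.swap_apply_of_ne_of_ne h1 h2]; exact hj
    let v : Fin n → K := fun j => if j < p then C p j / C p p else 0
    obtain ⟨t, ht, hte⟩ := exists_elementary_mem (Pi.single p (1 : K)) v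
      (fun i => by
        by_cases hi : i = p
        · subst hi; simp
        · simp [hi])
      (fun j => by
        simp only [v]
        split_ifs with hj
        · rw [norm_div]; exact div_le_one_of_le₀ (hCp j hj.le) (norm_nonneg _)
        · simp)
      (by simp [v])
    refine ⟨k * w * t, mul_mem (mul_mem hk hw) ht, fun i j hi hj => ?_⟩
    have e : A * ((k * w * t : GL (Fin n) K) : Matrix (Fin n) (Fin n) K) =
        C - C * Matrix.vecMulVec (Pi.single p (1 : K)) v := by
      rw [Units.val_mul, Units.val_mul, ← Matrix.mul_assoc, ← Matrix.mul_assoc, ← hB, ← hC, hte,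
        Matrix.mul_sub, Matrix.mul_one]
    rw [e, Matrix.sub_apply, Matrix.mul_vecMulVec, Matrix.vecMulVec_apply, Matrix.mulVec_single_one,
      Matrix.col_apply]
    by_cases hip : i = p
    · subst hip
      simp only [v, if_pos hj]
      -- If the maximal entry vanishes, the row segment is already zero.
      by_cases h0 : C p p = 0
      · have := hCp j hj.le
        rw [h0, norm_zero] at this
        simp [norm_le_zero_iff.1 this]
      · field_simp; simp
    · have hi' : p < i := by
        rw [Fin.lt_def]
        have : (i : ℕ) ≠ p := fun e => hip (Fin.ext e)
        simp only [p] at this ⊢; omega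
      rw [hC0 i j hi' hj, hC0 i p hi' hi']; simp

/-- Row and column operations over the ring of integers diagonalize a matrix, with diagonal
entries of decreasing norm. -/
lemma exists_mul_mul_diagonal (A : Matrix (Fin n) (Fin n) K) :
    ∃ k ∈ maxCompact n K, ∃ l ∈ maxCompact n K, ∃ B : Matrix (Fin n) (Fin n) K,
      (k : Matrix (Fin n) (Fin n) K) * A * (l : Matrix (Fin n) (Fin n) K) = B ∧
      (∀ i j, i ≠ j → B i j = 0) ∧ ∀ i j, i ≤ j → ‖B j j‖ ≤ ‖B i i‖ := by
  -- The invariant: the first m rows and columns are cleared, and each of the first m diagonal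
  -- entries dominates every entry of the block it starts. The second clause yields the decreasing
  -- norms at the end.
  suffices H : ∀ m : ℕ, m ≤ n → ∃ k ∈ maxCompact n K, ∃ l ∈ maxCompact n K,
      ∃ B : Matrix (Fin n) (Fin n) K,
      (k : Matrix (Fin n) (Fin n) K) * A * (l : Matrix (Fin n) (Fin n) K) = B ∧
      (∀ i j : Fin n, (i : ℕ) < m ∨ (j : ℕ) < m → i ≠ j → B i j = 0) ∧
      ∀ i : Fin n, (i : ℕ) < m → ∀ j j', i ≤ j → i ≤ j' → ‖B j j'‖ ≤ ‖B i i‖ by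
    obtain ⟨k, hk, l, hl, B, e, h1, h2⟩ := H n le_rfl
    exact ⟨k, hk, l, hl, B, e, fun i j => h1 i j (Or.inl i.2), fun i j hij =>
      h2 i i.2 j j hij hij⟩
  intro m
  induction m with
  | zero => exact fun _ => ⟨1, one_mem _, 1, one_mem _, A, by simp, by simp, by simp⟩
  | succ m ih =>
    intro hm
    obtain ⟨k, hk, l, hl, B, e, h1, h2⟩ := ih (by omega)
    let p : Fin n := ⟨m, by omega⟩
    -- A pivot of maximal norm in the whole remaining block makes both the row and the column
    -- quotients integral.
    obtain ⟨⟨q, r⟩, hqr, hmax⟩ := Finset.exists_max_image (Finset.Ici p ×ˢ Finset.Ici p)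
      (fun x => ‖B x.1 x.2‖) ⟨(p, p), by simp⟩
    have hq : p ≤ q := by simpa using (Finset.mem_product.1 hqr).1
    have hr : p ≤ r := by simpa using (Finset.mem_product.1 hqr).2
    obtain ⟨w, hw, -, hwl⟩ := exists_perm_mem (K := K) (Equiv.swap p q)
    obtain ⟨w', hw', hwr, -⟩ := exists_perm_mem (K := K) (Equiv.swap p r)
    have hswap : ∀ q, p ≤ q → ∀ j, p ≤ j → p ≤ Equiv.swap p q j := by
      intro q hq j hj
      by_cases h1 : j = p
      · subst h1; simpa using hq
      by_cases h2 : j = q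
      · subst h2; simp
      · rwa [Equiv.swap_apply_of_ne_of_ne h1 h2]
    have hfix : ∀ q, p ≤ q → ∀ j, j < p → Equiv.swap p q j = j := fun q hq j hj =>
      Equiv.swap_apply_of_ne_of_ne hj.ne (hj.trans_le hq).ne
    set C : Matrix (Fin n) (Fin n) K :=
      B.submatrix (Equiv.swap p q) (Equiv.swap p r) with hC
    have eC : (w : Matrix (Fin n) (Fin n) K) * B * (w' : Matrix (Fin n) (Fin n) K) = C := by
      rw [hwl, hwr]; rfl
    have hCp : ∀ i j, p ≤ i → p ≤ j → ‖C i j‖ ≤ ‖C p p‖ := by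
      intro i j hi hj
      simpa [hC] using hmax (Equiv.swap p q i, Equiv.swap p r j)
        (by simpa using ⟨hswap q hq i hi, hswap r hr j hj⟩)
    have hC0 : ∀ i j, i < p ∨ j < p → i ≠ j → C i j = 0 := by
      intro i j hij hne
      rw [hC, Matrix.submatrix_apply]
      rcases hij with hi | hj
      · rw [hfix q hq i hi]
        refine h1 _ _ (Or.inl hi) ?_
        by_cases hj : j < p
        · rwa [hfix r hr j hj]
        · exact (hi.trans_le (hswap r hr j (not_lt.1 hj))).ne
      · rw [hfix r hr j hj]
        refine h1 _ _ (Or.inr hj) ?_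
        by_cases hi : i < p
        · rwa [hfix q hq i hi]
        · exact (hj.trans_le (hswap q hq i (not_lt.1 hi))).ne'
    have hCd : ∀ i, i < p → ∀ j j', i ≤ j → i ≤ j' → ‖C j j'‖ ≤ ‖C i i‖ := by
      intro i hi j j' hj hj'
      have key : ∀ q, p ≤ q → ∀ j, i ≤ j → i ≤ Equiv.swap p q j := by
        intro q hq j hj
        by_cases hjp : j < p
        · rwa [hfix q hq j hjp]
        · exact hi.le.trans (hswap q hq j (not_lt.1 hjp))
      have := h2 i hi _ _ (key q hq j hj) (key r hr j' hj')
      simpa [hC, hfix q hq i hi, hfix r hr i hi] using this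
    let v : Fin n → K := fun j => if p < j then C p j / C p p else 0
    let u : Fin n → K := fun i => if p < i then C i p / C p p else 0
    have hs : ∀ i, ‖(Pi.single p (1 : K) : Fin n → K) i‖ ≤ 1 := fun i => by
      by_cases hi : i = p
      · subst hi; simp
      · simp [hi]
    obtain ⟨t, ht, hte⟩ := exists_elementary_mem (Pi.single p (1 : K)) v hs
      (fun j => by
        simp only [v]
        split_ifs with hj
        · rw [norm_div]; exact div_le_one_of_le₀ (hCp p j le_rfl hj.le) (norm_nonneg _)
        · simp)
      (by simp [v])
    obtain ⟨t', ht', hte'⟩ := exists_elementary_mem u (Pi.single p (1 : K))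
      (fun i => by
        simp only [u]
        split_ifs with hi
        · rw [norm_div]; exact div_le_one_of_le₀ (hCp i p hi.le le_rfl) (norm_nonneg _)
        · simp) hs
      (by simp [u])
    -- The result of subtracting u i times row p from row i, and then v j times column p from column
    -- j.
    set D : Matrix (Fin n) (Fin n) K :=
      Matrix.of fun i j => C i j - u i * C p j - (C i p - u i * C p p) * v j with hD
    have eD : (t' : Matrix (Fin n) (Fin n) K) * C * (t : Matrix (Fin n) (Fin n) K) = D := by
      rw [hte, hte', Matrix.sub_mul, Matrix.one_mul, Matrix.mul_sub, Matrix.mul_one,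
        Matrix.mul_vecMulVec, Matrix.mulVec_single_one]
      ext i j
      simp [hD, Matrix.vecMulVec_mul, Matrix.vecMulVec_apply]
    have hvC : ∀ j, p < j → C p p * v j = C p j := by
      intro j hj
      simp only [v, if_pos hj]
      by_cases h0 : C p p = 0
      · have := hCp p j le_rfl hj.le
        rw [h0, norm_zero] at this
        rw [norm_le_zero_iff.1 this, h0]; simp
      · field_simp
    have huC : ∀ i, p < i → u i * C p p = C i p := by
      intro i hi
      simp only [u, if_pos hi]
      by_cases h0 : C p p = 0
      · have := hCp i p hi.le le_rfl
        rw [h0, norm_zero] at this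
        rw [norm_le_zero_iff.1 this, h0]; simp
      · field_simp
    have hu0 : ∀ i, i ≤ p → u i = 0 := fun i hi => if_neg (not_lt.2 hi)
    have hv0 : ∀ i, i ≤ p → v i = 0 := fun i hi => if_neg (not_lt.2 hi)
    have hDlow : ∀ i j, i < p ∨ j < p → D i j = C i j := by
      intro i j hij
      simp only [hD, Matrix.of_apply]
      rcases hij with hi | hj
      · rw [hu0 i hi.le, hC0 i p (Or.inl hi) hi.ne]; ring
      · rw [hv0 j hj.le, hC0 p j (Or.inr hj) hj.ne']; ring
    have hDrow : ∀ j, p < j → D p j = 0 := by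
      intro j hj
      simp only [hD, Matrix.of_apply]
      rw [hu0 p le_rfl, zero_mul, zero_mul, sub_zero, sub_zero, hvC j hj, sub_self]
    have hDcol : ∀ i, p < i → D i p = 0 := by
      intro i hi
      simp only [hD, Matrix.of_apply]
      rw [hv0 p le_rfl, mul_zero, sub_zero, huC i hi, sub_self]
    have hDpp : D p p = C p p := by
      simp only [hD, Matrix.of_apply]
      rw [hv0 p le_rfl, hu0 p le_rfl]; ring
    have hDle : ∀ i j, p < i → p < j → ‖D i j‖ ≤ ‖C p p‖ := by
      intro i j hi hj
      simp only [hD, Matrix.of_apply]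
      rw [huC i hi, sub_self, zero_mul, sub_zero]
      refine (norm_sub_le_max_norm _ _).trans (max_le (hCp i j hi.le hj.le) ?_)
      rw [← hvC j hj, ← mul_assoc, huC i hi, norm_mul]
      refine (mul_le_mul (hCp i p hi.le le_rfl) ?_ (norm_nonneg _) (norm_nonneg _)).trans
        (mul_one _).le
      simp only [v, if_pos hj, norm_div]
      exact div_le_one_of_le₀ (hCp p j le_rfl hj.le) (norm_nonneg _)
    have hDall : ∀ i j, p ≤ i → p ≤ j → ‖D i j‖ ≤ ‖C p p‖ := by
      intro i j hi hj
      rcases hi.eq_or_lt with rfl | hi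
      · rcases hj.eq_or_lt with rfl | hj
        · rw [hDpp]
        · rw [hDrow _ hj]; simp
      · rcases hj.eq_or_lt with rfl | hj
        · rw [hDcol _ hi]; simp
        · exact hDle _ _ hi hj
    refine ⟨t' * w * k, mul_mem (mul_mem ht' hw) hk, l * w' * t, mul_mem (mul_mem hl hw') ht,
      D, ?_, fun i j hij hne => ?_, fun i hi j j' hj hj' => ?_⟩
    · rw [← eD, ← eC, ← e]
      simp only [Units.val_mul, Matrix.mul_assoc]
    · have hp : (p : ℕ) = m := rfl
      rcases lt_trichotomy i p with hi | hi | hi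
      · rw [hDlow i j (Or.inl hi), hC0 i j (Or.inl hi) hne]
      · subst hi
        rcases lt_trichotomy j p with hj | hj | hj
        · rw [hDlow _ j (Or.inr hj), hC0 _ j (Or.inr hj) hne]
        · exact absurd hj.symm hne
        · exact hDrow j hj
      · rcases lt_trichotomy j p with hj | hj | hj
        · rw [hDlow _ j (Or.inr hj), hC0 _ j (Or.inr hj) hne]
        · subst hj; exact hDcol i hi
        · rw [Fin.lt_def] at hi hj; omega
    · have hp : (p : ℕ) = m := rfl
      rcases lt_or_ge i p with hip | hip
      · rw [hDlow i i (Or.inl hip)]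
        by_cases hlow : j < p ∨ j' < p
        · rw [hDlow j j' hlow]
          exact hCd i hip j j' hj hj'
        · push Not at hlow
          exact (hDall j j' hlow.1 hlow.2).trans (hCd i hip p p hip.le hip.le)
      · obtain rfl : i = p := le_antisymm (by rw [Fin.le_def]; omega) hip
        rw [hDpp]
        exact hDall j j' hj hj'

end IntegralMatrices

/-! ### The Iwasawa and Cartan decompositions and the inequality between them. -/

section Decompositions

/-- Counting from 0, the i-th smallest of r distinct indices is at least i, so replacing it by i can
only increase the value of f. -/
lemma prod_comp_le_prod_castLE {r n : ℕ} (h : r ≤ n) (f : Fin n → ℝ) (hf : Antitone f)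
    (h0 : ∀ i, 0 ≤ f i) (σ : Fin r → Fin n) (hσ : Function.Injective σ) :
    ∏ i, f (σ i) ≤ ∏ i, f (Fin.castLE h i) := by
  have hc : (Finset.univ.image σ).card = r := by
    rw [Finset.card_image_of_injective _ hσ, Finset.card_univ, Fintype.card_fin]
  have e1 : ∏ i, f (σ i) = ∏ j ∈ Finset.univ.image σ, f j :=
    (Finset.prod_image fun a _ b _ hab => hσ hab).symm
  have e2 : ∏ j ∈ Finset.univ.image σ, f j =
      ∏ i, f ((Finset.univ.image σ).orderEmbOfFin hc i) := by
    conv_lhs => rw [← Finset.image_orderEmbOfFin_univ (Finset.univ.image σ) hc]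
    exact Finset.prod_image fun a _ b _ hab => (Finset.orderEmbOfFin _ hc).injective hab
  rw [e1, e2]
  refine Finset.prod_le_prod (fun _ _ => h0 _) fun i _ => hf ?_
  have key : ∀ m (hm : m < r), m ≤ ((Finset.univ.image σ).orderEmbOfFin hc ⟨m, hm⟩ : ℕ) := by
    intro m
    induction m with
    | zero => exact fun _ => Nat.zero_le _
    | succ m ih =>
      intro hm
      have h1 := ih (by omega)
      have h2 : (Finset.univ.image σ).orderEmbOfFin hc ⟨m, by omega⟩ <
          (Finset.univ.image σ).orderEmbOfFin hc ⟨m + 1, hm⟩ :=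
        (Finset.orderEmbOfFin _ hc).strictMono (by simp [Fin.lt_def])
      rw [Fin.lt_def] at h2
      omega
  exact key i i.2

variable {n : ℕ} {K : Type*} [NontriviallyNormedField K]

@[simp] lemma diag_val (a : Fin n → Kˣ) :
    (diag n K a : Matrix (Fin n) (Fin n) K) = Matrix.diagonal fun i => (a i : K) := rfl

lemma upper_of_unipotent {u : GL (Fin n) K} (hu : u ∈ unipotent n K) (a : Fin n → Kˣ) :
    (∀ i, ((diag n K a * u : GL (Fin n) K) : Matrix (Fin n) (Fin n) K) i i = a i) ∧
    ∀ i j, j < i → ((diag n K a * u : GL (Fin n) K) : Matrix (Fin n) (Fin n) K) i j = 0 := by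
  refine ⟨fun i => ?_, fun i j h => ?_⟩
  · rw [Units.val_mul, diag_val, Matrix.diagonal_mul, hu.1 i, mul_one]
  · rw [Units.val_mul, diag_val, Matrix.diagonal_mul, hu.2 i j h, mul_zero]

lemma exists_of_upperTriangular (g : GL (Fin n) K)
    (h : ∀ i j, j < i → (g : Matrix (Fin n) (Fin n) K) i j = 0) :
    ∃ a : Fin n → Kˣ, (∀ i, (a i : K) = (g : Matrix (Fin n) (Fin n) K) i i) ∧
      ∃ u ∈ unipotent n K, g = diag n K a * u := by
  have hd : (g : Matrix (Fin n) (Fin n) K).det ≠ 0 :=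
    ((Matrix.isUnit_iff_isUnit_det _).1 g.isUnit).ne_zero
  rw [Matrix.det_of_isUpperTriangular (fun i j hij => h i j hij), Finset.prod_ne_zero_iff] at hd
  let a : Fin n → Kˣ := fun i => Units.mk0 _ (hd i (Finset.mem_univ i))
  have ha : ∀ i, (a i : K) = (g : Matrix (Fin n) (Fin n) K) i i := fun i => rfl
  have e : (((diag n K a)⁻¹ * g : GL (Fin n) K) : Matrix (Fin n) (Fin n) K) =
      Matrix.diagonal (fun i => ((a i : K))⁻¹) * (g : Matrix (Fin n) (Fin n) K) := by
    rw [← map_inv, Units.val_mul, diag_val]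
    simp
  refine ⟨a, ha, (diag n K a)⁻¹ * g, ⟨fun i => ?_, fun i j hij => ?_⟩, by simp⟩
  · rw [e, Matrix.diagonal_mul, ← ha, inv_mul_cancel₀ (a i).ne_zero]
  · rw [e, Matrix.diagonal_mul, h i j hij, mul_zero]

lemma diag_conj_mem {u : GL (Fin n) K} (hu : u ∈ unipotent n K) (a : Fin n → Kˣ) :
    (diag n K a)⁻¹ * u * diag n K a ∈ unipotent n K := by
  have e : (((diag n K a)⁻¹ * u * diag n K a : GL (Fin n) K) : Matrix (Fin n) (Fin n) K) =
      Matrix.diagonal (fun i => ((a i : K))⁻¹) * (u : Matrix (Fin n) (Fin n) K) *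
        Matrix.diagonal fun i => (a i : K) := by
    rw [← map_inv, Units.val_mul, Units.val_mul, diag_val]
    simp
  refine ⟨fun i => ?_, fun i j h => ?_⟩
  · rw [e, Matrix.mul_diagonal, Matrix.diagonal_mul, hu.1 i, mul_one,
      inv_mul_cancel₀ (a i).ne_zero]
  · rw [e, Matrix.mul_diagonal, Matrix.diagonal_mul, hu.2 i j h]; simp

lemma modulus_congr {a b : Fin n → Kˣ} (h : ∀ i, ‖(a i : K)‖ = ‖(b i : K)‖) :
    modulus a = modulus b := by
  simp only [modulus, h]

lemma modulus_pos (a : Fin n → Kˣ) : 0 < modulus a :=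
  Finset.prod_pos fun i _ => zpow_pos (norm_pos_iff.2 (a i).ne_zero) _

lemma modulus_mul (a b : Fin n → Kˣ) : modulus (a * b) = modulus a * modulus b := by
  simp only [modulus, Pi.mul_apply, Units.val_mul, norm_mul, mul_zpow, Finset.prod_mul_distrib]

variable [IsUltrametricDist K]

/-- The Iwasawa decomposition. -/
lemma exists_iwasawa (g : GL (Fin n) K) : ∃ a : Fin n → Kˣ, ∃ u ∈ unipotent n K,
    ∃ k ∈ maxCompact n K, g = diag n K a * u * k := by
  obtain ⟨k, hk, h⟩ := exists_mul_upperTriangular (g : Matrix (Fin n) (Fin n) K)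
  obtain ⟨a, -, u, hu, e⟩ := exists_of_upperTriangular (g * k) h
  exact ⟨a, u, hu, k⁻¹, inv_mem hk, by rw [← e]; simp⟩

/-- The Cartan decomposition. -/
lemma exists_cartan (g : GL (Fin n) K) : ∃ d : Fin n → Kˣ, Antitone (fun i => ‖(d i : K)‖) ∧
    ∃ k ∈ maxCompact n K, ∃ l ∈ maxCompact n K, g = k * diag n K d * l := by
  obtain ⟨k, hk, l, hl, B, e, h1, h2⟩ :=
    exists_mul_mul_diagonal (g : Matrix (Fin n) (Fin n) K)
  have hB : ((k * g * l : GL (Fin n) K) : Matrix (Fin n) (Fin n) K) = B := by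
    rw [← e]; simp
  obtain ⟨a, ha, -⟩ := exists_of_upperTriangular (k * g * l)
    (fun i j hij => by rw [hB, h1 i j hij.ne'])
  have hd : k * g * l = diag n K a := by
    refine Units.ext ?_
    ext i j
    rw [diag_val, Matrix.diagonal_apply]
    split_ifs with hij
    · subst hij; exact (ha i).symm
    · rw [hB, h1 i j hij]
  refine ⟨a, fun i j hij => ?_, k⁻¹, inv_mem hk, l⁻¹, inv_mem hl, ?_⟩
  · simp only [ha, hB]; exact h2 i j hij
  · rw [← hd]; group

/-- A Cauchy–Binet argument: expand the determinant multilinearly over maps σ. Terms with σ not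
injective have a repeated row and vanish; the others are bounded by a product of r distinct `‖d j‖`,
and the ultrametric inequality bounds the sum by the largest. -/
lemma norm_det_mul_diagonal_mul_le {r : ℕ} (h : r ≤ n) (A : Matrix (Fin r) (Fin n) K)
    (d : Fin n → K) (B : Matrix (Fin n) (Fin r) K) (hA : ∀ i j, ‖A i j‖ ≤ 1)
    (hB : ∀ i j, ‖B i j‖ ≤ 1) (hd : Antitone fun i => ‖d i‖) :
    ‖(A * Matrix.diagonal d * B).det‖ ≤ ∏ i, ‖d (Fin.castLE h i)‖ := by
  have e : (A * Matrix.diagonal d * B).det =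
      ∑ σ : Fin r → Fin n, (∏ i, A i (σ i) * d (σ i)) * (B.submatrix σ id).det := by
    have : A * Matrix.diagonal d * B =
        Matrix.of fun i => ∑ j, (A i j * d j) • B j := by
      ext i l
      rw [Matrix.mul_apply]
      simp only [Matrix.mul_diagonal, Matrix.of_apply, Finset.sum_apply, Pi.smul_apply,
        smul_eq_mul]
    rw [this]
    change Matrix.detRowAlternating (fun i => ∑ j, (A i j * d j) • B j) = _
    rw [← AlternatingMap.coe_multilinearMap, MultilinearMap.map_sum]
    refine Finset.sum_congr rfl fun σ _ => ?_
    rw [MultilinearMap.map_smul_univ]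
    rfl
  rw [e]
  refine IsUltrametricDist.norm_sum_le_of_forall_le_of_nonneg
    (Finset.prod_nonneg fun _ _ => norm_nonneg _) fun σ _ => ?_
  by_cases hσ : Function.Injective σ
  · rw [norm_mul, norm_prod]
    refine (mul_le_mul ((Finset.prod_le_prod (fun _ _ => norm_nonneg _) fun i _ => ?_).trans
      (prod_comp_le_prod_castLE h _ hd (fun _ => norm_nonneg _) σ hσ))
      (norm_det_le_one _ fun i j => hB _ _) (norm_nonneg _)
      (Finset.prod_nonneg fun _ _ => norm_nonneg _)).trans (mul_one _).le
    rw [norm_mul]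
    exact mul_le_of_le_one_left (norm_nonneg _) (hA _ _)
  · rw [Function.not_injective_iff] at hσ
    obtain ⟨i, j, hij, hne⟩ := hσ
    rw [Matrix.det_zero_of_row_eq hne (by ext l; simp [hij]), mul_zero, norm_zero]
    exact Finset.prod_nonneg fun _ _ => norm_nonneg _

/-- The dominance inequality between the Iwasawa and the Cartan components. -/
lemma prod_norm_iwasawa_le_cartan {a d : Fin n → Kˣ} {u k l : GL (Fin n) K}
    (hu : u ∈ unipotent n K) (hk : k ∈ maxCompact n K) (hl : l ∈ maxCompact n K)
    (hd : Antitone fun i => ‖(d i : K)‖) (e : diag n K a * u = k * diag n K d * l)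
    {r : ℕ} (h : r ≤ n) :
    ∏ i : Fin r, ‖(a (Fin.castLE h i) : K)‖ ≤ ∏ i : Fin r, ‖(d (Fin.castLE h i) : K)‖ := by
  have hk' := ((mem_maxCompact_iff k).1 hk).1
  have hl' := ((mem_maxCompact_iff l).1 hl).1
  have key := norm_det_mul_diagonal_mul_le h
    ((k : Matrix (Fin n) (Fin n) K).submatrix (Fin.castLE h) id) (fun i => (d i : K))
    ((l : Matrix (Fin n) (Fin n) K).submatrix id (Fin.castLE h))
    (fun i j => hk' _ _) (fun i j => hl' _ _) hd
  -- Both sides are the leading r×r block of the same matrix. It is upper triangular on the Iwasawa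
  -- side, so its minor is the product of the first r entries of a.
  have e2 : (k : Matrix (Fin n) (Fin n) K).submatrix (Fin.castLE h) id *
      Matrix.diagonal (fun i => (d i : K)) *
      (l : Matrix (Fin n) (Fin n) K).submatrix id (Fin.castLE h) =
      ((diag n K a * u : GL (Fin n) K) : Matrix (Fin n) (Fin n) K).submatrix
        (Fin.castLE h) (Fin.castLE h) := by
    rw [e, Units.val_mul, Units.val_mul, diag_val]
    rfl
  have hT := upper_of_unipotent hu a
  have hU : (((diag n K a * u : GL (Fin n) K) : Matrix (Fin n) (Fin n) K).submatrix
      (Fin.castLE h) (Fin.castLE h)).IsUpperTriangular := fun i j hij => hT.2 _ _ hij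
  rw [e2, Matrix.det_of_isUpperTriangular hU, norm_prod] at key
  simp only [Matrix.submatrix_apply, hT.1] at key
  exact key

/-- Uniqueness in the Iwasawa decomposition. -/
lemma norm_eq_of_iwasawa {a b : Fin n → Kˣ} {u v k l : GL (Fin n) K}
    (hu : u ∈ unipotent n K) (hv : v ∈ unipotent n K)
    (hk : k ∈ maxCompact n K) (hl : l ∈ maxCompact n K)
    (e : diag n K a * u * k = diag n K b * v * l) (i : Fin n) : ‖(a i : K)‖ = ‖(b i : K)‖ := by
  have main : ∀ {a b : Fin n → Kˣ} {u v k l : GL (Fin n) K}, u ∈ unipotent n K →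
      v ∈ unipotent n K → k ∈ maxCompact n K → l ∈ maxCompact n K →
      diag n K a * u * k = diag n K b * v * l → ‖(a i : K)‖ ≤ ‖(b i : K)‖ := by
    intro a b u v k l hu hv hk hl e
    -- A normalizes N, so `b⁻¹ * a` is the diagonal of an upper triangular element of K₀ and has
    -- integral entries.
    have hm : diag n K (b⁻¹ * a) * (((diag n K (b⁻¹ * a))⁻¹ * v⁻¹ * diag n K (b⁻¹ * a)) * u) =
        l * k⁻¹ := by
      rw [eq_mul_inv_iff_mul_eq]
      have : l = v⁻¹ * (diag n K b)⁻¹ * (diag n K a * u * k) := by rw [e]; group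
      rw [this, map_mul, map_inv]; group
    have h1 := (upper_of_unipotent (mul_mem (diag_conj_mem (inv_mem hv) (b⁻¹ * a)) hu)
      (b⁻¹ * a)).1 i
    rw [hm] at h1
    have h2 := ((mem_maxCompact_iff _).1 (mul_mem hl (inv_mem hk))).1 i i
    rw [h1] at h2
    simp only [Pi.mul_apply, Pi.inv_apply, Units.val_mul, Units.val_inv_eq_inv_val, norm_mul,
      norm_inv] at h2
    rwa [inv_mul_le_one₀ (norm_pos_iff.2 (b i).ne_zero)] at h2
  exact le_antisymm (main hu hv hk hl e) (main hv hu hl hk e.symm)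

lemma mem_diagCompact_iff (a : Fin n → Kˣ) : a ∈ diagCompact n K ↔ ∀ i, ‖(a i : K)‖ = 1 := by
  constructor
  · intro h i
    have := norm_eq_of_iwasawa (a := a) (b := 1) (one_mem _) (one_mem _) (one_mem _)
      (show diag n K a ∈ maxCompact n K from h) (by simp) i
    simpa using this
  · intro h
    refine mem_maxCompact_of_norm_det (fun i j => ?_) ?_
    · rw [diag_val, Matrix.diagonal_apply]
      split_ifs
      · exact (h i).le
      · simp
    · rw [diag_val, Matrix.det_diagonal, norm_prod]
      exact Finset.prod_eq_one fun i _ => h i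

lemma lattice_mk_eq_iff (a b : Fin n → Kˣ) :
    (QuotientGroup.mk a : Lattice n K) = QuotientGroup.mk b ↔ ∀ i, ‖(a i : K)‖ = ‖(b i : K)‖ := by
  rw [QuotientGroup.eq, mem_diagCompact_iff]
  refine forall_congr' fun i => ?_
  simp only [Pi.mul_apply, Pi.inv_apply, Units.val_mul, Units.val_inv_eq_inv_val, norm_mul,
    norm_inv]
  rw [inv_mul_eq_one₀ (norm_ne_zero_iff.2 (a i).ne_zero)]

variable (n K) in
/-- The space `GL_n(K) / GL_n(𝒪)` of lattices in `K^n`. -/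
abbrev CosetSpace : Type _ := GL (Fin n) K ⧸ maxCompact n K

noncomputable section

variable (n K) in
/-- A copy of the lattice `λ`, carrying a single commutative group structure. -/
def LatticeGroup : Type _ := Lattice n K

instance : CommGroup (LatticeGroup n K) :=
  inferInstanceAs (CommGroup ((Fin n → Kˣ) ⧸ diagCompact n K))

/-- The class of a diagonal matrix in `λ`. -/
def latticeMk : (Fin n → Kˣ) →* LatticeGroup n K where
  toFun a := (QuotientGroup.mk a : Lattice n K)
  map_one' := rfl
  map_mul' _ _ := rfl

lemma latticeMk_surjective : Function.Surjective (latticeMk (n := n) (K := K)) :=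
  QuotientGroup.mk_surjective

lemma latticeMk_eq_iff (a b : Fin n → Kˣ) :
    latticeMk a = latticeMk b ↔ ∀ i, ‖(a i : K)‖ = ‖(b i : K)‖ :=
  lattice_mk_eq_iff a b

/-- The class in `λ` of the diagonal part of `g` in the Iwasawa decomposition. -/
def iwasawaPart (g : GL (Fin n) K) : LatticeGroup n K :=
  latticeMk (exists_iwasawa g).choose

lemma iwasawaPart_eq {a : Fin n → Kˣ} {u k : GL (Fin n) K} (hu : u ∈ unipotent n K)
    (hk : k ∈ maxCompact n K) : iwasawaPart (diag n K a * u * k) = latticeMk a := by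
  obtain ⟨v, hv, l, hl, e⟩ := (exists_iwasawa (diag n K a * u * k)).choose_spec
  rw [iwasawaPart, latticeMk_eq_iff]
  exact norm_eq_of_iwasawa hv hu hl hk e.symm

lemma iwasawaPart_mul_right (g : GL (Fin n) K) {k : GL (Fin n) K} (hk : k ∈ maxCompact n K) :
    iwasawaPart (g * k) = iwasawaPart g := by
  obtain ⟨a, u, hu, l, hl, rfl⟩ := exists_iwasawa g
  rw [mul_assoc, iwasawaPart_eq hu (mul_mem hl hk), iwasawaPart_eq hu hl]

lemma iwasawaPart_borel_mul (a : Fin n → Kˣ) {u : GL (Fin n) K} (hu : u ∈ unipotent n K)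
    (g : GL (Fin n) K) :
    iwasawaPart (diag n K a * u * g) = latticeMk a * iwasawaPart g := by
  obtain ⟨b, v, hv, l, hl, rfl⟩ := exists_iwasawa g
  have e : diag n K a * u * (diag n K b * v * l) =
      diag n K (a * b) * (((diag n K b)⁻¹ * u * diag n K b) * v) * l := by
    rw [map_mul]; group
  rw [e, iwasawaPart_eq (mul_mem (diag_conj_mem hu b) hv) hl, iwasawaPart_eq hv hl, map_mul]

/-- The Iwasawa class on `GL_n(K) / GL_n(𝒪)`. -/
def cosetIwasawa (x : CosetSpace n K) : LatticeGroup n K := iwasawaPart x.out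

lemma cosetIwasawa_mk (g : GL (Fin n) K) :
    cosetIwasawa (QuotientGroup.mk g : CosetSpace n K) = iwasawaPart g := by
  obtain ⟨k, hk⟩ := QuotientGroup.mk_out_eq_mul (maxCompact n K) g
  rw [cosetIwasawa, hk, iwasawaPart_mul_right g k.2]

/-- The diagonal representative may be prescribed: a change by t in A ∩ K₀ is moved to the right
past the unipotent factor, which it conjugates, and is absorbed in K₀. -/
lemma exists_eq_mk_of_cosetIwasawa {x : CosetSpace n K} {a : Fin n → Kˣ}
    (h : cosetIwasawa x = latticeMk a) :
    ∃ u ∈ unipotent n K, x = QuotientGroup.mk (diag n K a * u) := by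
  obtain ⟨g, rfl⟩ := QuotientGroup.mk_surjective x
  obtain ⟨b, v, hv, l, hl, rfl⟩ := exists_iwasawa g
  rw [cosetIwasawa_mk, iwasawaPart_eq hv hl] at h
  replace h := (QuotientGroup.eq (s := diagCompact n K)).1 h
  set t := b⁻¹ * a with ht
  have hat : b = a * t⁻¹ := by rw [ht]; group
  have ht' : diag n K t ∈ maxCompact n K := h
  refine ⟨(diag n K t)⁻¹ * v * diag n K t, diag_conj_mem hv t, ?_⟩
  rw [QuotientGroup.eq, hat]
  have : (diag n K (a * t⁻¹) * v * l)⁻¹ * (diag n K a * ((diag n K t)⁻¹ * v * diag n K t)) =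
      l⁻¹ * diag n K t := by
    rw [map_mul, map_inv]; group
  rw [this]
  exact mul_mem (inv_mem hl) ht'

lemma exists_rep_borel (x : CosetSpace n K) : ∃ a : Fin n → Kˣ, ∃ u ∈ unipotent n K,
    x = QuotientGroup.mk (diag n K a * u) ∧ cosetIwasawa x = latticeMk a := by
  obtain ⟨a, ha⟩ := latticeMk_surjective (cosetIwasawa x)
  obtain ⟨u, hu, e⟩ := exists_eq_mk_of_cosetIwasawa ha.symm
  exact ⟨a, u, hu, e, ha.symm⟩

lemma cosetIwasawa_borel_smul (a : Fin n → Kˣ) {u : GL (Fin n) K} (hu : u ∈ unipotent n K)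
    (x : CosetSpace n K) :
    cosetIwasawa ((diag n K a * u) • x) = latticeMk a * cosetIwasawa x := by
  obtain ⟨g, rfl⟩ := QuotientGroup.mk_surjective x
  change cosetIwasawa (QuotientGroup.mk (diag n K a * u * g)) = _
  rw [cosetIwasawa_mk, cosetIwasawa_mk, iwasawaPart_borel_mul a hu]

/-- The square root of the modulus as a function on `λ`. -/
def sqrtModulus (l : LatticeGroup n K) : ℝ :=
  Real.sqrt (modulus (latticeMk_surjective l).choose)

lemma sqrtModulus_mk (a : Fin n → Kˣ) :
    sqrtModulus (latticeMk a) = Real.sqrt (modulus a) := by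
  rw [sqrtModulus, modulus_congr ((latticeMk_eq_iff _ a).1
    (latticeMk_surjective (latticeMk a)).choose_spec)]

lemma sqrtModulus_mul (l m : LatticeGroup n K) :
    sqrtModulus (l * m) = sqrtModulus l * sqrtModulus m := by
  obtain ⟨a, rfl⟩ := latticeMk_surjective l
  obtain ⟨b, rfl⟩ := latticeMk_surjective m
  rw [← map_mul, sqrtModulus_mk, sqrtModulus_mk, sqrtModulus_mk, modulus_mul,
    Real.sqrt_mul (modulus_pos a).le]

lemma sqrtModulus_pos (l : LatticeGroup n K) : 0 < sqrtModulus l := Real.sqrt_pos.2 (modulus_pos _)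

end

end Decompositions

noncomputable section

/-! ### The Hecke algebra on finitely supported functions of cosets, and the Satake transform. -/

section HeckeModule

variable {n : ℕ} {K : Type*} [NontriviallyNormedField K] [IsUltrametricDist K]

variable (n K) in
/-- Left translation on finitely supported functions on `GL_n(K) / GL_n(𝒪)`. -/
def translate : GL (Fin n) K →* Module.End ℂ (CosetSpace n K →₀ ℂ) where
  toFun g := Finsupp.lmapDomain ℂ ℂ (g • ·)
  map_one' := by
    refine LinearMap.ext fun f => ?_
    simp only [one_smul]
    exact Finsupp.mapDomain_id
  map_mul' g h := by
    refine LinearMap.ext fun f => ?_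
    rw [Module.End.mul_apply, Finsupp.lmapDomain_apply, Finsupp.lmapDomain_apply,
      Finsupp.lmapDomain_apply, ← Finsupp.mapDomain_comp]
    congr 1
    funext x
    exact mul_smul g h x

lemma translate_single (g : GL (Fin n) K) (x : CosetSpace n K) (c : ℂ) :
    translate n K g (Finsupp.single x c) = Finsupp.single (g • x) c :=
  Finsupp.mapDomain_single

lemma translate_apply_smul (g : GL (Fin n) K) (f : CosetSpace n K →₀ ℂ) (x : CosetSpace n K) :
    translate n K g f (g • x) = f x :=
  Finsupp.mapDomain_apply (MulAction.injective g) f x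

variable (n K) in
/-- The Hecke algebra, as the space of finitely supported functions on
`GL_n(K) / GL_n(𝒪)` that are invariant under `GL_n(𝒪)`. -/
def heckeSubmodule : Submodule ℂ (CosetSpace n K →₀ ℂ) :=
  ⨅ k : maxCompact n K, LinearMap.eqLocus (translate n K k) LinearMap.id

lemma mem_heckeSubmodule {f : CosetSpace n K →₀ ℂ} :
    f ∈ heckeSubmodule n K ↔ ∀ k ∈ maxCompact n K, translate n K k f = f := by
  simp [heckeSubmodule]

lemma mem_heckeSubmodule_iff {f : CosetSpace n K →₀ ℂ} :
    f ∈ heckeSubmodule n K ↔ ∀ k ∈ maxCompact n K, ∀ x, f (k • x) = f x := by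
  rw [mem_heckeSubmodule]
  refine ⟨fun h k hk x => ?_, fun h k hk => ?_⟩
  · conv_lhs => rw [← h k hk]
    exact translate_apply_smul k f x
  · ext x
    have := translate_apply_smul k f (k⁻¹ • x)
    rw [smul_inv_smul] at this
    rw [this, h _ (inv_mem hk)]

variable {M : Type*} [AddCommGroup M] [Module ℂ M] (ρ : GL (Fin n) K →* Module.End ℂ M)

/-- The action of finitely supported functions on `GL_n(K) / GL_n(𝒪)` on a vector. -/
def cosetAction (m : M) : (CosetSpace n K →₀ ℂ) →ₗ[ℂ] M :=
  Finsupp.linearCombination ℂ fun x => ρ x.out m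

lemma cosetAction_single (m : M) (x : CosetSpace n K) (c : ℂ) :
    cosetAction ρ m (Finsupp.single x c) = c • ρ x.out m := by
  simp [cosetAction]

variable {ρ} in
lemma apply_out_mk {m : M} (hm : ∀ k ∈ maxCompact n K, ρ k m = m) (g : GL (Fin n) K) :
    ρ (QuotientGroup.mk g : CosetSpace n K).out m = ρ g m := by
  obtain ⟨k, hk⟩ := QuotientGroup.mk_out_eq_mul (maxCompact n K) g
  rw [hk, map_mul, Module.End.mul_apply, hm k k.2]

variable {ρ} in
lemma apply_out_smul {m : M} (hm : ∀ k ∈ maxCompact n K, ρ k m = m) (g : GL (Fin n) K)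
    (x : CosetSpace n K) : ρ (g • x).out m = ρ g (ρ x.out m) := by
  have e : g • x = QuotientGroup.mk (g * x.out) := by
    conv_lhs => rw [← QuotientGroup.out_eq' x]
    rfl
  rw [e, apply_out_mk hm, map_mul, Module.End.mul_apply]

variable {ρ} in
lemma cosetAction_translate {m : M} (hm : ∀ k ∈ maxCompact n K, ρ k m = m) (g : GL (Fin n) K)
    (f : CosetSpace n K →₀ ℂ) :
    cosetAction ρ m (translate n K g f) = ρ g (cosetAction ρ m f) := by
  induction f using Finsupp.induction_linear with
  | zero => simp
  | add f₁ f₂ h₁ h₂ => rw [map_add, map_add, map_add, map_add, h₁, h₂]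
  | single x c =>
    rw [translate_single, cosetAction_single, cosetAction_single, apply_out_smul hm, map_smul]

variable {ρ} in
lemma cosetAction_fixed {m : M} (hm : ∀ k ∈ maxCompact n K, ρ k m = m)
    {f : CosetSpace n K →₀ ℂ} (hf : f ∈ heckeSubmodule n K) :
    ∀ k ∈ maxCompact n K, ρ k (cosetAction ρ m f) = cosetAction ρ m f := fun k hk => by
  rw [← cosetAction_translate hm, mem_heckeSubmodule.1 hf k hk]

/-- Convolution. -/
def conv (f g : CosetSpace n K →₀ ℂ) : CosetSpace n K →₀ ℂ := cosetAction (translate n K) g f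

lemma conv_mem {f g : CosetSpace n K →₀ ℂ} (hf : f ∈ heckeSubmodule n K)
    (hg : g ∈ heckeSubmodule n K) : conv f g ∈ heckeSubmodule n K :=
  mem_heckeSubmodule.2 (cosetAction_fixed (mem_heckeSubmodule.1 hg) hf)

variable {ρ} in
-- Convolution acts as composition, with g applied before f. By linearity in f it is enough to treat
-- a point mass, where this is equivariance.
lemma cosetAction_conv {m : M} (hm : ∀ k ∈ maxCompact n K, ρ k m = m)
    (f g : CosetSpace n K →₀ ℂ) :
    cosetAction ρ m (conv f g) = cosetAction ρ (cosetAction ρ m g) f := by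
  induction f using Finsupp.induction_linear with
  | zero => simp [conv]
  | add f₁ f₂ h₁ h₂ =>
    simp only [conv, map_add] at h₁ h₂ ⊢
    rw [h₁, h₂]
  | single x c =>
    rw [conv, cosetAction_single, cosetAction_single, map_smul, cosetAction_translate hm]

variable (n K) in
/-- The Satake transform. -/
def satakeMap : (CosetSpace n K →₀ ℂ) →ₗ[ℂ] MonoidAlgebra ℂ (LatticeGroup n K) :=
  Finsupp.linearCombination ℂ fun x =>
    MonoidAlgebra.single (cosetIwasawa x) (sqrtModulus (cosetIwasawa x) : ℂ)

lemma satakeMap_single (x : CosetSpace n K) (c : ℂ) :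
    satakeMap n K (Finsupp.single x c) =
      c • MonoidAlgebra.single (cosetIwasawa x) (sqrtModulus (cosetIwasawa x) : ℂ) := by
  simp [satakeMap]

/-- The Iwasawa class and δ^{1/2} are both multiplicative under left translation by the Borel
subgroup AN. -/
lemma satakeMap_translate (a : Fin n → Kˣ) {u : GL (Fin n) K} (hu : u ∈ unipotent n K)
    (f : CosetSpace n K →₀ ℂ) :
    satakeMap n K (translate n K (diag n K a * u) f) =
      MonoidAlgebra.single (latticeMk a)
        (sqrtModulus (latticeMk a) : ℂ) * satakeMap n K f := by
  induction f using Finsupp.induction_linear with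
  | zero => simp
  | add f₁ f₂ h₁ h₂ => simp only [map_add, h₁, h₂, mul_add]
  | single x c =>
    rw [translate_single, satakeMap_single, satakeMap_single, cosetIwasawa_borel_smul a hu,
      sqrtModulus_mul, mul_smul_comm, MonoidAlgebra.single_mul_single, Complex.ofReal_mul]

/-- Every coset has a representative in AN, and by invariance of g the translate of g depends only
on the coset; so the convolution is a combination of Borel translates of g. -/
lemma satakeMap_conv (f : CosetSpace n K →₀ ℂ) {g : CosetSpace n K →₀ ℂ}
    (hg : g ∈ heckeSubmodule n K) :
    satakeMap n K (conv f g) = satakeMap n K f * satakeMap n K g := by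
  induction f using Finsupp.induction_linear with
  | zero => simp [conv]
  | add f₁ f₂ h₁ h₂ =>
    simp only [conv, map_add] at h₁ h₂ ⊢
    rw [h₁, h₂, add_mul]
  | single x c =>
    obtain ⟨a, u, hu, rfl, hx⟩ := exists_rep_borel x
    rw [conv, cosetAction_single, apply_out_mk (mem_heckeSubmodule.1 hg), map_smul,
      satakeMap_translate a hu, satakeMap_single, hx, smul_mul_assoc]

open Classical in
lemma coeff_satakeMap (f : CosetSpace n K →₀ ℂ) (l : LatticeGroup n K) :
    (satakeMap n K f).coeff l =
      (∑ x ∈ f.support with cosetIwasawa x = l, f x) * (sqrtModulus l : ℂ) := by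
  rw [satakeMap, Finsupp.linearCombination_apply, Finsupp.sum, MonoidAlgebra.coeff_sum,
    Finsupp.finsetSum_apply, Finset.sum_mul, Finset.sum_filter]
  refine Finset.sum_congr rfl fun x _ => ?_
  rw [MonoidAlgebra.coeff_smul, MonoidAlgebra.coeff_single, Finsupp.smul_apply,
    Finsupp.single_apply]
  split_ifs with h
  · rw [h, smul_eq_mul]
  · simp

/-- The product of the first `r` norms. -/
def partialNorm (d : Fin n → Kˣ) (r : Fin (n + 1)) : ℝ :=
  ∏ i : Fin r, ‖(d (Fin.castLE (Nat.lt_succ_iff.1 r.2) i) : K)‖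

lemma partialNorm_pos (d : Fin n → Kˣ) (r : Fin (n + 1)) : 0 < partialNorm d r :=
  Finset.prod_pos fun _ _ => norm_pos_iff.2 (Units.ne_zero _)

lemma norm_eq_of_partialNorm_eq {a d : Fin n → Kˣ}
    (h : ∀ r, partialNorm a r = partialNorm d r) (i : Fin n) : ‖(a i : K)‖ = ‖(d i : K)‖ := by
  have key : ∀ d : Fin n → Kˣ, partialNorm d i.succ = partialNorm d i.castSucc * ‖(d i : K)‖ := by
    intro d
    have := Fin.prod_univ_castSucc
      (fun j : Fin ((i : ℕ) + 1) => ‖(d (Fin.castLE (by have := i.2; omega) j) : K)‖)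
    exact this
  have h1 := h i.succ
  rw [key, key, h i.castSucc] at h1
  exact mul_left_cancel₀ (partialNorm_pos _ _).ne' h1

/-- Converts the dominance order into one real number that can be maximized: equality of the
products forces equality of every partial product, and the individual norms are their successive
ratios. -/
lemma norm_eq_of_prod_partialNorm_le {a d : Fin n → Kˣ}
    (h : ∀ r, partialNorm a r ≤ partialNorm d r)
    (h' : ∏ r, partialNorm d r ≤ ∏ r, partialNorm a r) (i : Fin n) :
    ‖(a i : K)‖ = ‖(d i : K)‖ := by
  refine norm_eq_of_partialNorm_eq (fun r => ?_) i
  by_contra hne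
  exact absurd h' (not_le.2 (Finset.prod_lt_prod (fun r _ => partialNorm_pos _ _) (fun r _ => h r)
    ⟨r, Finset.mem_univ _, lt_of_le_of_ne (h r) hne⟩))

lemma mk_diag_eq {a d : Fin n → Kˣ} (h : ∀ i, ‖(a i : K)‖ = ‖(d i : K)‖) :
    (QuotientGroup.mk (diag n K a) : CosetSpace n K) = QuotientGroup.mk (diag n K d) := by
  rw [QuotientGroup.eq, ← map_inv, ← map_mul]
  exact (QuotientGroup.eq (s := diagCompact n K)).1 ((lattice_mk_eq_iff a d).2 h)

lemma exists_cartan_coset (x : CosetSpace n K) : ∃ d : Fin n → Kˣ,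
    Antitone (fun i => ‖(d i : K)‖) ∧ ∃ k ∈ maxCompact n K,
      x = k • (QuotientGroup.mk (diag n K d) : CosetSpace n K) := by
  obtain ⟨g, rfl⟩ := QuotientGroup.mk_surjective x
  obtain ⟨d, hd, k, hk, l, hl, rfl⟩ := exists_cartan g
  exact ⟨d, hd, k, hk, QuotientGroup.mk_mul_of_mem _ hl⟩

/-- The Satake transform is injective on the Hecke algebra. -/
lemma eq_zero_of_satakeMap_eq_zero {f : CosetSpace n K →₀ ℂ} (hf : f ∈ heckeSubmodule n K)
    (h0 : satakeMap n K f = 0) : f = 0 := by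
  classical
  by_contra hne
  choose d hd k hk hx using exists_cartan_coset (n := n) (K := K)
  have hf' := mem_heckeSubmodule_iff.1 hf
  have hfd : ∀ x, f x = f (QuotientGroup.mk (diag n K (d x))) := fun x => by
    conv_lhs => rw [hx x]
    exact hf' _ (hk x) _
  -- A support point with a maximal Cartan component. The coefficient of the transform at that
  -- component will turn out to be a positive multiple of f x.
  obtain ⟨x, hxs, hmax⟩ := Finset.exists_max_image f.support
    (fun x => ∏ r, partialNorm (d x) r) (Finsupp.support_nonempty_iff.2 hne)
  have hc := coeff_satakeMap f (latticeMk (d x))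
  rw [h0, MonoidAlgebra.coeff_zero, Finsupp.zero_apply, eq_comm, mul_eq_zero,
    or_iff_left (by exact_mod_cast (sqrtModulus_pos _).ne')] at hc
  -- If y has Iwasawa class d x, then d x is dominated by the Cartan component of y; maximality
  -- makes them equal, so y lies in the K₀-orbit on which f takes the value f x.
  have hall : ∀ y ∈ f.support.filter (fun y => cosetIwasawa y = latticeMk (d x)),
      f y = f x := by
    intro y hy
    obtain ⟨hys, hyi⟩ := Finset.mem_filter.1 hy
    obtain ⟨u, hu, hyu⟩ := exists_eq_mk_of_cosetIwasawa hyi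
    rw [hfd x, hfd y]
    congr 1
    refine (mk_diag_eq fun i => ?_).symm
    have e1 : (QuotientGroup.mk (k y * diag n K (d y)) : CosetSpace n K) =
        QuotientGroup.mk (diag n K (d x) * u) := by
      rw [← hyu]; exact (hx y).symm
    rw [QuotientGroup.eq] at e1
    refine norm_eq_of_prod_partialNorm_le (fun r => ?_) (hmax y hys) i
    exact prod_norm_iwasawa_le_cartan (l := (k y * diag n K (d y))⁻¹ * (diag n K (d x) * u))
      hu (hk y) e1 (hd y) (by group) _
  rw [Finset.sum_congr rfl hall, Finset.sum_const, nsmul_eq_mul, mul_eq_zero,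
    or_iff_left (Finsupp.mem_support_iff.1 hxs), Nat.cast_eq_zero, Finset.card_eq_zero] at hc
  -- The number of contributing cosets is not zero, because the diagonal coset itself contributes.
  refine Finset.eq_empty_iff_forall_notMem.1 hc (QuotientGroup.mk (diag n K (d x))) ?_
  rw [Finset.mem_filter, Finsupp.mem_support_iff, ← hfd x, cosetIwasawa_mk]
  refine ⟨Finsupp.mem_support_iff.1 hxs, ?_⟩
  have := iwasawaPart_eq (a := d x) (one_mem (unipotent n K)) (one_mem (maxCompact n K))
  simpa using this

/-- Inherited from the commutative algebra ℂ[λ] through the injective, multiplicative Satake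
transform. -/
lemma conv_comm {f g : CosetSpace n K →₀ ℂ} (hf : f ∈ heckeSubmodule n K)
    (hg : g ∈ heckeSubmodule n K) : conv f g = conv g f := by
  rw [← sub_eq_zero]
  refine eq_zero_of_satakeMap_eq_zero (Submodule.sub_mem _ (conv_mem hf hg) (conv_mem hg hf)) ?_
  rw [map_sub, satakeMap_conv _ hg, satakeMap_conv _ hf, mul_comm, sub_self]

end HeckeModule

/-! ### Haar integrals as finite sums over cosets. -/

section Integration

variable {n : ℕ} {K : Type*} [NontriviallyNormedField K] [IsUltrametricDist K]

instance : DiscreteTopology (CosetSpace n K) := QuotientGroup.discreteTopology isOpen_maxCompact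

lemma continuous_mk : Continuous (fun g : GL (Fin n) K => (QuotientGroup.mk g : CosetSpace n K)) :=
  continuous_quot_mk

lemma mk_preimage_singleton (x : CosetSpace n K) :
    (fun g : GL (Fin n) K => (QuotientGroup.mk g : CosetSpace n K)) ⁻¹' {x} =
      (fun g => x.out⁻¹ * g) ⁻¹' (maxCompact n K : Set (GL (Fin n) K)) := by
  ext g
  rw [Set.mem_preimage, Set.mem_singleton_iff, Set.mem_preimage, SetLike.mem_coe,
    ← QuotientGroup.eq, QuotientGroup.out_eq']
  exact eq_comm

lemma measurableSet_maxCompact : MeasurableSet (maxCompact n K : Set (GL (Fin n) K)) :=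
  isOpen_maxCompact.measurableSet

lemma measurableSet_mk_preimage (x : CosetSpace n K) :
    MeasurableSet ((fun g : GL (Fin n) K => (QuotientGroup.mk g : CosetSpace n K)) ⁻¹' {x}) :=
  ((isOpen_discrete _).preimage continuous_mk).measurableSet

variable [LocallyCompactSpace K]

instance : (haarG n K).IsMulLeftInvariant := by unfold haarG; infer_instance

instance : (haarN n K).IsMulLeftInvariant := by unfold haarN; infer_instance

instance : (haarG n K).IsHaarMeasure := by unfold haarG; infer_instance

lemma haarG_maxCompact : haarG n K (maxCompact n K : Set (GL (Fin n) K)) = 1 :=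
  Measure.haarMeasure_self

lemma haarN_maxCompact :
    haarN n K (Subtype.val ⁻¹' (maxCompact n K : Set (GL (Fin n) K))) = 1 :=
  Measure.haarMeasure_self

lemma isCompact_mk_preimage (x : CosetSpace n K) :
    IsCompact ((fun g : GL (Fin n) K => (QuotientGroup.mk g : CosetSpace n K)) ⁻¹' {x}) := by
  rw [mk_preimage_singleton]
  exact (Homeomorph.mulLeft x.out⁻¹).isClosedEmbedding.isCompact_preimage isCompact_maxCompact

variable {E : Type*} [NormedAddCommGroup E] [NormedSpace ℂ E]

lemma integrableOn_maxCompact {Ψ : GL (Fin n) K → E} (hΨ : Continuous Ψ) :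
    IntegrableOn Ψ (maxCompact n K : Set (GL (Fin n) K)) (haarG n K) :=
  hΨ.continuousOn.integrableOn_compact' isCompact_maxCompact measurableSet_maxCompact

lemma integrableOn_coset {Ψ : GL (Fin n) K → E} (hΨ : Continuous Ψ) (x : CosetSpace n K) :
    IntegrableOn Ψ ((fun g : GL (Fin n) K => (QuotientGroup.mk g : CosetSpace n K)) ⁻¹' {x})
      (haarG n K) :=
  hΨ.continuousOn.integrableOn_compact' (isCompact_mk_preimage x) (measurableSet_mk_preimage x)

lemma setIntegral_coset (Ψ : GL (Fin n) K → E) (x : CosetSpace n K) :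
    ∫ g in (fun g : GL (Fin n) K => (QuotientGroup.mk g : CosetSpace n K)) ⁻¹' {x}, Ψ g
      ∂(haarG n K) = ∫ k in (maxCompact n K : Set (GL (Fin n) K)), Ψ (x.out * k) ∂(haarG n K) := by
  rw [← integral_indicator (measurableSet_mk_preimage x),
    ← integral_indicator measurableSet_maxCompact,
    ← integral_mul_left_eq_self _ x.out]
  congr 1
  funext g
  rw [mk_preimage_singleton]
  classical
  simp only [Set.indicator_apply, Set.mem_preimage, inv_mul_cancel_left]

lemma smul_mk_eq_sum (F : CosetSpace n K →₀ ℂ) (Ψ : GL (Fin n) K → E) :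
    (fun g => F (QuotientGroup.mk g) • Ψ g) = fun g => ∑ x ∈ F.support, F x •
      ((fun g : GL (Fin n) K => (QuotientGroup.mk g : CosetSpace n K)) ⁻¹' {x}).indicator Ψ g := by
  classical
  funext g
  simp only [Set.indicator, Set.mem_preimage, Set.mem_singleton_iff, smul_ite, smul_zero,
    Finset.sum_ite_eq, Finsupp.mem_support_iff]
  split_ifs with h
  · rfl
  · rw [not_not.1 h, zero_smul]

lemma integrable_coset_smul (F : CosetSpace n K →₀ ℂ) {Ψ : GL (Fin n) K → E}
    (hΨ : Continuous Ψ) :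
    Integrable (fun g => F (QuotientGroup.mk g) • Ψ g) (haarG n K) := by
  rw [smul_mk_eq_sum]
  exact integrable_finsetSum _ fun x _ =>
    ((integrableOn_coset hΨ x).integrable_indicator (measurableSet_mk_preimage x)).smul _

lemma integral_coset_smul (F : CosetSpace n K →₀ ℂ) {Ψ : GL (Fin n) K → E}
    (hΨ : Continuous Ψ) :
    ∫ g, F (QuotientGroup.mk g) • Ψ g ∂(haarG n K) = ∑ x ∈ F.support, F x •
      ∫ k in (maxCompact n K : Set (GL (Fin n) K)), Ψ (x.out * k) ∂(haarG n K) := by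
  rw [smul_mk_eq_sum, integral_finsetSum F.support (f := fun x g => F x •
    ((fun g : GL (Fin n) K => (QuotientGroup.mk g : CosetSpace n K)) ⁻¹' {x}).indicator Ψ g)
    fun x _ => ((integrableOn_coset hΨ x).integrable_indicator (measurableSet_mk_preimage x)).smul _]
  refine Finset.sum_congr rfl fun x _ => ?_
  rw [integral_smul, integral_indicator (measurableSet_mk_preimage x), setIntegral_coset]

open Classical in
-- If x meets aN, the set is a left translate of N ∩ K₀, which has volume one; otherwise it is
-- empty.
lemma haarN_coset (a : Fin n → Kˣ) (x : CosetSpace n K) :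
    haarN n K {u | (QuotientGroup.mk (diag n K a * (u : GL (Fin n) K)) : CosetSpace n K) = x} =
      if cosetIwasawa x = latticeMk a then 1 else 0 := by
  split_ifs with h
  · obtain ⟨v, hv, rfl⟩ := exists_eq_mk_of_cosetIwasawa h
    rw [← haarN_maxCompact (n := n) (K := K),
      ← measure_preimage_mul (haarN n K) (⟨v, hv⟩ : unipotent n K)]
    congr 1
    ext u
    change (QuotientGroup.mk (diag n K a * (v * (u : GL (Fin n) K))) : CosetSpace n K) =
      QuotientGroup.mk (diag n K a * v) ↔ (u : GL (Fin n) K) ∈ maxCompact n K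
    rw [eq_comm, QuotientGroup.eq, ← mul_assoc (diag n K a) v, inv_mul_cancel_left]
  · convert measure_empty (μ := haarN n K)
    rw [Set.eq_empty_iff_forall_notMem]
    rintro u rfl
    refine h ?_
    rw [cosetIwasawa_mk]
    simpa using iwasawaPart_eq (a := a) u.2 (one_mem (maxCompact n K))

open Classical in
lemma satake_eq (F : CosetSpace n K →₀ ℂ) (a : Fin n → Kˣ) :
    satake (fun g => F (QuotientGroup.mk g)) a = (satakeMap n K F).coeff (latticeMk a) := by
  rw [coeff_satakeMap, satake, sqrtModulus_mk, mul_comm]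
  congr 1
  have e : (fun u : unipotent n K => F (QuotientGroup.mk (diag n K a * (u : GL (Fin n) K)))) =
      fun u => ∑ x ∈ F.support,
        Set.indicator {u : unipotent n K |
          (QuotientGroup.mk (diag n K a * (u : GL (Fin n) K)) : CosetSpace n K) = x}
          (fun _ => F x) u := by
    funext u
    simp only [Set.indicator, Set.mem_ofPred_eq, Finset.sum_ite_eq, Finsupp.mem_support_iff]
    split_ifs with h
    · rfl
    · exact not_not.1 h
  have hc : Continuous fun u : unipotent n K =>
      (QuotientGroup.mk (diag n K a * (u : GL (Fin n) K)) : CosetSpace n K) :=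
    continuous_mk.comp (continuous_const.mul continuous_subtype_val)
  have hm : ∀ x : CosetSpace n K, MeasurableSet {u : unipotent n K |
      (QuotientGroup.mk (diag n K a * (u : GL (Fin n) K)) : CosetSpace n K) = x} := fun x =>
    ((isOpen_discrete {x}).preimage hc).measurableSet
  rw [e, integral_finsetSum, Finset.sum_filter]
  · refine Finset.sum_congr rfl fun x _ => ?_
    rw [integral_indicator (hm x), setIntegral_const, measureReal_def, haarN_coset]
    split_ifs <;> simp
  · intro x _
    refine IntegrableOn.integrable_indicator ?_ (hm x)
    refine integrableOn_const ?_
    rw [haarN_coset]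
    split_ifs <;> simp

/-- A character of `λ` as a complex-valued homomorphism. -/
def charHom (χ : Lattice n K →* ℂˣ) : LatticeGroup n K →* ℂ where
  toFun l := (χ l : ℂ)
  map_one' := congrArg Units.val (map_one χ)
  map_mul' l m := congrArg Units.val (map_mul χ l m)

lemma heckeCharacter_eq (χ : Lattice n K →* ℂˣ) (F : CosetSpace n K →₀ ℂ) :
    heckeCharacter χ (fun g => F (QuotientGroup.mk g)) =
      MonoidAlgebra.lift ℂ ℂ (LatticeGroup n K) (charHom χ) (satakeMap n K F) := by
  rw [MonoidAlgebra.lift_apply, heckeCharacter, Finsupp.sum]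
  have e : ∀ l : Lattice n K, satake (fun g => F (QuotientGroup.mk g)) (Quotient.out l) *
      (χ l : ℂ) = (satakeMap n K F).coeff (l : LatticeGroup n K) • charHom χ l := by
    intro l
    rw [satake_eq]
    have : latticeMk (Quotient.out l) = (l : LatticeGroup n K) := QuotientGroup.out_eq' l
    rw [this]
    rfl
  simp only [e]
  exact finsum_eq_sum_of_support_subset _ fun l hl =>
    Finsupp.mem_support_iff.2 fun h0 => hl ((congrArg (· • charHom χ l) h0).trans (zero_smul ℂ _))

/-- The eigenvalue as a sum over cosets, a form that still makes sense for infinite support. -/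
lemma lift_satakeMap (ψ : LatticeGroup n K →* ℂ) (F : CosetSpace n K →₀ ℂ) :
    MonoidAlgebra.lift ℂ ℂ (LatticeGroup n K) ψ (satakeMap n K F) =
      F.sum fun x c => c * (sqrtModulus (cosetIwasawa x) * ψ (cosetIwasawa x)) := by
  induction F using Finsupp.induction_linear with
  | zero => simp
  | add f₁ f₂ h₁ h₂ =>
    rw [map_add, map_add, h₁, h₂, Finsupp.sum_add_index']
    · simp
    · intros; ring
  | single x c =>
    rw [satakeMap_single, map_smul, MonoidAlgebra.lift_single, Finsupp.sum_single_index (by simp)]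
    simp

/-- The coset space is discrete, so the compact support of f has finite image in it. -/
lemma exists_heckeSubmodule_of_isHecke {f : GL (Fin n) K → ℂ} (hf : IsHecke f) :
    ∃ F ∈ heckeSubmodule n K, f = fun g => F (QuotientGroup.mk g) := by
  let φ : CosetSpace n K → ℂ := fun x => f x.out
  have hφ : ∀ g, φ (QuotientGroup.mk g) = f g := fun g => by
    obtain ⟨k, hk⟩ := QuotientGroup.mk_out_eq_mul (maxCompact n K) g
    simp only [φ]
    rw [hk, hf.right_inv k k.2]
  have hfin : (Function.support φ).Finite := by
    refine ((hf.compactSupport.isCompact.image continuous_mk).finite_of_discrete).subset ?_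
    intro x hx
    exact ⟨x.out, subset_tsupport _ hx, QuotientGroup.out_eq' x⟩
  refine ⟨Finsupp.ofSupportFinite φ hfin, mem_heckeSubmodule_iff.2 fun k hk x => ?_, ?_⟩
  · obtain ⟨g, rfl⟩ := QuotientGroup.mk_surjective x
    change φ (QuotientGroup.mk (k * g)) = φ (QuotientGroup.mk g)
    rw [hφ, hφ, hf.left_inv k hk]
  · funext g
    exact (hφ g).symm

lemma isHecke_of_mem {F : CosetSpace n K →₀ ℂ} (hF : F ∈ heckeSubmodule n K) :
    IsHecke fun g : GL (Fin n) K => F (QuotientGroup.mk g) where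
  compactSupport := by
    refine HasCompactSupport.of_support_subset_isCompact
      (F.support.isCompact_biUnion fun x _ => isCompact_mk_preimage x) fun g hg => ?_
    simp only [Set.mem_iUnion]
    exact ⟨QuotientGroup.mk g, Finsupp.mem_support_iff.2 hg, rfl⟩
  left_inv k hk x := mem_heckeSubmodule_iff.1 hF k hk (QuotientGroup.mk x)
  right_inv k hk x := by rw [QuotientGroup.mk_mul_of_mem _ hk]

end Integration

/-! ### Hermite normal forms as representatives of the integral cosets. -/

section HermiteNormalForm

variable {n : ℕ} {K : Type*} [NontriviallyNormedField K] [IsUltrametricDist K]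

lemma isDiscreteValuationRing_integers [LocallyCompactSpace K] :
    IsDiscreteValuationRing 𝒪[K] := by
  have : ProperSpace K := ProperSpace.of_locallyCompactSpace K
  have : CompactSpace 𝒪[K] := by
    refine isCompact_iff_compactSpace.1 (?_ : IsCompact (𝒪[K] : Set K))
    convert isCompact_closedBall (0 : K) 1
    ext x
    simp [Valued.integer.mem_iff]
  have : (Valued.v : Valuation K NNReal).IsNontrivial := by
    obtain ⟨x, hx0, hx1⟩ := NormedField.exists_norm_lt_one K
    refine ⟨x, ?_, ?_⟩
    · simpa using hx0
    · intro h
      have h2 : (‖x‖₊ : NNReal) = 1 := h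
      exact hx1.ne (congrArg NNReal.toReal h2)
  exact Valued.integer.isDiscreteValuationRing_of_compactSpace

variable {ϖ : Kˣ}

lemma IsUniformizer.norm_lt_one (hϖ : IsUniformizer ϖ) : ‖(ϖ : K)‖ < 1 := by
  obtain ⟨p, hp, e⟩ := hϖ
  rw [← e]
  exact Valued.integer.norm_irreducible_lt_one hp

lemma norm_uniformizer_pos : 0 < ‖(ϖ : K)‖ := norm_pos_iff.2 ϖ.ne_zero

lemma IsUniformizer.norm_pow_injective (hϖ : IsUniformizer ϖ) :
    Function.Injective fun m : ℕ => ‖(ϖ : K)‖ ^ m :=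
  (pow_right_strictAnti₀ norm_uniformizer_pos hϖ.norm_lt_one).injective

variable [LocallyCompactSpace K]

lemma IsUniformizer.exists_norm_eq_pow (hϖ : IsUniformizer ϖ) {x : K} (hx : x ≠ 0)
    (h1 : ‖x‖ ≤ 1) : ∃ m : ℕ, ‖x‖ = ‖(ϖ : K)‖ ^ m := by
  have := isDiscreteValuationRing_integers (K := K)
  obtain ⟨p, hp, e⟩ := hϖ
  obtain ⟨m, u, hu⟩ := IsDiscreteValuationRing.eq_unit_mul_pow_irreducible
    (x := (⟨x, Valued.integer.mem_iff.2 h1⟩ : 𝒪[K]))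
    (by simpa [Subtype.ext_iff] using hx) hp
  refine ⟨m, ?_⟩
  have h2 := congrArg (fun y : 𝒪[K] => ‖(y : K)‖) hu
  simp only [Subring.coe_mul, Subring.coe_pow, norm_mul, norm_pow,
    Valued.integer.norm_coe_unit, one_mul] at h2
  rw [h2, e]

lemma IsUniformizer.exists_norm_eq_zpow (hϖ : IsUniformizer ϖ) (x : Kˣ) :
    ∃ m : ℤ, ‖(x : K)‖ = ‖(ϖ : K)‖ ^ m := by
  rcases le_total ‖(x : K)‖ 1 with h | h
  · obtain ⟨m, hm⟩ := hϖ.exists_norm_eq_pow x.ne_zero h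
    exact ⟨m, by rw [hm, zpow_natCast]⟩
  · obtain ⟨m, hm⟩ := hϖ.exists_norm_eq_pow (x := ((x⁻¹ : Kˣ) : K)) (Units.ne_zero _)
      (by rw [Units.val_inv_eq_inv_val, norm_inv]; exact inv_le_one_of_one_le₀ h)
    refine ⟨-m, ?_⟩
    rw [Units.val_inv_eq_inv_val, norm_inv] at hm
    rw [_root_.zpow_neg, zpow_natCast, ← hm, inv_inv]

lemma IsUniformizer.mem_maximalIdeal_pow_iff (hϖ : IsUniformizer ϖ) (y : 𝒪[K]) (m : ℕ) :
    y ∈ 𝓂[K] ^ m ↔ ‖(y : K)‖ ≤ ‖(ϖ : K)‖ ^ m := by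
  have := isDiscreteValuationRing_integers (K := K)
  obtain ⟨p, hp, e⟩ := hϖ
  rw [← SetLike.mem_coe, hp.maximalIdeal_pow_eq_closedBall_pow, mem_closedBall_zero_iff, ← e]
  rfl

lemma card_quotient_maximalIdeal_pow (m : ℕ) :
    Nat.card (𝒪[K] ⧸ 𝓂[K] ^ m) = residueCard K ^ m := by
  have := isDiscreteValuationRing_integers (K := K)
  have h := cardQuot_pow_of_prime (P := 𝓂[K]) (IsDiscreteValuationRing.not_a_field _) (i := m)
  rw [Submodule.cardQuot_apply, Submodule.cardQuot_apply] at h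
  exact h

variable (n K) in
/-- The entries above the diagonal in the Hermite normal form of an integral matrix. -/
abbrev HermiteData (l : Fin n → ℕ) : Type _ :=
  ∀ i : Fin n, {j : Fin n // i < j} → 𝒪[K] ⧸ 𝓂[K] ^ (l i)

lemma card_hermiteData (l : Fin n → ℕ) :
    Nat.card (HermiteData n K l) = ∏ i, residueCard K ^ (l i * (n - 1 - i)) := by
  rw [Nat.card_pi]
  refine Finset.prod_congr rfl fun i _ => ?_
  rw [Nat.card_fun, card_quotient_maximalIdeal_pow, ← pow_mul, Nat.card_eq_fintype_card,
    Fintype.card_subtype]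
  congr 2
  rw [← Fin.card_Ioi]
  congr 1
  ext j
  simp

variable (ϖ) in
/-- Upper triangular matrices in Hermite normal form. -/
def hermiteMatrix (l : Fin n → ℕ) (c : HermiteData n K l) : Matrix (Fin n) (Fin n) K :=
  -- Column operations by multiples of column i, whose pivot is `ϖ ^ l i`, change the entries of row
  -- i modulo that power, so these are fixed residue representatives.
  Matrix.of fun i j => if h : i < j then ((c i ⟨j, h⟩).out : K)
    else if i = j then (ϖ : K) ^ l i else 0

lemma hermiteMatrix_upper (l : Fin n → ℕ) (c : HermiteData n K l) {i j : Fin n} (h : j < i) :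
    hermiteMatrix ϖ l c i j = 0 := by
  simp [hermiteMatrix, h.not_gt, h.ne']

lemma hermiteMatrix_diag (l : Fin n → ℕ) (c : HermiteData n K l) (i : Fin n) :
    hermiteMatrix ϖ l c i i = (ϖ : K) ^ l i := by
  simp [hermiteMatrix]

lemma hermiteMatrix_lt (l : Fin n → ℕ) (c : HermiteData n K l) {i j : Fin n} (h : i < j) :
    hermiteMatrix ϖ l c i j = ((c i ⟨j, h⟩).out : K) := by
  simp [hermiteMatrix, h]

lemma det_hermiteMatrix (l : Fin n → ℕ) (c : HermiteData n K l) :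
    (hermiteMatrix ϖ l c).det = ∏ i, (ϖ : K) ^ l i := by
  have h : (hermiteMatrix ϖ l c).IsUpperTriangular := fun i j hij => hermiteMatrix_upper l c hij
  rw [Matrix.det_of_isUpperTriangular h]
  simp only [hermiteMatrix_diag]

lemma IsUniformizer.norm_hermiteMatrix_le (hϖ : IsUniformizer ϖ) (l : Fin n → ℕ)
    (c : HermiteData n K l) (i j : Fin n) : ‖hermiteMatrix ϖ l c i j‖ ≤ 1 := by
  rcases lt_trichotomy i j with h | rfl | h
  · rw [hermiteMatrix_lt l c h]; exact Valued.integer.norm_le_one _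
  · rw [hermiteMatrix_diag, norm_pow]
    exact pow_le_one₀ (norm_nonneg _) hϖ.norm_lt_one.le
  · rw [hermiteMatrix_upper l c h]; simp

variable (ϖ) in
/-- The Hermite normal form as an invertible matrix. -/
def hermite (l : Fin n → ℕ) (c : HermiteData n K l) : GL (Fin n) K :=
  Matrix.GeneralLinearGroup.mkOfDetNeZero (hermiteMatrix ϖ l c) (by
    rw [det_hermiteMatrix]
    exact Finset.prod_ne_zero_iff.2 fun i _ => pow_ne_zero _ ϖ.ne_zero)

lemma coe_hermite (l : Fin n → ℕ) (c : HermiteData n K l) :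
    (hermite ϖ l c : Matrix (Fin n) (Fin n) K) = hermiteMatrix ϖ l c := rfl

/-- The diagonal matrix `ϖ^l`. -/
abbrev powVec (ϖ : Kˣ) (l : Fin n → ℕ) : Fin n → Kˣ := fun i => ϖ ^ l i

lemma cosetIwasawa_hermite (l : Fin n → ℕ) (c : HermiteData n K l) :
    cosetIwasawa (QuotientGroup.mk (hermite ϖ l c) : CosetSpace n K) =
      latticeMk (powVec ϖ l) := by
  obtain ⟨a, ha, u, hu, e⟩ := exists_of_upperTriangular (hermite ϖ l c)
    fun i j hij => hermiteMatrix_upper l c hij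
  have h := iwasawaPart_eq (a := a) hu (one_mem (maxCompact n K))
  rw [mul_one, ← e] at h
  rw [cosetIwasawa_mk, h, latticeMk_eq_iff]
  intro i
  rw [ha, coe_hermite, hermiteMatrix_diag]
  simp

lemma mul_apply_upper {A B : Matrix (Fin n) (Fin n) K} (hA : ∀ i j, j < i → A i j = 0)
    (hB : ∀ i j, j < i → B i j = 0) {i j : Fin n} (h : i < j) :
    (A * B) i j = A i i * B i j + A i j * B j j + ∑ k ∈ Finset.Ioo i j, A i k * B k j := by
  rw [Matrix.mul_apply]
  have hsub : ∑ k, A i k * B k j = ∑ k ∈ Finset.Icc i j, A i k * B k j := by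
    refine (Finset.sum_subset (Finset.subset_univ _) fun k _ hk => ?_).symm
    rw [Finset.mem_Icc, not_and_or, not_le, not_le] at hk
    rcases hk with hk | hk
    · rw [hA i k hk, zero_mul]
    · rw [hB k j hk, mul_zero]
  rw [hsub, ← Finset.Ioc_insert_left h.le, Finset.sum_insert (by simp),
    ← Finset.Ioo_insert_right h, Finset.sum_insert (by simp)]
  ring

/-- The Iwasawa class recovers the diagonal. The transition matrix u between two forms with the same
diagonal is then integral and upper unipotent, and it is shown to be trivial one superdiagonal at a
time. -/
lemma IsUniformizer.hermite_injective (hϖ : IsUniformizer ϖ) :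
    Function.Injective fun x : (Σ l : Fin n → ℕ, HermiteData n K l) =>
      (QuotientGroup.mk (hermite ϖ x.1 x.2) : CosetSpace n K) := by
  rintro ⟨l, c⟩ ⟨l', c'⟩ h
  have hl : l = l' := by
    have h1 := congrArg cosetIwasawa h
    simp only [cosetIwasawa_hermite] at h1
    rw [latticeMk_eq_iff] at h1
    funext i
    refine hϖ.norm_pow_injective ?_
    simpa using h1 i
  subst hl
  congr 1
  simp only at h
  rw [QuotientGroup.eq] at h
  set u := (hermite ϖ l c)⁻¹ * hermite ϖ l c' with hu
  have he : hermiteMatrix ϖ l c * (u : Matrix (Fin n) (Fin n) K) = hermiteMatrix ϖ l c' := by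
    rw [← coe_hermite, ← coe_hermite, ← Units.val_mul, hu, mul_inv_cancel_left]
  have hA : ∀ i j, j < i → hermiteMatrix ϖ l c i j = 0 := fun i j => hermiteMatrix_upper l c
  have hA' : ∀ i j, j < i → hermiteMatrix ϖ l c' i j = 0 := fun i j => hermiteMatrix_upper l c'
  have hUp : ∀ i j, j < i → (u : Matrix (Fin n) (Fin n) K) i j = 0 := by
    have hB : (hermiteMatrix ϖ l c).BlockTriangular id := fun i j hij => hA i j hij
    have hB' : (hermiteMatrix ϖ l c').BlockTriangular id := fun i j hij => hA' i j hij
    have : Invertible (hermiteMatrix ϖ l c) := (hermite ϖ l c).isUnit.invertible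
    have h2 := (Matrix.blockTriangular_inv_of_blockTriangular hB).mul hB'
    have h3 : (u : Matrix (Fin n) (Fin n) K) =
        (hermiteMatrix ϖ l c)⁻¹ * hermiteMatrix ϖ l c' := by
      rw [hu, Units.val_mul, Matrix.coe_units_inv]; rfl
    rw [h3]
    exact fun i j hij => h2 hij
  have hdiag : ∀ i, (u : Matrix (Fin n) (Fin n) K) i i = 1 := by
    intro i
    have h1 := congrFun (congrFun he i) i
    rw [Matrix.mul_apply, Finset.sum_eq_single i, hermiteMatrix_diag, hermiteMatrix_diag] at h1
    · exact mul_left_cancel₀ (pow_ne_zero (l i) ϖ.ne_zero) (by rw [h1, mul_one])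
    · intro k _ hk
      rcases lt_or_gt_of_ne hk with hk | hk
      · rw [hA i k hk, zero_mul]
      · rw [hUp k i hk, mul_zero]
    · simp
  have hint := ((mem_maxCompact_iff u).1 h).1
  -- Once u vanishes nearer the diagonal, the (i, j) entry reads `ϖ ^ l i * u i j` = difference of
  -- two chosen representatives. Their classes agree, hence the representatives agree, hence `u i j
  -- = 0`.
  have key : ∀ m : ℕ, ∀ i j : Fin n, ∀ hij : i < j, (j : ℕ) - i ≤ m →
      (u : Matrix (Fin n) (Fin n) K) i j = 0 ∧ c i ⟨j, hij⟩ = c' i ⟨j, hij⟩ := by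
    intro m
    induction m with
    | zero => intro i j hij h; rw [Fin.lt_def] at hij; omega
    | succ m ih =>
      intro i j hij hm
      have h1 := congrFun (congrFun he i) j
      rw [mul_apply_upper hA hUp hij, hdiag, mul_one, hermiteMatrix_diag, hermiteMatrix_lt _ _ hij,
        hermiteMatrix_lt _ _ hij, Finset.sum_eq_zero, add_zero] at h1
      · have hc : c i ⟨j, hij⟩ = c' i ⟨j, hij⟩ := by
          rw [← Ideal.Quotient.mk_out (c i ⟨j, hij⟩), ← Ideal.Quotient.mk_out (c' i ⟨j, hij⟩),
            eq_comm, Ideal.Quotient.eq, hϖ.mem_maximalIdeal_pow_iff, AddSubgroupClass.coe_sub, ← h1,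
            add_sub_cancel_right, norm_mul, norm_pow]
          exact mul_le_of_le_one_right (by positivity) (hint i j)
        refine ⟨?_, hc⟩
        rw [hc, add_eq_right] at h1
        exact (mul_eq_zero.1 h1).resolve_left (pow_ne_zero _ ϖ.ne_zero)
      · intro k hk
        rw [Finset.mem_Ioo, Fin.lt_def, Fin.lt_def] at hk
        rw [(ih k j (Fin.lt_def.2 hk.2) (by omega)).1, mul_zero]
  refine funext fun i => funext fun j => ?_
  exact (key _ i j j.2 le_rfl).2

/-- Builds column j of a unipotent reducing matrix. Rows are treated from j - 1 upwards; changing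
the entry w p does not disturb the rows below p, since y is upper triangular. -/
lemma IsUniformizer.exists_column (hϖ : IsUniformizer ϖ) (l : Fin n → ℕ)
    (y : Matrix (Fin n) (Fin n) K) (hup : ∀ i j, j < i → y i j = 0)
    (hd : ∀ i, y i i = (ϖ : K) ^ l i) (hint : ∀ i j, ‖y i j‖ ≤ 1) (j : Fin n) :
    ∃ w : Fin n → K, w j = 1 ∧ (∀ i, j < i → w i = 0) ∧ (∀ i, ‖w i‖ ≤ 1) ∧
      ∀ i, i < j → ∃ c : 𝒪[K] ⧸ 𝓂[K] ^ (l i), ∑ k, y i k * w k = (c.out : K) := by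
  suffices H : ∀ m : ℕ, ∃ w : Fin n → K, w j = 1 ∧ (∀ i, j < i → w i = 0) ∧ (∀ i, ‖w i‖ ≤ 1) ∧
      ∀ i, i < j → (j : ℕ) ≤ i + m →
        ∃ c : 𝒪[K] ⧸ 𝓂[K] ^ (l i), ∑ k, y i k * w k = (c.out : K) by
    obtain ⟨w, h1, h2, h3, h4⟩ := H j
    exact ⟨w, h1, h2, h3, fun i hi => h4 i hi (by omega)⟩
  intro m
  induction m with
  | zero =>
    refine ⟨Pi.single j 1, by simp, fun i hi => by simp [hi.ne'], fun i => ?_, fun i hi h => ?_⟩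
    · by_cases h : i = j
      · subst h; simp
      · simp [h]
    · rw [Fin.lt_def] at hi; omega
  | succ m ih =>
    obtain ⟨w, h1, h2, h3, h4⟩ := ih
    by_cases hm : (j : ℕ) < m + 1
    · exact ⟨w, h1, h2, h3, fun i hi h => h4 i hi (by omega)⟩
    let p : Fin n := ⟨j - (m + 1), by have := j.2; omega⟩
    have hpj : p < j := by rw [Fin.lt_def]; simp only [p]; omega
    set w₀ := Function.update w p 0 with hw₀
    have hs : ‖∑ k, y p k * w₀ k‖ ≤ 1 := by
      refine IsUltrametricDist.norm_sum_le_of_forall_le_of_nonneg zero_le_one fun k _ => ?_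
      rw [norm_mul]
      refine mul_le_one₀ (hint _ _) (norm_nonneg _) ?_
      rw [hw₀, Function.update_apply]
      split_ifs
      · simp
      · exact h3 k
    set S : 𝒪[K] := ⟨∑ k, y p k * w₀ k, Valued.integer.mem_iff.2 hs⟩ with hS
    let c : 𝒪[K] ⧸ 𝓂[K] ^ (l p) := Ideal.Quotient.mk _ S
    have hc : c.out - S ∈ 𝓂[K] ^ (l p) := by
      rw [← Ideal.Quotient.eq, Ideal.Quotient.mk_out]
    rw [hϖ.mem_maximalIdeal_pow_iff, AddSubgroupClass.coe_sub] at hc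
    -- The entry that moves row p from S to the chosen representative of its class; it is integral
    -- because the difference lies in the `l p`-th power of the maximal ideal.
    set t : K := ((c.out : K) - (S : K)) / (ϖ : K) ^ l p with ht
    have hupd : ∀ i, ∑ k, y i k * Function.update w p t k =
        ∑ k, y i k * w₀ k + y i p * t := by
      intro i
      have e : Function.update w p t = w₀ + Pi.single p t := by
        funext k
        by_cases hk : k = p
        · subst hk; simp [hw₀]
        · simp [hw₀, hk]
      simp only [e, Pi.add_apply, mul_add, Finset.sum_add_distrib]
      congr 1
      rw [Finset.sum_eq_single p] <;> simp +contextual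
    have hupd' : ∀ i, ∑ k, y i k * w k = ∑ k, y i k * w₀ k + y i p * w p := by
      intro i
      have e : w = w₀ + Pi.single p (w p) := by
        funext k
        by_cases hk : k = p
        · subst hk; simp [hw₀]
        · simp [hw₀, hk]
      conv_lhs => rw [e]
      simp only [Pi.add_apply, mul_add, Finset.sum_add_distrib]
      congr 1
      rw [Finset.sum_eq_single p] <;> simp +contextual
    refine ⟨Function.update w p t, ?_, fun i hi => ?_, fun i => ?_, fun i hi hij => ?_⟩
    · rw [Function.update_of_ne hpj.ne', h1]
    · rw [Function.update_of_ne (hpj.trans hi).ne', h2 i hi]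
    · rw [Function.update_apply]
      split_ifs
      · rw [ht, norm_div, norm_pow]
        exact div_le_one_of_le₀ hc (by positivity)
      · exact h3 i
    · by_cases hip : i = p
      · subst hip
        refine ⟨c, ?_⟩
        rw [hupd, hd, ht, mul_div_cancel₀ _ (pow_ne_zero _ ϖ.ne_zero)]
        simp [hS]
      · have hpi : p < i := by
          have : (i : ℕ) ≠ p := fun e => hip (Fin.ext e)
          rw [Fin.lt_def]; simp only [p] at this ⊢; omega
        obtain ⟨c', hc'⟩ := h4 i hi (by rw [Fin.lt_def] at hpi; simp only [p] at hpi; omega)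
        refine ⟨c', ?_⟩
        rw [hupd, ← hc', hupd', hup i p hpi, zero_mul, zero_mul]

/-- An element of `GL_n(K) / GL_n(𝒪)` is integral if it comes from an integral matrix. -/
def IsIntegralCoset (x : CosetSpace n K) : Prop :=
  ∀ i j, ‖(x.out : Matrix (Fin n) (Fin n) K) i j‖ ≤ 1

lemma norm_mul_apply_le_one {A B : Matrix (Fin n) (Fin n) K} (hA : ∀ i j, ‖A i j‖ ≤ 1)
    (hB : ∀ i j, ‖B i j‖ ≤ 1) (i j : Fin n) : ‖(A * B) i j‖ ≤ 1 := by
  rw [Matrix.mul_apply]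
  refine IsUltrametricDist.norm_sum_le_of_forall_le_of_nonneg zero_le_one fun k _ => ?_
  rw [norm_mul]
  exact mul_le_one₀ (hA _ _) (norm_nonneg _) (hB _ _)

lemma isIntegralCoset_mk (g : GL (Fin n) K) :
    IsIntegralCoset (QuotientGroup.mk g : CosetSpace n K) ↔
      ∀ i j, ‖(g : Matrix (Fin n) (Fin n) K) i j‖ ≤ 1 := by
  obtain ⟨k, hk⟩ := QuotientGroup.mk_out_eq_mul (maxCompact n K) g
  have hk' := (mem_maxCompact_iff (k : GL (Fin n) K)).1 k.2
  rw [IsIntegralCoset, hk]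
  refine ⟨fun h => ?_, fun h => ?_⟩
  · have := norm_mul_apply_le_one h hk'.2
    rw [← Units.val_mul, mul_inv_cancel_right] at this
    exact this
  · rw [Units.val_mul]
    exact norm_mul_apply_le_one h hk'.1

lemma isIntegralCoset_smul {k : GL (Fin n) K} (hk : k ∈ maxCompact n K) (x : CosetSpace n K) :
    IsIntegralCoset (k • x) ↔ IsIntegralCoset x := by
  obtain ⟨g, rfl⟩ := QuotientGroup.mk_surjective x
  change IsIntegralCoset (QuotientGroup.mk (k * g) : CosetSpace n K) ↔ _
  have hk' := (mem_maxCompact_iff (k : GL (Fin n) K)).1 hk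
  rw [isIntegralCoset_mk, isIntegralCoset_mk]
  refine ⟨fun h => ?_, fun h => ?_⟩
  · have := norm_mul_apply_le_one hk'.2 h
    rw [← Units.val_mul, inv_mul_cancel_left] at this
    exact this
  · rw [Units.val_mul]
    exact norm_mul_apply_le_one hk'.1 h

lemma IsUniformizer.exists_hermite (hϖ : IsUniformizer ϖ) {x : CosetSpace n K}
    (hx : IsIntegralCoset x) : ∃ l : Fin n → ℕ, ∃ c : HermiteData n K l,
      (QuotientGroup.mk (hermite ϖ l c) : CosetSpace n K) = x := by
  obtain ⟨a, v, hv, rfl, ha⟩ := exists_rep_borel x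
  rw [isIntegralCoset_mk] at hx
  choose l hl using fun i => hϖ.exists_norm_eq_pow (a i).ne_zero (by
    have := hx i i
    rwa [(upper_of_unipotent hv a).1 i] at this)
  have hal : latticeMk a = latticeMk (powVec ϖ l) := by
    rw [latticeMk_eq_iff]
    intro i
    rw [hl i]; simp
  rw [hal] at ha
  obtain ⟨u, hu, e⟩ := exists_eq_mk_of_cosetIwasawa ha
  rw [e]
  have hx' : IsIntegralCoset
      (QuotientGroup.mk (diag n K (powVec ϖ l) * u) : CosetSpace n K) := by
    rw [← e, isIntegralCoset_mk]; exact hx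
  rw [isIntegralCoset_mk] at hx'
  set y := diag n K (powVec ϖ l) * u with hy
  have hyu := upper_of_unipotent hu (powVec ϖ l)
  rw [← hy] at hyu
  have hyd : ∀ i, (y : Matrix (Fin n) (Fin n) K) i i = (ϖ : K) ^ l i := fun i => by
    rw [hyu.1 i]; simp
  -- The columns assemble to an integral upper unipotent matrix, an element of K₀.
  choose w hw1 hw2 hw3 hw4 using hϖ.exists_column l _ hyu.2 hyd hx'
  choose c hc using hw4
  obtain ⟨k, hk, ek⟩ := exists_mem_maxCompact (Matrix.of fun i j => w j i) (fun i j => hw3 j i)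
    (by
      have h : (Matrix.of fun i j => w j i).IsUpperTriangular := fun i j hij => hw2 j i hij
      rw [Matrix.det_of_isUpperTriangular h]
      simp [hw1])
  refine ⟨l, fun i j => c j i j.2, ?_⟩
  have : hermite ϖ l (fun i j => c j i j.2) = y * k := by
    refine Units.ext ?_
    rw [Units.val_mul, ek, coe_hermite]
    ext i j
    rcases lt_trichotomy i j with h | rfl | h
    · rw [hermiteMatrix_lt _ _ h, ← hc j i h, Matrix.mul_apply]
      rfl
    · rw [hermiteMatrix_diag, Matrix.mul_apply, Finset.sum_eq_single i]
      · simp [hyd, hw1]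
      · intro k _ hk
        rcases lt_or_gt_of_ne hk with hk | hk
        · rw [hyu.2 i k hk, zero_mul]
        · simp [hw2 i k hk]
      · simp
    · rw [hermiteMatrix_upper _ _ h, Matrix.mul_apply, eq_comm]
      refine Finset.sum_eq_zero fun k _ => ?_
      rcases lt_or_ge k i with hk | hk
      · rw [hyu.2 i k hk, zero_mul]
      · simp [hw2 j k (h.trans_le hk)]
  rw [this, QuotientGroup.mk_mul_of_mem _ hk]

end HermiteNormalForm

/-! ### Averaging over the maximal compact subgroup and the spherical line. -/

section Representation

universe u

variable {n : ℕ} {K : Type*} [NontriviallyNormedField K] [IsUltrametricDist K]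
  {V : Type u} [NormedAddCommGroup V] [InnerProductSpace ℂ V]

namespace HilbertRep

variable (π : HilbertRep n K V)

/-- The underlying algebraic representation. -/
def linearRep : GL (Fin n) K →* Module.End ℂ V :=
  (ContinuousLinearMap.toLinearMapRingHom (R₁ := ℂ) (M₁ := V)).toMonoidHom.comp π.toHom

lemma linearRep_apply (g : GL (Fin n) K) (v : V) : π.linearRep g v = π.toHom g v := rfl

lemma continuous_toHom_apply (v : V) : Continuous fun g => π.toHom g v :=
  π.continuous_action.comp (continuous_id.prodMk continuous_const)

lemma toHom_mul_apply (g h : GL (Fin n) K) (v : V) :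
    π.toHom (g * h) v = π.toHom g (π.toHom h v) := by
  rw [map_mul]; rfl

lemma fixed_iff {v : V} : v ∈ π.fixed (maxCompact n K) ↔
    ∀ k ∈ maxCompact n K, π.linearRep k v = v := Iff.rfl

variable [LocallyCompactSpace K]

lemma integrableOn_toHom' (v : V) :
    IntegrableOn (fun k => π.toHom k v) (maxCompact n K : Set (GL (Fin n) K)) (haarG n K) :=
  integrableOn_maxCompact (π.continuous_toHom_apply v)

variable [CompleteSpace V]

/-- Orbits of the compact group are bounded, so uniform boundedness applies. The representation is
not assumed unitary. -/
lemma exists_bound : ∃ C : ℝ, ∀ k ∈ maxCompact n K, ‖π.toHom k‖ ≤ C := by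
  obtain ⟨C, hC⟩ := banach_steinhaus (g := fun k : maxCompact n K => π.toHom k) fun v => by
    obtain ⟨C, hC⟩ := isCompact_maxCompact.exists_bound_of_continuousOn
      (π.continuous_toHom_apply v).continuousOn
    exact ⟨C, fun k => hC k k.2⟩
  exact ⟨C, fun k hk => hC ⟨k, hk⟩⟩

/-- The projection onto the vectors fixed under `GL_n(𝒪)`. -/
def average : V →L[ℂ] V :=
  LinearMap.mkContinuous
    { toFun := fun v => ∫ k in (maxCompact n K : Set (GL (Fin n) K)), π.toHom k v ∂(haarG n K)
      map_add' := fun v w => by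
        simp only [map_add]
        exact integral_add (π.integrableOn_toHom' v) (π.integrableOn_toHom' w)
      map_smul' := fun c v => by
        simp only [map_smul, RingHom.id_apply]
        exact integral_smul c _ }
    π.exists_bound.choose
    (fun v => by
      have h := norm_setIntegral_le_of_norm_le_const (μ := haarG n K)
        (s := (maxCompact n K : Set (GL (Fin n) K))) (f := fun k => π.toHom k v)
        (C := π.exists_bound.choose * ‖v‖) (by rw [haarG_maxCompact]; exact ENNReal.one_lt_top)
        (fun k hk => (π.toHom k).le_of_opNorm_le (π.exists_bound.choose_spec k hk) v)
      rwa [measureReal_def, haarG_maxCompact, ENNReal.toReal_one, mul_one] at h)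

lemma average_apply (v : V) : π.average v =
    ∫ k in (maxCompact n K : Set (GL (Fin n) K)), π.toHom k v ∂(haarG n K) := rfl

lemma setIntegral_mul_left {E : Type*} [NormedAddCommGroup E] [NormedSpace ℂ E]
    (Ψ : GL (Fin n) K → E) {k : GL (Fin n) K} (hk : k ∈ maxCompact n K) :
    ∫ l in (maxCompact n K : Set (GL (Fin n) K)), Ψ (k * l) ∂(haarG n K) =
      ∫ l in (maxCompact n K : Set (GL (Fin n) K)), Ψ l ∂(haarG n K) := by
  classical
  rw [← integral_indicator measurableSet_maxCompact, ← integral_indicator measurableSet_maxCompact,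
    ← integral_mul_left_eq_self (fun l => (maxCompact n K : Set (GL (Fin n) K)).indicator Ψ l) k]
  congr 1
  funext l
  simp only [Set.indicator_apply, SetLike.mem_coe, (maxCompact n K).mul_mem_cancel_left hk]

lemma average_mem (v : V) : π.average v ∈ π.fixed (maxCompact n K) := by
  intro k hk
  rw [average_apply, ← ContinuousLinearMap.integral_comp_comm _ (π.integrableOn_toHom' v),
    ← setIntegral_mul_left (fun l => π.toHom l v) hk]
  simp only [toHom_mul_apply]

lemma average_of_mem {v : V} (hv : v ∈ π.fixed (maxCompact n K)) : π.average v = v := by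
  rw [average_apply, setIntegral_congr_fun measurableSet_maxCompact (fun k hk => hv k hk),
    setIntegral_const, measureReal_def, haarG_maxCompact]
  simp

/-- The integral over one coset x is π(x) applied to the average of v. So the operator of any such F
factors through the averaging projection on all of V. -/
lemma integral_coset_toHom (F : CosetSpace n K →₀ ℂ) (v : V) :
    ∫ g, F (QuotientGroup.mk g) • π.toHom g v ∂(haarG n K) =
      cosetAction π.linearRep (π.average v) F := by
  rw [integral_coset_smul F (π.continuous_toHom_apply v), cosetAction,
    Finsupp.linearCombination_apply, Finsupp.sum]
  refine Finset.sum_congr rfl fun x _ => ?_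
  rw [linearRep_apply, average_apply,
    ← ContinuousLinearMap.integral_comp_comm _ (π.integrableOn_toHom' v)]
  simp only [toHom_mul_apply]

/-- F is the distribution of k g K₀ for k uniform in K₀, a bi-invariant function carried by the
double coset of g. -/
lemma exists_average_toHom (g : GL (Fin n) K) : ∃ F ∈ heckeSubmodule n K,
    ∀ w ∈ π.fixed (maxCompact n K),
      π.average (π.toHom g w) = cosetAction π.linearRep w F := by
  classical
  let m : CosetSpace n K → ℂ := fun x => ((haarG n K).real
    ((maxCompact n K : Set (GL (Fin n) K)) ∩
      {k | (QuotientGroup.mk (k * g) : CosetSpace n K) = x}) : ℂ)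
  have hc : Continuous fun k : GL (Fin n) K => (QuotientGroup.mk (k * g) : CosetSpace n K) :=
    continuous_mk.comp (continuous_mul_const g)
  have hms : ∀ x : CosetSpace n K, MeasurableSet
      {k : GL (Fin n) K | (QuotientGroup.mk (k * g) : CosetSpace n K) = x} := fun x =>
    ((isOpen_discrete {x}).preimage hc).measurableSet
  have hS : ((fun k : GL (Fin n) K => (QuotientGroup.mk (k * g) : CosetSpace n K)) ''
      (maxCompact n K : Set (GL (Fin n) K))).Finite :=
    (isCompact_maxCompact.image hc).finite_of_discrete
  have hm : Function.support m ⊆ hS.toFinset := by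
    intro x hx
    rw [hS.coe_toFinset]
    by_contra hne
    refine hx ?_
    have : (maxCompact n K : Set (GL (Fin n) K)) ∩
        {k | (QuotientGroup.mk (k * g) : CosetSpace n K) = x} = ∅ := by
      rw [Set.eq_empty_iff_forall_notMem]
      rintro k ⟨hk, rfl⟩
      exact hne ⟨k, hk, rfl⟩
    simp only [m, this]
    simp
  refine ⟨Finsupp.onFinset hS.toFinset m fun x hx => hm hx, ?_, fun w hw => ?_⟩
  · rw [mem_heckeSubmodule_iff]
    intro k hk x
    simp only [Finsupp.onFinset_apply, m]
    rw [measureReal_def, measureReal_def, ← measure_preimage_mul (haarG n K) k]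
    congr 3
    ext l
    simp only [Set.mem_preimage, Set.mem_inter_iff, SetLike.mem_coe,
      (maxCompact n K).mul_mem_cancel_left hk]
    refine and_congr_right fun _ => ?_
    rw [Set.mem_ofPred_eq, Set.mem_ofPred_eq, mul_assoc]
    exact (MulAction.injective k).eq_iff (a := (QuotientGroup.mk (l * g) : CosetSpace n K))
  · rw [average_apply, cosetAction, Finsupp.linearCombination_apply,
      Finsupp.onFinset_sum _ (by simp)]
    have e : ∀ k ∈ (maxCompact n K : Set (GL (Fin n) K)), π.toHom k (π.toHom g w) =
        ∑ x ∈ hS.toFinset, Set.indicator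
          {k | (QuotientGroup.mk (k * g) : CosetSpace n K) = x}
          (fun _ => π.linearRep x.out w) k := by
      intro k hk
      simp only [Set.indicator_apply, Set.mem_ofPred_eq]
      rw [← toHom_mul_apply, Finset.sum_eq_single (QuotientGroup.mk (k * g) : CosetSpace n K)]
      · rw [if_pos rfl, apply_out_mk (π.fixed_iff.1 hw)]
        rfl
      · intro x _ hx
        exact if_neg fun h => hx h.symm
      · intro h
        exact absurd (hS.mem_toFinset.2 ⟨k, hk, rfl⟩) h
    rw [setIntegral_congr_fun measurableSet_maxCompact e, integral_finsetSum]
    · refine Finset.sum_congr rfl fun x _ => ?_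
      rw [integral_indicator (hms x), Measure.restrict_restrict (hms x), setIntegral_const,
        Set.inter_comm]
      simp only [m]
      rfl
    · intro x _
      refine Integrable.indicator ?_ (hms x)
      refine integrableOn_const ?_
      rw [haarG_maxCompact]
      exact ENNReal.one_ne_top

/-- The translates of W span a dense subspace by irreducibility. Averaging maps that span into W by
Hecke stability, and W is closed since it is finite dimensional; as averaging fixes every invariant
vector, W contains them all. -/
lemma eq_fixed_of_stable (hirr : π.IsIrreducible)
    [FiniteDimensional ℂ (π.fixed (maxCompact n K))] (W : Submodule ℂ V)
    (hW : W ≤ π.fixed (maxCompact n K)) (h0 : W ≠ ⊥)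
    (hst : ∀ F ∈ heckeSubmodule n K, ∀ w ∈ W, cosetAction π.linearRep w F ∈ W) :
    W = π.fixed (maxCompact n K) := by
  have hfd : FiniteDimensional ℂ W := Submodule.finiteDimensional_of_le hW
  refine le_antisymm hW fun v hv => ?_
  let S : Set V := {x | ∃ g : GL (Fin n) K, ∃ w ∈ W, π.toHom g w = x}
  let U := (Submodule.span ℂ S).topologicalClosure
  have hU : U = ⊤ := by
    refine (hirr.2 U (Submodule.isClosed_topologicalClosure _) fun g x hx => ?_).resolve_left ?_
    · have h1 : Set.MapsTo (π.toHom g) (Submodule.span ℂ S : Set V)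
          (Submodule.span ℂ S : Set V) := by
        intro y hy
        have : Submodule.span ℂ S ≤ (Submodule.span ℂ S).comap (π.toHom g : V →ₗ[ℂ] V) := by
          rw [Submodule.span_le]
          rintro _ ⟨h, w, hw, rfl⟩
          refine Submodule.subset_span ⟨g * h, w, hw, ?_⟩
          rw [toHom_mul_apply]; rfl
        exact this hy
      exact h1.closure (π.toHom g).continuous hx
    · intro hbot
      refine h0 ((Submodule.eq_bot_iff _).2 fun w hw => ?_)
      have : w ∈ U := Submodule.le_topologicalClosure _
        (Submodule.subset_span ⟨1, w, hw, by simp⟩)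
      rw [hbot] at this
      exact (Submodule.mem_bot ℂ).1 this
  have hcl : IsClosed (W : Set V) := Submodule.closed_of_finiteDimensional W
  have hmaps : Set.MapsTo π.average (Submodule.span ℂ S : Set V) (W : Set V) := by
    intro y hy
    have : Submodule.span ℂ S ≤ W.comap (π.average : V →ₗ[ℂ] V) := by
      rw [Submodule.span_le]
      rintro _ ⟨g, w, hw, rfl⟩
      obtain ⟨F, hF, h⟩ := π.exists_average_toHom g
      change π.average (π.toHom g w) ∈ W
      rw [h w (hW hw)]
      exact hst F hF w hw
    exact this hy
  have hvU : v ∈ closure (Submodule.span ℂ S : Set V) := by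
    have : v ∈ U := hU ▸ Submodule.mem_top
    exact this
  have := hmaps.closure π.average.continuous hvU
  rw [hcl.closure_eq, π.average_of_mem hv] at this
  exact this

/-- Schur's argument: an eigenspace is stable under the commutative Hecke algebra, hence is the
whole fixed space. -/
lemma exists_scalar (hirr : π.IsIrreducible)
    [FiniteDimensional ℂ (π.fixed (maxCompact n K))] (hone : π.IsClassOne)
    {F : CosetSpace n K →₀ ℂ} (hF : F ∈ heckeSubmodule n K) :
    ∃ c : ℂ, ∀ v ∈ π.fixed (maxCompact n K), cosetAction π.linearRep v F = c • v := by
  let T : Module.End ℂ (π.fixed (maxCompact n K)) :=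
    { toFun := fun v => ⟨cosetAction π.linearRep v F, cosetAction_fixed (π.fixed_iff.1 v.2) hF⟩
      map_add' := fun v w => Subtype.ext (by
        simp [cosetAction, Finsupp.linearCombination_apply, Finsupp.sum, Finset.sum_add_distrib])
      map_smul' := fun c v => Subtype.ext (by
        simp [cosetAction, Finsupp.linearCombination_apply, Finsupp.sum, Finset.smul_sum,
          smul_comm c]) }
  have : Nontrivial (π.fixed (maxCompact n K)) := (Submodule.nontrivial_iff_ne_bot).2 hone
  obtain ⟨c, hc⟩ := Module.End.exists_eigenvalue T
  refine ⟨c, ?_⟩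
  let W := (Module.End.eigenspace T c).map (π.fixed (maxCompact n K)).subtype
  have hmem : ∀ w, w ∈ W ↔ w ∈ π.fixed (maxCompact n K) ∧
      cosetAction π.linearRep w F = c • w := by
    intro w
    constructor
    · rintro ⟨x, hx, rfl⟩
      exact ⟨x.2, congrArg Subtype.val (Module.End.mem_eigenspace_iff.1 hx)⟩
    · rintro ⟨h1, h2⟩
      exact ⟨⟨w, h1⟩, Module.End.mem_eigenspace_iff.2 (Subtype.ext h2), rfl⟩
  have hW : W = π.fixed (maxCompact n K) := by
    refine π.eq_fixed_of_stable hirr W (fun w hw => ((hmem w).1 hw).1) ?_ fun G hG w hw => ?_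
    · obtain ⟨x, hx, hx0⟩ := hc.exists_hasEigenvector
      intro hbot
      have : (x : V) ∈ W := ⟨x, hx, rfl⟩
      rw [hbot, Submodule.mem_bot] at this
      exact hx0 (Subtype.ext this)
    · obtain ⟨h1, h2⟩ := (hmem w).1 hw
      rw [fixed_iff] at h1
      refine (hmem _).2 ⟨cosetAction_fixed h1 hG, ?_⟩
      rw [← cosetAction_conv h1, conv_comm hF hG, cosetAction_conv h1, h2]
      simp [cosetAction, Finsupp.linearCombination_apply, Finsupp.sum, Finset.smul_sum,
        smul_comm c]
  intro v hv
  rw [← hW] at hv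
  exact ((hmem v).1 hv).2

lemma exists_spherical_vector (hirr : π.IsIrreducible)
    [FiniteDimensional ℂ (π.fixed (maxCompact n K))] (hone : π.IsClassOne) :
    ∃ v₀ : V, v₀ ≠ 0 ∧ π.fixed (maxCompact n K) = Submodule.span ℂ {v₀} := by
  obtain ⟨v₀, hv₀, hne⟩ := Submodule.exists_mem_ne_zero_of_ne_bot hone
  refine ⟨v₀, hne, (π.eq_fixed_of_stable hirr _ ?_ ?_ ?_).symm⟩
  · rwa [Submodule.span_singleton_le_iff_mem]
  · rwa [Ne, Submodule.span_singleton_eq_bot]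
  · intro F hF w hw
    obtain ⟨c, hc⟩ := π.exists_scalar hirr hone hF
    rw [hc w ((Submodule.span_singleton_le_iff_mem _ _).2 hv₀ hw)]
    exact Submodule.smul_mem _ _ hw

end HilbertRep

end Representation

/-! ### Complete symmetric sums and integrality. -/

section CompleteSymmetric

variable {A : Type*} [CommRing A] {n : ℕ}

/-- The complete homogeneous symmetric polynomials evaluated at `x`. -/
def completeSum (x : Fin n → A) (k : ℕ) : A :=
  ∑ l ∈ Finset.finsuppAntidiag (Finset.univ : Finset (Fin n)) k, ∏ j, x j ^ l j

lemma mk_pow_mul_one_sub (a : A) :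
    PowerSeries.mk (fun k => a ^ k) * (1 - PowerSeries.C a * PowerSeries.X) = 1 := by
  ext k
  rw [mul_sub, mul_one, map_sub, ← mul_assoc, mul_comm _ (PowerSeries.C a), mul_assoc,
    PowerSeries.coeff_C_mul]
  cases k with
  | zero => simp
  | succ k => simp [PowerSeries.coeff_succ_mul_X, PowerSeries.coeff_one, pow_succ']

lemma mk_completeSum_mul_prod (x : Fin n → A) :
    PowerSeries.mk (completeSum x) * ∏ j, (1 - PowerSeries.C (x j) * PowerSeries.X) = 1 := by
  have e : PowerSeries.mk (completeSum x) = ∏ j, PowerSeries.mk (fun k => x j ^ k) := by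
    ext k
    rw [PowerSeries.coeff_prod]
    simp [completeSum]
  rw [e, ← Finset.prod_mul_distrib]
  exact Finset.prod_eq_one fun j _ => mk_pow_mul_one_sub _

lemma coe_prod_one_sub (x : Fin n → A) :
    ((∏ j, (1 - Polynomial.C (x j) * Polynomial.X) : Polynomial A) : PowerSeries A) =
      ∏ j, (1 - PowerSeries.C (x j) * PowerSeries.X) := by
  rw [← Polynomial.coeToPowerSeries.ringHom_apply, map_prod]
  refine Finset.prod_congr rfl fun j _ => ?_
  simp

lemma prod_one_sub_eq_of_completeSum_eq {x y : Fin n → A}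
    (h : ∀ k, completeSum x k = completeSum y k) :
    (∏ j, (1 - Polynomial.C (x j) * Polynomial.X) : Polynomial A) =
      ∏ j, (1 - Polynomial.C (y j) * Polynomial.X) := by
  refine Polynomial.coe_injective A ?_
  rw [coe_prod_one_sub, coe_prod_one_sub]
  have h1 := mk_completeSum_mul_prod x
  have h2 := mk_completeSum_mul_prod y
  rw [← funext h] at h2
  exact (left_inv_eq_right_inv ((mul_comm _ _).trans h1) h2)

/-- Equal sums give equal generating polynomials ∏ (1 - x_j X), which are compared at the root
1/x_i; zero entries leave no trace there. -/
lemma exists_eq_of_completeSum_eq {F : Type*} [Field F] {x y : Fin n → F}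
    (h : ∀ k, completeSum x k = completeSum y k) {i : Fin n} (hi : x i ≠ 0) :
    ∃ j, x i = y j := by
  have h1 := congrArg (Polynomial.eval (x i)⁻¹) (prod_one_sub_eq_of_completeSum_eq h)
  rw [Polynomial.eval_prod, Polynomial.eval_prod,
    Finset.prod_eq_zero (Finset.mem_univ i) (by simp [hi]), eq_comm, Finset.prod_eq_zero_iff] at h1
  obtain ⟨j, -, hj⟩ := h1
  refine ⟨j, ?_⟩
  simp only [Polynomial.eval_sub, Polynomial.eval_one, Polynomial.eval_mul, Polynomial.eval_C,
    Polynomial.eval_X, sub_eq_zero] at hj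
  field_simp at hj
  exact hj

/-- Constant coefficient 1 lets each coefficient of g be solved for recursively without division. -/
lemma coeff_mem_of_mul_eq_one (R : Subring A) {f g : PowerSeries A} (h : f * g = 1)
    (hf : ∀ k, PowerSeries.coeff k f ∈ R) (h0 : PowerSeries.coeff 0 f = 1) (k : ℕ) :
    PowerSeries.coeff k g ∈ R := by
  induction k using Nat.strong_induction_on with
  | _ k ih =>
    have h1 := congrArg (PowerSeries.coeff k) h
    rw [PowerSeries.coeff_mul, Finset.Nat.sum_antidiagonal_eq_sum_range_succ
      (fun i j => PowerSeries.coeff i f * PowerSeries.coeff j g), Finset.sum_range_succ',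
      h0, one_mul, Nat.sub_zero] at h1
    rw [← eq_sub_iff_add_eq'] at h1
    rw [h1]
    refine sub_mem ?_ (sum_mem fun i hi => mul_mem (hf _) (ih _ ?_))
    · rw [PowerSeries.coeff_one]
      split_ifs
      · exact one_mem _
      · exact zero_mem _
    · have := Finset.mem_range.1 hi
      omega

/-- ∏ (1 - x_j X) is the inverse of the generating series, so its coefficients lie in R. It vanishes
at 1/x_i, hence its reverse, monic because the constant term is 1, vanishes at x_i. -/
lemma isIntegral_of_completeSum_mem (R : Subring A) (x : Fin n → A) (hx : ∀ j, IsUnit (x j))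
    (h : ∀ k, completeSum x k ∈ R) (i : Fin n) : IsIntegral R (x i) := by
  have h0 : PowerSeries.coeff 0 (PowerSeries.mk (completeSum x)) = 1 := by
    simp [completeSum]
  have hc := coeff_mem_of_mul_eq_one R (mk_completeSum_mul_prod x)
    (fun k => by rw [PowerSeries.coeff_mk]; exact h k) h0
  set P : Polynomial A := ∏ j, (1 - Polynomial.C (x j) * Polynomial.X) with hP
  have hl : P ∈ Polynomial.lifts (algebraMap R A) := by
    rw [Polynomial.lifts_iff_coeff_lifts]
    intro k
    have := hc k
    rw [← coe_prod_one_sub, Polynomial.coeff_coe] at this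
    exact ⟨⟨_, this⟩, rfl⟩
  obtain ⟨q, hq⟩ := (Polynomial.mem_lifts _).1 hl
  have hP0 : P.coeff 0 = 1 := by
    rw [Polynomial.coeff_zero_eq_eval_zero, hP, Polynomial.eval_prod]
    simp
  have hq0 : q.coeff 0 = 1 := by
    have h1 : algebraMap R A (q.coeff 0) = 1 := by rw [← Polynomial.coeff_map, hq, hP0]
    exact Subtype.ext h1
  obtain ⟨u, hu⟩ := hx i
  refine ⟨q.reverse, ?_, ?_⟩
  · rcases subsingleton_or_nontrivial R with hs | hs
    · exact Subsingleton.elim _ _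
    rw [Polynomial.Monic, Polynomial.reverse_leadingCoeff, Polynomial.trailingCoeff,
      Polynomial.natTrailingDegree_eq_zero.2 (Or.inr (by rw [hq0]; exact one_ne_zero)), hq0]
  · let : Invertible ((u⁻¹ : Aˣ) : A) := u⁻¹.invertible
    have h1 := Polynomial.eval₂_reverse_mul_pow (algebraMap R A) ((u⁻¹ : Aˣ) : A) q
    have h2 : Polynomial.eval₂ (algebraMap R A) ((u⁻¹ : Aˣ) : A) q = 0 := by
      rw [← Polynomial.eval_map, hq, hP, Polynomial.eval_prod]
      refine Finset.prod_eq_zero (Finset.mem_univ i) ?_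
      simp [← hu]
    have h3 : ⅟((u⁻¹ : Aˣ) : A) = x i := by
      rw [← hu]; simp
    rw [h2, h3] at h1
    exact ((u⁻¹.isUnit.pow _).mul_left_eq_zero).1 h1

end CompleteSymmetric

/-- Characters with values in `ℂ` extend along integral extensions. -/
lemma exists_extension_of_isIntegral {A : Type*} [CommRing A] [Algebra ℂ A]
    (R : Subalgebra ℂ A) [Algebra.IsIntegral R A] (ω : R →ₐ[ℂ] ℂ) :
    ∃ Ω : A →ₐ[ℂ] ℂ, ∀ r : R, Ω r = ω r := by
  have hsurj : Function.Surjective ω := fun c => ⟨algebraMap ℂ R c, by simp⟩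
  have hmax : (RingHom.ker ω).IsMaximal := RingHom.ker_isMaximal_of_surjective _ hsurj
  obtain ⟨Q, hQ, hQP⟩ := Ideal.exists_ideal_over_maximal_of_isIntegral (S := A) (RingHom.ker ω)
    (by
      intro r hr
      have : (r : A) = 0 := hr
      rw [ZeroMemClass.coe_eq_zero] at this
      rw [this]; exact zero_mem _)
  let : Field (A ⧸ Q) := Ideal.Quotient.field Q
  have hmk : ∀ r : R, Ideal.Quotient.mk Q (r : A) = algebraMap ℂ (A ⧸ Q) (ω r) := by
    intro r
    have h1 : r - algebraMap ℂ R (ω r) ∈ RingHom.ker ω := by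
      rw [RingHom.mem_ker, map_sub]; simp
    rw [← hQP, Ideal.mem_comap, map_sub] at h1
    exact Ideal.Quotient.eq.2 h1
  -- On R the residue map is ω, so integral equations over R reduce to equations over ℂ. The residue
  -- field, being integral over ℂ, is then ℂ itself.
  have hint : Algebra.IsIntegral ℂ (A ⧸ Q) := by
    refine ⟨fun y => ?_⟩
    obtain ⟨a, rfl⟩ := Ideal.Quotient.mk_surjective y
    obtain ⟨p, hp, hpa⟩ := Algebra.IsIntegral.isIntegral (R := R) a
    refine ⟨p.map (ω : R →+* ℂ), hp.map _, ?_⟩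
    rw [Polynomial.eval₂_map]
    have : (algebraMap ℂ (A ⧸ Q)).comp (ω : R →+* ℂ) =
        (Ideal.Quotient.mk Q).comp (algebraMap R A) :=
      RingHom.ext fun r => (hmk r).symm
    rw [this, ← Polynomial.hom_eval₂, hpa, map_zero]
  have hbij : Function.Bijective (algebraMap ℂ (A ⧸ Q)) :=
    IsAlgClosed.algebraMap_bijective_of_isIntegral
  let e : ℂ ≃ₐ[ℂ] A ⧸ Q := AlgEquiv.ofBijective (Algebra.ofId ℂ (A ⧸ Q)) hbij
  refine ⟨(e.symm : (A ⧸ Q) →ₐ[ℂ] ℂ).comp (Ideal.Quotient.mkₐ ℂ Q), fun r => ?_⟩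
  change e.symm (Ideal.Quotient.mk Q (r : A)) = _
  rw [hmk, AlgEquiv.symm_apply_eq]
  rfl

/-! ### Counting normal forms against the modulus. -/

section SatakeImage

variable {n : ℕ} {K : Type*} [NontriviallyNormedField K] [IsUltrametricDist K]
  [LocallyCompactSpace K] {ϖ : Kˣ}

variable (n) in
/-- The generators of `λ`. -/
def latticeBasis (ϖ : Kˣ) (j : Fin n) : LatticeGroup n K := latticeMk (Pi.mulSingle j ϖ)

lemma latticeMk_powVec (l : Fin n → ℕ) :
    latticeMk (powVec ϖ l) = ∏ j, latticeBasis n ϖ j ^ l j := by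
  simp only [latticeBasis, ← map_pow, ← map_prod]
  congr 1
  rw [← Finset.univ_prod_mulSingle (powVec ϖ l)]
  refine Finset.prod_congr rfl fun j _ => ?_
  rw [← Pi.mulSingle_pow]

lemma IsUniformizer.exists_zpow (hϖ : IsUniformizer ϖ) (m : LatticeGroup n K) :
    ∃ l : Fin n → ℤ, m = ∏ j, latticeBasis n ϖ j ^ l j := by
  obtain ⟨a, rfl⟩ := latticeMk_surjective m
  choose l hl using fun j => hϖ.exists_norm_eq_zpow (a j)
  refine ⟨l, ?_⟩
  have : ∏ j, latticeBasis n ϖ j ^ l j = latticeMk fun j => ϖ ^ l j := by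
    simp only [latticeBasis, ← map_zpow, ← map_prod]
    congr 1
    rw [← Finset.univ_prod_mulSingle fun j => ϖ ^ l j]
    refine Finset.prod_congr rfl fun j _ => ?_
    rw [← Pi.mulSingle_zpow]
  rw [this, latticeMk_eq_iff]
  intro i
  rw [hl i]; simp

/-- The Satake weight of the matrices of Hermite type. -/
def hermiteWeight (n : ℕ) (ϖ : Kˣ) : ℝ := ((Real.sqrt ‖(ϖ : K)‖)⁻¹) ^ (n - 1)

lemma hermiteWeight_pos : 0 < hermiteWeight n ϖ :=
  pow_pos (inv_pos.2 (Real.sqrt_pos.2 norm_uniformizer_pos)) _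

lemma residueCard_ne_zero (hnorm : ‖(ϖ : K)‖ = (residueCard K : ℝ)⁻¹) : residueCard K ≠ 0 := by
  intro h
  rw [h] at hnorm
  simp at hnorm

lemma finite_hermiteData (hnorm : ‖(ϖ : K)‖ = (residueCard K : ℝ)⁻¹) (l : Fin n → ℕ) :
    Finite (HermiteData n K l) := by
  refine Nat.finite_of_card_ne_zero ?_
  rw [card_hermiteData, Finset.prod_ne_zero_iff]
  exact fun i _ => pow_ne_zero _ (residueCard_ne_zero hnorm)

/-- Row i contributes q to the power l_i(n-1-i) from the count and -l_i(n-1-2i)/2 from δ^{1/2}. The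
total l_i(n-1)/2 no longer depends on the position i. Working with the square root of `‖ϖ‖` keeps
all exponents integral. -/
lemma card_mul_sqrtModulus (hnorm : ‖(ϖ : K)‖ = (residueCard K : ℝ)⁻¹) (l : Fin n → ℕ) :
    (Nat.card (HermiteData n K l) : ℝ) * sqrtModulus (latticeMk (powVec ϖ l)) =
      hermiteWeight n ϖ ^ (∑ i, l i) := by
  set r := Real.sqrt ‖(ϖ : K)‖ with hr
  have hr0 : 0 < r := Real.sqrt_pos.2 norm_uniformizer_pos
  have hr2 : ‖(ϖ : K)‖ = r ^ 2 := (Real.sq_sqrt (norm_nonneg _)).symm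
  have hq : (residueCard K : ℝ) = (r ^ 2)⁻¹ := by rw [← hr2, hnorm, inv_inv]
  have hm : modulus (powVec ϖ l) =
      (∏ i : Fin n, r ^ ((l i : ℤ) * ((n : ℤ) - 1 - 2 * ((i : ℕ) : ℤ)))) ^ 2 := by
    rw [modulus, ← Finset.prod_pow]
    refine Finset.prod_congr rfl fun i _ => ?_
    simp only [powVec, Units.val_pow_eq_pow_val, norm_pow, hr2]
    rw [← zpow_natCast, ← zpow_natCast, ← zpow_natCast, ← _root_.zpow_mul, ← _root_.zpow_mul,
      ← _root_.zpow_mul]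
    congr 1
    push_cast
    ring
  rw [sqrtModulus_mk, hm, Real.sqrt_sq (Finset.prod_nonneg fun _ _ => (zpow_pos hr0 _).le),
    card_hermiteData, Nat.cast_prod, ← Finset.prod_mul_distrib, hermiteWeight, ← hr,
    ← Finset.prod_pow_eq_pow_sum]
  refine Finset.prod_congr rfl fun i _ => ?_
  have hi := i.2
  rw [Nat.cast_pow, hq, ← _root_.zpow_natCast, ← _root_.zpow_natCast r 2, ← _root_.zpow_neg,
    ← _root_.zpow_mul, ← zpow_add₀ hr0.ne', ← pow_mul, inv_pow, ← _root_.zpow_natCast,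
    ← _root_.zpow_neg]
  congr 1
  push_cast [Nat.cast_sub (show (i : ℕ) ≤ n - 1 by omega), Nat.cast_sub (show 1 ≤ n by omega)]
  ring

lemma IsUniformizer.exists_hermite_iff (hϖ : IsUniformizer ϖ) (x : CosetSpace n K) (k : ℕ) :
    (∃ l ∈ Finset.finsuppAntidiag (Finset.univ : Finset (Fin n)) k, ∃ c : HermiteData n K l,
      (QuotientGroup.mk (hermite ϖ l c) : CosetSpace n K) = x) ↔
    IsIntegralCoset x ∧ ‖(x.out : Matrix (Fin n) (Fin n) K).det‖ = ‖(ϖ : K)‖ ^ k := by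
  have hdet : ∀ g : GL (Fin n) K, ‖((QuotientGroup.mk g : CosetSpace n K).out :
      Matrix (Fin n) (Fin n) K).det‖ = ‖(g : Matrix (Fin n) (Fin n) K).det‖ := by
    intro g
    obtain ⟨k, hk⟩ := QuotientGroup.mk_out_eq_mul (maxCompact n K) g
    rw [hk, Units.val_mul, Matrix.det_mul, norm_mul, norm_det_of_mem k.2, mul_one]
  have hdH : ∀ (l : Fin n → ℕ) (c : HermiteData n K l),
      ‖(hermite ϖ l c : Matrix (Fin n) (Fin n) K).det‖ = ‖(ϖ : K)‖ ^ (∑ i, l i) := by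
    intro l c
    rw [coe_hermite, det_hermiteMatrix, norm_prod, ← Finset.prod_pow_eq_pow_sum]
    simp
  constructor
  · rintro ⟨l, hl, c, rfl⟩
    rw [isIntegralCoset_mk, hdet, hdH]
    rw [Finset.mem_finsuppAntidiag] at hl
    exact ⟨hϖ.norm_hermiteMatrix_le l c, by rw [← hl.1]⟩
  · rintro ⟨h1, h2⟩
    obtain ⟨l, c, rfl⟩ := hϖ.exists_hermite h1
    rw [hdet, hdH] at h2
    refine ⟨Finsupp.equivFunOnFinite.symm l, ?_, c, rfl⟩
    rw [Finset.mem_finsuppAntidiag]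
    exact ⟨hϖ.norm_pow_injective h2, Finset.subset_univ _⟩

open Classical in
/-- The characteristic function of the integral matrices with determinant of norm `‖ϖ‖ ^ k`. -/
def integralLayer (hnorm : ‖(ϖ : K)‖ = (residueCard K : ℝ)⁻¹) (n k : ℕ) :
    CosetSpace n K →₀ ℂ :=
  ∑ l ∈ Finset.finsuppAntidiag (Finset.univ : Finset (Fin n)) k,
    have := finite_hermiteData hnorm (l : Fin n → ℕ)
    have := Fintype.ofFinite (HermiteData n K l)
    ∑ c : HermiteData n K l, Finsupp.single (QuotientGroup.mk (hermite ϖ l c)) 1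

end SatakeImage

/-! ### The group algebra of λ is integral over the Satake image. -/

section SatakeIntegral

variable {n : ℕ} {K : Type*} [NontriviallyNormedField K] [IsUltrametricDist K] [LocallyCompactSpace K]
  {ϖ : Kˣ}

lemma norm_det_out_smul {k : GL (Fin n) K} (hk : k ∈ maxCompact n K) (x : CosetSpace n K) :
    ‖((k • x).out : Matrix (Fin n) (Fin n) K).det‖ =
      ‖(x.out : Matrix (Fin n) (Fin n) K).det‖ := by
  obtain ⟨l, hl⟩ := QuotientGroup.mk_out_eq_mul (maxCompact n K) (k * x.out)
  have e : k • x = QuotientGroup.mk (k * x.out) := by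
    conv_lhs => rw [← QuotientGroup.out_eq' x]
    rfl
  rw [e, hl, Units.val_mul, Units.val_mul, Matrix.det_mul, Matrix.det_mul, norm_mul, norm_mul,
    norm_det_of_mem l.2, norm_det_of_mem hk, mul_one, one_mul]

open Classical in
-- By injectivity of the normal forms no coset is counted twice. The sum of point masses computes
-- the Satake transform, whereas this description shows K₀-invariance.
lemma integralLayer_apply (hϖ : IsUniformizer ϖ) (hnorm : ‖(ϖ : K)‖ = (residueCard K : ℝ)⁻¹)
    (k : ℕ) (x : CosetSpace n K) : integralLayer hnorm n k x =
      if IsIntegralCoset x ∧ ‖(x.out : Matrix (Fin n) (Fin n) K).det‖ = ‖(ϖ : K)‖ ^ k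
        then 1 else 0 := by
  simp only [← hϖ.exists_hermite_iff x k]
  have hinj := hϖ.hermite_injective (n := n)
  split_ifs with h
  · obtain ⟨l, hl, c, rfl⟩ := h
    have := finite_hermiteData hnorm (l : Fin n → ℕ)
    let := Fintype.ofFinite (HermiteData n K l)
    rw [integralLayer, Finsupp.finsetSum_apply, Finset.sum_eq_single_of_mem l hl,
      Finsupp.finsetSum_apply, Finset.sum_eq_single_of_mem c (Finset.mem_univ _)]
    · simp
    · intro c' _ hc
      refine Finsupp.single_eq_of_ne fun e => hc ?_
      have := @hinj ⟨l, c⟩ ⟨l, c'⟩ e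
      simpa using this.symm
    · intro l' _ hl'
      rw [Finsupp.finsetSum_apply]
      refine Finset.sum_eq_zero fun c' _ => Finsupp.single_eq_of_ne fun e => hl' ?_
      exact (DFunLike.coe_injective (congrArg Sigma.fst (@hinj ⟨l, c⟩ ⟨l', c'⟩ e))).symm
  · rw [integralLayer, Finsupp.finsetSum_apply]
    refine Finset.sum_eq_zero fun l hl => ?_
    rw [Finsupp.finsetSum_apply]
    exact Finset.sum_eq_zero fun c _ => Finsupp.single_eq_of_ne fun e => h ⟨l, hl, c, e.symm⟩

lemma integralLayer_mem (hϖ : IsUniformizer ϖ) (hnorm : ‖(ϖ : K)‖ = (residueCard K : ℝ)⁻¹)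
    (k : ℕ) : integralLayer hnorm n k ∈ heckeSubmodule n K := by
  rw [mem_heckeSubmodule_iff]
  intro g hg x
  rw [integralLayer_apply hϖ, integralLayer_apply hϖ, isIntegralCoset_smul hg,
    norm_det_out_smul hg]

/-- All normal forms with diagonal ϖ^l have the same image; their number times δ^{1/2} depends only
on |l| = k, and the monomials of degree k add up to h_k. -/
lemma satakeMap_integralLayer (hnorm : ‖(ϖ : K)‖ = (residueCard K : ℝ)⁻¹) (k : ℕ) :
    satakeMap n K (integralLayer hnorm n k) = ((hermiteWeight n ϖ : ℂ) ^ k) •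
      completeSum (fun j => MonoidAlgebra.single (latticeBasis n ϖ j) (1 : ℂ)) k := by
  rw [integralLayer, map_sum, completeSum, Finset.smul_sum]
  refine Finset.sum_congr rfl fun l hl => ?_
  have := finite_hermiteData hnorm (l : Fin n → ℕ)
  let := Fintype.ofFinite (HermiteData n K l)
  rw [map_sum]
  simp only [satakeMap_single, cosetIwasawa_hermite, one_smul, Finset.sum_const, Finset.card_univ]
  rw [← Nat.card_eq_fintype_card, Finset.mem_finsuppAntidiag] at *
  simp only [MonoidAlgebra.single_pow, one_pow]
  have e : ∏ j, (MonoidAlgebra.single (latticeBasis n ϖ j ^ l j) (1 : ℂ)) =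
      MonoidAlgebra.single (∏ j, latticeBasis n ϖ j ^ l j) 1 := by
    simp
  rw [e, ← latticeMk_powVec, ← Nat.cast_smul_eq_nsmul ℂ, MonoidAlgebra.smul_single,
    MonoidAlgebra.smul_single, smul_eq_mul, smul_eq_mul, mul_one]
  congr 1
  have h := card_mul_sqrtModulus hnorm (l : Fin n → ℕ)
  rw [hl.1] at h
  exact_mod_cast h

lemma cosetIwasawa_mk_diag (a : Fin n → Kˣ) :
    cosetIwasawa (QuotientGroup.mk (diag n K a) : CosetSpace n K) = latticeMk a := by
  rw [cosetIwasawa_mk]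
  have := iwasawaPart_eq (a := a) (one_mem (unipotent n K)) (one_mem (maxCompact n K))
  simpa using this

/-- Scalar matrices are central. They provide the constants and the inverse of the product of all
generators. -/
lemma single_scalar_mem (t : Kˣ) (c : ℂ) :
    Finsupp.single (QuotientGroup.mk (diag n K fun _ => t) : CosetSpace n K) c ∈
      heckeSubmodule n K := by
  refine mem_heckeSubmodule.2 fun k hk => ?_
  rw [translate_single]
  congr 1
  have hcomm : k * diag n K (fun _ => t) = diag n K (fun _ => t) * k := by
    ext i j
    rw [Units.val_mul, Units.val_mul, diag_val, Matrix.mul_diagonal, Matrix.diagonal_mul, mul_comm]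
  change (QuotientGroup.mk (k * diag n K (fun _ => t)) : CosetSpace n K) = _
  rw [hcomm, QuotientGroup.eq]
  simpa using hk

lemma satakeMap_single_scalar (t : Kˣ) (c : ℂ) :
    satakeMap n K (Finsupp.single (QuotientGroup.mk (diag n K fun _ => t)) c) =
      MonoidAlgebra.single (latticeMk fun _ => t)
        (c * (sqrtModulus (latticeMk fun _ : Fin n => t) : ℂ)) := by
  rw [satakeMap_single, cosetIwasawa_mk_diag, MonoidAlgebra.smul_single, smul_eq_mul]

lemma satakeMap_single_one (c : ℂ) :
    satakeMap n K (Finsupp.single (QuotientGroup.mk (diag n K fun _ => 1)) c) =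
      algebraMap ℂ _ c := by
  rw [satakeMap_single_scalar]
  have h1 : (latticeMk fun _ : Fin n => (1 : Kˣ)) = 1 := map_one latticeMk
  have h2 : sqrtModulus (latticeMk fun _ : Fin n => (1 : Kˣ)) = 1 := by
    rw [sqrtModulus_mk]; simp [modulus]
  rw [h2, h1, Complex.ofReal_one, mul_one]
  rfl

variable (n K) in
/-- The image of the Hecke algebra under the Satake transform. -/
def satakeImage : Subalgebra ℂ (MonoidAlgebra ℂ (LatticeGroup n K)) where
  carrier := satakeMap n K '' heckeSubmodule n K
  mul_mem' := by
    rintro _ _ ⟨f, hf, rfl⟩ ⟨g, hg, rfl⟩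
    exact ⟨conv f g, conv_mem hf hg, satakeMap_conv f hg⟩
  add_mem' := by
    rintro _ _ ⟨f, hf, rfl⟩ ⟨g, hg, rfl⟩
    exact ⟨f + g, add_mem hf hg, map_add _ _ _⟩
  algebraMap_mem' := fun c => ⟨_, single_scalar_mem 1 c, satakeMap_single_one c⟩

lemma mem_satakeImage {p : MonoidAlgebra ℂ (LatticeGroup n K)} :
    p ∈ satakeImage n K ↔ ∃ f ∈ heckeSubmodule n K, satakeMap n K f = p := Iff.rfl

lemma isUnit_single (l : LatticeGroup n K) :
    IsUnit (MonoidAlgebra.single l (1 : ℂ)) :=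
  (Group.isUnit l).map (MonoidAlgebra.of ℂ (LatticeGroup n K))

/-- The generators are integral because all h_k lie in the image. The inverse of one generator is
the product of the others times the class of the scalar matrix ϖ⁻¹, which lies in the image. -/
lemma isIntegral_satakeImage (hϖ : IsUniformizer ϖ)
    (hnorm : ‖(ϖ : K)‖ = (residueCard K : ℝ)⁻¹) :
    Algebra.IsIntegral (satakeImage n K) (MonoidAlgebra ℂ (LatticeGroup n K)) := by
  have hb : ∀ j : Fin n, IsIntegral (satakeImage n K)
      (MonoidAlgebra.single (latticeBasis n ϖ j) (1 : ℂ)) := by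
    refine isIntegral_of_completeSum_mem (satakeImage n K).toSubring
      (fun j => MonoidAlgebra.single (latticeBasis n ϖ j) (1 : ℂ)) (fun j => isUnit_single _) fun k => ?_
    have h := Subalgebra.smul_mem (satakeImage n K)
      (mem_satakeImage.2 ⟨_, integralLayer_mem hϖ hnorm k, rfl⟩)
      (((hermiteWeight n ϖ : ℂ) ^ k)⁻¹)
    rwa [satakeMap_integralLayer, inv_smul_smul₀] at h
    exact pow_ne_zero _ (Complex.ofReal_ne_zero.2 hermiteWeight_pos.ne')
  have hprod : ∏ j, latticeBasis n ϖ j = latticeMk fun _ => ϖ := by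
    simp only [latticeBasis, ← map_prod]
    rw [Finset.univ_prod_mulSingle fun _ => ϖ]
  have hc : IsIntegral (satakeImage n K)
      (MonoidAlgebra.single (∏ j, latticeBasis n ϖ j)⁻¹ (1 : ℂ)) := by
    have hm : MonoidAlgebra.single (∏ j, latticeBasis n ϖ j)⁻¹ (1 : ℂ) ∈ satakeImage n K := by
      refine ⟨_, single_scalar_mem ϖ⁻¹
        (sqrtModulus (latticeMk fun _ : Fin n => ϖ⁻¹) : ℂ)⁻¹, ?_⟩
      rw [satakeMap_single_scalar, inv_mul_cancel₀
        (Complex.ofReal_ne_zero.2 (sqrtModulus_pos _).ne'), hprod, ← map_inv]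
      rfl
    exact isIntegral_algebraMap (x := (⟨_, hm⟩ : satakeImage n K))
  have hmul : ∀ a b : LatticeGroup n K, IsIntegral (satakeImage n K) (MonoidAlgebra.single a (1 : ℂ)) →
      IsIntegral (satakeImage n K) (MonoidAlgebra.single b (1 : ℂ)) →
      IsIntegral (satakeImage n K) (MonoidAlgebra.single (a * b) (1 : ℂ)) := fun a b ha hb => by
    have := ha.mul hb
    rwa [MonoidAlgebra.single_mul_single, mul_one] at this
  let S : Submonoid (LatticeGroup n K) :=
    { carrier := {a | IsIntegral (satakeImage n K) (MonoidAlgebra.single a (1 : ℂ))}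
      one_mem' := isIntegral_one
      mul_mem' := fun ha hb => hmul _ _ ha hb }
  have hinv : ∀ j, (latticeBasis n ϖ j)⁻¹ ∈ S := fun j => by
    have h1 : ∏ i ∈ Finset.univ.erase j, latticeBasis n ϖ i ∈ S :=
      S.prod_mem fun i _ => hb i
    have h2 := S.mul_mem h1 (show (∏ j, latticeBasis n ϖ j)⁻¹ ∈ S from hc)
    rwa [← Finset.prod_erase_mul _ _ (Finset.mem_univ j), mul_inv, mul_inv_cancel_left] at h2
  have hall : ∀ l, l ∈ S := fun l => by
    obtain ⟨m, rfl⟩ := hϖ.exists_zpow l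
    refine S.prod_mem fun j _ => ?_
    obtain ⟨k, hk | hk⟩ := (m j).eq_nat_or_neg
    · rw [hk, _root_.zpow_natCast]
      exact S.pow_mem (hb j) k
    · rw [hk, _root_.zpow_neg, _root_.zpow_natCast, ← inv_pow]
      exact S.pow_mem (hinv j) k
  refine ⟨fun p => ?_⟩
  induction p using MonoidAlgebra.induction_on with
  | of l => exact hall l
  | add a b ha hb => exact ha.add hb
  | smul c a ha => exact ha.smul c

end SatakeIntegral

/-! ### Existence of the Satake parameter. -/

section SatakeParameter

universe u

variable {n : ℕ} {K : Type*} [NontriviallyNormedField K] [IsUltrametricDist K]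
  [LocallyCompactSpace K] {ϖ : Kˣ}
  {V : Type u} [NormedAddCommGroup V] [InnerProductSpace ℂ V] [CompleteSpace V]

namespace HilbertRep

variable (π : HilbertRep n K V)

lemma isSatakeParameter_iff (χ : Lattice n K →* ℂˣ) : π.IsSatakeParameter χ ↔
    ∀ F ∈ heckeSubmodule n K, ∀ v ∈ π.fixed (maxCompact n K),
      cosetAction π.linearRep v F =
        MonoidAlgebra.lift ℂ ℂ (LatticeGroup n K) (charHom χ) (satakeMap n K F) • v := by
  constructor
  · intro h F hF v hv
    have := h _ (isHecke_of_mem hF) v hv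
    rwa [integral_coset_toHom, π.average_of_mem hv, heckeCharacter_eq] at this
  · intro h f hf v hv
    obtain ⟨F, hF, rfl⟩ := exists_heckeSubmodule_of_isHecke hf
    rw [integral_coset_toHom, π.average_of_mem hv, heckeCharacter_eq]
    exact h F hF v hv

lemma cosetAction_smul_right (c : ℂ) (v : V) (F : CosetSpace n K →₀ ℂ) :
    cosetAction π.linearRep (c • v) F = c • cosetAction π.linearRep v F := by
  simp [cosetAction, Finsupp.linearCombination_apply, Finsupp.sum, Finset.smul_sum, smul_comm c]

/-- The eigenvalue on the spherical line is an algebra character ω of the Satake image. Its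
extension to ℂ[λ], restricted to group elements, is χ. -/
lemma exists_isSatakeParameter (hϖ : IsUniformizer ϖ)
    (hnorm : ‖(ϖ : K)‖ = (residueCard K : ℝ)⁻¹) (hirr : π.IsIrreducible)
    [FiniteDimensional ℂ (π.fixed (maxCompact n K))] (hone : π.IsClassOne) :
    ∃ χ, π.IsSatakeParameter χ := by
  obtain ⟨v₀, hv₀, hspan⟩ := π.exists_spherical_vector hirr hone
  have hmem : v₀ ∈ π.fixed (maxCompact n K) := by
    rw [hspan]; exact Submodule.mem_span_singleton_self v₀
  choose F hF hFp using fun p : satakeImage n K => mem_satakeImage.1 p.2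
  choose c hc using fun p : satakeImage n K => π.exists_scalar hirr hone (hF p)
  -- Injectivity of the transform makes the scalar independent of the chosen preimage of p.
  have key : ∀ G ∈ heckeSubmodule n K, ∀ p : satakeImage n K, satakeMap n K G = p →
      cosetAction π.linearRep v₀ G = c p • v₀ := by
    intro G hG p hp
    rw [← hc p v₀ hmem]
    congr 1
    rw [← sub_eq_zero]
    refine eq_zero_of_satakeMap_eq_zero (sub_mem hG (hF p)) ?_
    rw [map_sub, hp, hFp, sub_self]
  have hinj : ∀ a b : ℂ, a • v₀ = b • v₀ → a = b := fun a b h => smul_left_injective ℂ hv₀ h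
  let ω : satakeImage n K →ₐ[ℂ] ℂ := AlgHom.ofLinearMap
    { toFun := c
      map_add' := fun p q => hinj _ _ (by
        rw [← key _ (add_mem (hF p) (hF q)) (p + q) (by rw [map_add, hFp, hFp]; rfl), map_add,
          hc p v₀ hmem, hc q v₀ hmem, add_smul])
      map_smul' := fun a p => hinj _ _ (by
        rw [← key _ (Submodule.smul_mem _ a (hF p)) (a • p) (by rw [map_smul, hFp]; rfl), map_smul,
          hc p v₀ hmem, smul_smul]; rfl) }
    (hinj _ _ (by
      change c 1 • v₀ = _
      have h1 : (diag n K fun _ => 1) = 1 := map_one (diag n K)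
      rw [← key _ (single_scalar_mem 1 1) 1 (by rw [satakeMap_single_one, map_one]; rfl),
        cosetAction_single, apply_out_mk (π.fixed_iff.1 hmem), h1, map_one]
      rfl))
    (fun p q => hinj _ _ (by
      change c (p * q) • v₀ = (c p * c q) • v₀
      rw [← key _ (conv_mem (hF p) (hF q)) (p * q) (by
        rw [satakeMap_conv _ (hF q), hFp, hFp]; rfl), cosetAction_conv (π.fixed_iff.1 hmem), hc q v₀ hmem,
        cosetAction_smul_right, hc p v₀ hmem, smul_smul, mul_comm]))
  have := isIntegral_satakeImage (n := n) hϖ hnorm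
  obtain ⟨Ω, hΩ⟩ := exists_extension_of_isIntegral (satakeImage n K) ω
  let ψ : LatticeGroup n K →* ℂ := (Ω : MonoidAlgebra ℂ (LatticeGroup n K) →* ℂ).comp
    (MonoidAlgebra.of ℂ (LatticeGroup n K))
  let χ : Lattice n K →* ℂˣ := (MonoidHom.toHomUnits ψ : LatticeGroup n K →* ℂˣ)
  have hχ : charHom χ = ψ := MonoidHom.ext fun l => rfl
  refine ⟨χ, (π.isSatakeParameter_iff χ).2 fun G hG v hv => ?_⟩
  rw [hχ]
  have hlift : MonoidAlgebra.lift ℂ ℂ (LatticeGroup n K) ψ = Ω :=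
    (MonoidAlgebra.lift ℂ ℂ (LatticeGroup n K)).apply_symm_apply Ω
  rw [hspan] at hv
  obtain ⟨a, rfl⟩ := Submodule.mem_span_singleton.1 hv
  have hp : satakeMap n K G ∈ satakeImage n K := ⟨G, hG, rfl⟩
  rw [hlift, cosetAction_smul_right, key G hG ⟨_, hp⟩ rfl, smul_comm]
  congr 2
  exact (hΩ ⟨_, hp⟩).symm

lemma isSatakeParameter_satakeParameter (hϖ : IsUniformizer ϖ)
    (hnorm : ‖(ϖ : K)‖ = (residueCard K : ℝ)⁻¹) (hirr : π.IsIrreducible)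
    [FiniteDimensional ℂ (π.fixed (maxCompact n K))] (hone : π.IsClassOne) :
    π.IsSatakeParameter π.satakeParameter := by
  have h := π.exists_isSatakeParameter hϖ hnorm hirr hone
  rw [satakeParameter, dif_pos h]
  exact h.choose_spec

end HilbertRep

end SatakeParameter

/-! ### Twisting by a power of the absolute value of the determinant. -/

section Twist

universe u

variable {n : ℕ} {K : Type*} [NontriviallyNormedField K] [IsUltrametricDist K]
  [LocallyCompactSpace K] {ϖ : Kˣ}
  {V : Type u} [NormedAddCommGroup V] [InnerProductSpace ℂ V] [CompleteSpace V]

lemma absDet_ne_zero (g : GL (Fin n) K) : absDet g ≠ 0 :=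
  Complex.ofReal_ne_zero.2 (norm_ne_zero_iff.2
    ((Matrix.isUnit_iff_isUnit_det _).1 g.isUnit).ne_zero)

lemma absDet_of_mem {k : GL (Fin n) K} (hk : k ∈ maxCompact n K) : absDet k = 1 := by
  rw [absDet, norm_det_of_mem hk, Complex.ofReal_one]

lemma ofReal_pow_cpow {r : ℝ} (hr : 0 ≤ r) (k : ℕ) (s : ℂ) :
    ((r ^ k : ℝ) : ℂ) ^ s = ((r : ℂ) ^ s) ^ k := by
  induction k with
  | zero => simp
  | succ k ih =>
    rw [pow_succ, pow_succ, Complex.ofReal_mul,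
      Complex.mul_cpow_ofReal_nonneg (pow_nonneg hr k) hr, ih]

lemma completeSum_const_mul {A : Type*} [CommRing A] (a : A) (x : Fin n → A) (k : ℕ) :
    completeSum (fun j => a * x j) k = a ^ k * completeSum x k := by
  rw [completeSum, completeSum, Finset.mul_sum]
  refine Finset.sum_congr rfl fun l hl => ?_
  rw [Finset.mem_finsuppAntidiag] at hl
  simp only [mul_pow, Finset.prod_mul_distrib, Finset.prod_pow_eq_pow_sum]
  rw [hl.1]

lemma map_completeSum {A B : Type*} [CommRing A] [CommRing B] (f : A →+* B) (x : Fin n → A)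
    (k : ℕ) : f (completeSum x k) = completeSum (fun j => f (x j)) k := by
  simp [completeSum]

lemma lift_satakeMap_integralLayer (hnorm : ‖(ϖ : K)‖ = (residueCard K : ℝ)⁻¹)
    (χ : Lattice n K →* ℂˣ) (k : ℕ) :
    MonoidAlgebra.lift ℂ ℂ (LatticeGroup n K) (charHom χ)
        (satakeMap n K (integralLayer hnorm n k)) =
      (hermiteWeight n ϖ : ℂ) ^ k * completeSum (fun j => (χ (latticeGen ϖ j) : ℂ)) k := by
  rw [satakeMap_integralLayer, map_smul, smul_eq_mul]
  congr 1
  refine (map_completeSum (MonoidAlgebra.lift ℂ ℂ (LatticeGroup n K) (charHom χ)).toRingHom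
    _ k).trans ?_
  congr 1
  funext j
  refine (MonoidAlgebra.lift_single _ _ _).trans ?_
  rw [one_smul]
  rfl

namespace HilbertRep

variable (π : HilbertRep n K V) (s : ℂ)

lemma twist_toHom_apply (g : GL (Fin n) K) (v : V) :
    (π.twist s).toHom g v = absDet g ^ s • π.toHom g v := rfl

lemma fixed_twist : (π.twist s).fixed (maxCompact n K) = π.fixed (maxCompact n K) := by
  ext v
  refine forall₂_congr fun k hk => ?_
  rw [twist_toHom_apply, absDet_of_mem hk, Complex.one_cpow, one_smul]

lemma isIrreducible_twist (h : π.IsIrreducible) : (π.twist s).IsIrreducible := by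
  refine ⟨h.1, fun W hW hst => h.2 W hW fun g w hw => ?_⟩
  have := hst g w hw
  rw [twist_toHom_apply] at this
  refine (Submodule.smul_mem_iff _ fun h0 => ?_).1 this
  exact absDet_ne_zero g ((Complex.cpow_eq_zero_iff _ _).1 h0).1

lemma isClassOne_twist (h : π.IsClassOne) : (π.twist s).IsClassOne := by
  rwa [IsClassOne, fixed_twist]

/-- |det| has the constant value |ϖ|^k on the k-th layer. -/
lemma cosetAction_twist_integralLayer (hϖ : IsUniformizer ϖ)
    (hnorm : ‖(ϖ : K)‖ = (residueCard K : ℝ)⁻¹) (k : ℕ) (v : V) :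
    cosetAction (π.twist s).linearRep v (integralLayer hnorm n k) =
      (((‖(ϖ : K)‖ : ℝ) : ℂ) ^ s) ^ k • cosetAction π.linearRep v (integralLayer hnorm n k) := by
  classical
  rw [cosetAction, cosetAction, Finsupp.linearCombination_apply, Finsupp.linearCombination_apply,
    Finsupp.sum, Finsupp.sum, Finset.smul_sum]
  refine Finset.sum_congr rfl fun x hx => ?_
  rw [Finsupp.mem_support_iff, integralLayer_apply hϖ, ite_ne_right_iff] at hx
  rw [linearRep_apply, linearRep_apply, twist_toHom_apply, absDet, hx.1.2, smul_comm]
  congr 1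
  exact ofReal_pow_cpow (norm_nonneg _) k s

/-- The two parameters are independent choices, so they are compared only through the eigenvalues on
the layers: these give equal h_k for the coordinates of the twist and for |ϖ|^s times those of π.
Matching one coordinate at a time suffices for the norm bound. -/
lemma exists_satakeParameter_twist (hϖ : IsUniformizer ϖ)
    (hnorm : ‖(ϖ : K)‖ = (residueCard K : ℝ)⁻¹) (hirr : π.IsIrreducible)
    [FiniteDimensional ℂ (π.fixed (maxCompact n K))] (hone : π.IsClassOne) (i : Fin n) :
    ∃ j, ((π.twist s).satakeParameter (latticeGen ϖ i) : ℂ) =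
      ((‖(ϖ : K)‖ : ℝ) : ℂ) ^ s * (π.satakeParameter (latticeGen ϖ j) : ℂ) := by
  have hfd : FiniteDimensional ℂ ((π.twist s).fixed (maxCompact n K)) := by
    rw [fixed_twist]; infer_instance
  have h1 := (π.isSatakeParameter_iff _).1
    (π.isSatakeParameter_satakeParameter hϖ hnorm hirr hone)
  have h2 := ((π.twist s).isSatakeParameter_iff _).1
    ((π.twist s).isSatakeParameter_satakeParameter hϖ hnorm (π.isIrreducible_twist s hirr)
      (π.isClassOne_twist s hone))
  obtain ⟨v, hv, hv0⟩ := Submodule.exists_mem_ne_zero_of_ne_bot hone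
  refine exists_eq_of_completeSum_eq
    (x := fun i => ((π.twist s).satakeParameter (latticeGen ϖ i) : ℂ))
    (y := fun j => ((‖(ϖ : K)‖ : ℝ) : ℂ) ^ s * (π.satakeParameter (latticeGen ϖ j) : ℂ))
    (fun k => ?_) (Units.ne_zero _)
  have e1 := h1 _ (integralLayer_mem hϖ hnorm k) v hv
  have e2 := h2 _ (integralLayer_mem hϖ hnorm k) v (by rwa [fixed_twist])
  rw [cosetAction_twist_integralLayer _ _ hϖ, e1, smul_smul] at e2
  have e3 := smul_left_injective ℂ hv0 e2
  rw [lift_satakeMap_integralLayer, lift_satakeMap_integralLayer, mul_left_comm] at e3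
  rw [completeSum_const_mul]
  exact (mul_left_cancel₀ (pow_ne_zero _ (Complex.ofReal_ne_zero.2 hermiteWeight_pos.ne')) e3).symm

lemma norm_satakeParameter_twist_lt_one (hϖ : IsUniformizer ϖ)
    (hnorm : ‖(ϖ : K)‖ = (residueCard K : ℝ)⁻¹) (hirr : π.IsIrreducible)
    [FiniteDimensional ℂ (π.fixed (maxCompact n K))] (hone : π.IsClassOne)
    (hs : π.satakeNorm ϖ < (residueCard K : ℝ) ^ s.re) (i : Fin n) :
    ‖((π.twist s).satakeParameter (latticeGen ϖ i) : ℂ)‖ < 1 := by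
  obtain ⟨j, hj⟩ := π.exists_satakeParameter_twist s hϖ hnorm hirr hone i
  have h1 : ‖(π.satakeParameter (latticeGen ϖ j) : ℂ)‖ < (residueCard K : ℝ) ^ s.re :=
    (le_ciSup (f := fun j : Fin n => ‖(π.satakeParameter (latticeGen ϖ j) : ℂ)‖)
      (Set.finite_range _).bddAbove j).trans_lt hs
  have hq : (0 : ℝ) < residueCard K := by
    have := residueCard_ne_zero hnorm
    positivity
  rw [hj, norm_mul, Complex.norm_cpow_eq_rpow_re_of_pos norm_uniformizer_pos, hnorm,
    Real.inv_rpow hq.le]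
  rwa [inv_mul_lt_iff₀ (Real.rpow_pos_of_pos hq _), mul_one]

end HilbertRep

end Twist

/-! ### Geometric series in several variables. -/

section MultiGeometric

/-- The geometric series in several variables. -/
lemma hasSum_prod_pow {n : ℕ} (z : Fin n → ℂ) (hz : ∀ j, ‖z j‖ < 1) :
    HasSum (fun l : Fin n → ℕ => ∏ j, z j ^ l j) (∏ j, (1 - z j)⁻¹) ∧
      Summable fun l : Fin n → ℕ => ‖∏ j, z j ^ l j‖ := by
  induction n with
  | zero =>
    refine ⟨by simp, ?_⟩
    exact (hasSum_fintype _).summable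
  | succ n ih =>
    obtain ⟨h1, h2⟩ := ih (fun j => z j.succ) fun j => hz _
    have g1 := hasSum_geometric_of_norm_lt_one (hz 0)
    have g2 : Summable fun k : ℕ => ‖z 0 ^ k‖ := summable_norm_geometric_of_norm_lt_one (hz 0)
    have h3 := summable_mul_of_summable_norm g2 h2
    have h4 : Summable fun x : ℕ × (Fin n → ℕ) => ‖z 0 ^ x.1 * ∏ j, z (Fin.succ j) ^ x.2 j‖ :=
      h3.norm
    have e : ∀ x : ℕ × (Fin n → ℕ), ∏ j, z j ^ Fin.consEquiv (fun _ : Fin (n + 1) => ℕ) x j =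
        z 0 ^ x.1 * ∏ j, z (Fin.succ j) ^ x.2 j := fun x => by
      rw [Fin.prod_univ_succ]; rfl
    rw [← (Fin.consEquiv fun _ : Fin (n + 1) => ℕ).hasSum_iff,
      ← (Fin.consEquiv fun _ : Fin (n + 1) => ℕ).summable_iff, Fin.prod_univ_succ]
    refine ⟨(g1.mul h1 h3).congr_fun fun x => ?_, h4.congr fun x => ?_⟩
    · exact e x
    · exact congrArg norm (e x).symm

lemma hasSum_card_inv_mul {𝕜 : Type*} [RCLike 𝕜] {β : Type*} (h : Nat.card β ≠ 0) (a : 𝕜) :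
    HasSum (fun _ : β => (Nat.card β : 𝕜)⁻¹ * a) a := by
  have := (Nat.card_ne_zero.1 h).2
  have := Fintype.ofFinite β
  convert hasSum_fintype fun _ : β => (Nat.card β : 𝕜)⁻¹ * a using 1
  rw [Finset.sum_const, Finset.card_univ, ← Nat.card_eq_fintype_card, nsmul_eq_mul,
    mul_inv_cancel_left₀ (Nat.cast_ne_zero.2 h)]

/-- Each term is spread evenly over a finite fibre, which preserves both the sum and the sum of
norms. -/
lemma hasSum_sigma_card_inv_mul {ι : Type*} {β : ι → Type*} (hβ : ∀ i, Nat.card (β i) ≠ 0)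
    {a : ι → ℂ} {c : ℂ} (h : HasSum a c) (hn : Summable fun i => ‖a i‖) :
    HasSum (fun x : Σ i, β i => (Nat.card (β x.1) : ℂ)⁻¹ * a x.1) c := by
  refine h.sigma_of_hasSum (fun i => hasSum_card_inv_mul (hβ i) (a i)) (Summable.of_norm ?_)
  have e : ∀ x : Σ i, β i, ‖(Nat.card (β x.1) : ℂ)⁻¹ * a x.1‖ =
      (Nat.card (β x.1) : ℝ)⁻¹ * ‖a x.1‖ := fun x => by
    rw [norm_mul, norm_inv, Complex.norm_natCast]
  have e' : ∀ i, HasSum (fun _ : β i => (Nat.card (β i) : ℝ)⁻¹ * ‖a i‖) ‖a i‖ := fun i =>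
    hasSum_card_inv_mul (hβ i) ‖a i‖
  rw [funext e, summable_sigma_of_nonneg fun _ => by positivity]
  exact ⟨fun i => (e' i).summable, hn.congr fun i => (e' i).tsum_eq.symm⟩

end MultiGeometric

/-! ### The spherical sum over integral cosets. -/

section SphericalSum

variable {n : ℕ} {K : Type*} [NontriviallyNormedField K] [IsUltrametricDist K]
  [LocallyCompactSpace K] {ϖ : Kˣ}

lemma ofReal_cpow_half {r : ℝ} (hr : 0 ≤ r) (m : ℕ) :
    (r : ℂ) ^ ((m : ℂ) / 2) = ((Real.sqrt r ^ m : ℝ) : ℂ) := by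
  have e : ((m : ℂ) / 2) = ((m / 2 : ℝ) : ℂ) := by push_cast; rfl
  rw [e, ← Complex.ofReal_cpow hr, Real.sqrt_eq_rpow, ← Real.rpow_natCast, ← Real.rpow_mul hr]
  congr 2
  ring

lemma absDet_hermite (l : Fin n → ℕ) (c : HermiteData n K l) :
    absDet (hermite ϖ l c) = ((‖(ϖ : K)‖ ^ (∑ i, l i) : ℝ) : ℂ) := by
  rw [absDet, coe_hermite, det_hermiteMatrix, norm_prod, ← Finset.prod_pow_eq_pow_sum]
  simp

lemma integralPower_mul_right (w : ℂ) {k : GL (Fin n) K} (hk : k ∈ maxCompact n K)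
    (g : GL (Fin n) K) : integralPower n K w (g * k) = integralPower n K w g := by
  have h1 : (∀ i j, ((g * k : GL (Fin n) K) : Matrix (Fin n) (Fin n) K) i j ∈ 𝒪[K]) ↔
      ∀ i j, (g : Matrix (Fin n) (Fin n) K) i j ∈ 𝒪[K] := by
    simp only [Valued.integer.mem_iff]
    rw [← isIntegralCoset_mk, ← isIntegralCoset_mk, QuotientGroup.mk_mul_of_mem g hk]
  have h2 : absDet (g * k) = absDet g := by
    simp only [absDet, Units.val_mul, Matrix.det_mul, norm_mul, norm_det_of_mem hk, mul_one]
  rw [integralPower, integralPower, h2]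
  classical exact if_congr h1 rfl rfl

lemma integralPower_mul_left (w : ℂ) {k : GL (Fin n) K} (hk : k ∈ maxCompact n K)
    (g : GL (Fin n) K) : integralPower n K w (k * g) = integralPower n K w g := by
  have h1 : (∀ i j, ((k * g : GL (Fin n) K) : Matrix (Fin n) (Fin n) K) i j ∈ 𝒪[K]) ↔
      ∀ i j, (g : Matrix (Fin n) (Fin n) K) i j ∈ 𝒪[K] := by
    simp only [Valued.integer.mem_iff]
    rw [← isIntegralCoset_mk, ← isIntegralCoset_mk, ← isIntegralCoset_smul hk (QuotientGroup.mk g)]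
    rfl
  have h2 : absDet (k * g) = absDet g := by
    simp only [absDet, Units.val_mul, Matrix.det_mul, norm_mul, norm_det_of_mem hk, one_mul]
  rw [integralPower, integralPower, h2]
  classical exact if_congr h1 rfl rfl

lemma integralPower_out (w : ℂ) (g : GL (Fin n) K) :
    integralPower n K w (QuotientGroup.mk g : CosetSpace n K).out = integralPower n K w g := by
  obtain ⟨k, hk⟩ := QuotientGroup.mk_out_eq_mul (maxCompact n K) g
  rw [hk, integralPower_mul_right w k.2]

/-- Only integral cosets contribute, so the sum is reindexed by normal forms. Each form of type l
contributes an equal share of the monomial ∏ ψ(ϖ_j)^{l_j}. -/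
lemma hasSum_integralPower (hn : 1 ≤ n) (hϖ : IsUniformizer ϖ)
    (hnorm : ‖(ϖ : K)‖ = (residueCard K : ℝ)⁻¹) (ψ : LatticeGroup n K →* ℂ)
    (hψ : ∀ j, ‖ψ (latticeBasis n ϖ j)‖ < 1) :
    HasSum (fun x : CosetSpace n K => integralPower n K (((n : ℂ) - 1) / 2) x.out *
      (sqrtModulus (cosetIwasawa x) * ψ (cosetIwasawa x)))
      (∏ j, (1 - ψ (latticeBasis n ϖ j))⁻¹) := by
  rw [← hϖ.hermite_injective.hasSum_iff]
  · have e : ∀ x : (Σ l : Fin n → ℕ, HermiteData n K l),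
        integralPower n K (((n : ℂ) - 1) / 2)
            (QuotientGroup.mk (hermite ϖ x.1 x.2) : CosetSpace n K).out *
          (sqrtModulus (cosetIwasawa (QuotientGroup.mk (hermite ϖ x.1 x.2) : CosetSpace n K)) *
            ψ (cosetIwasawa (QuotientGroup.mk (hermite ϖ x.1 x.2) : CosetSpace n K))) =
        (Nat.card (HermiteData n K x.1) : ℂ)⁻¹ * ∏ j, ψ (latticeBasis n ϖ j) ^ x.1 j := by
      rintro ⟨l, c⟩
      have := finite_hermiteData hnorm l
      have hc : (Nat.card (HermiteData n K l) : ℂ) ≠ 0 := by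
        have : Nonempty (HermiteData n K l) := ⟨c⟩
        exact_mod_cast Nat.card_pos.ne'
      have hs := congrArg (fun r : ℝ => (r : ℂ)) (card_mul_sqrtModulus (ϖ := ϖ) (n := n) hnorm l)
      simp only [Complex.ofReal_mul, Complex.ofReal_natCast] at hs
      have hint : ∀ i j, (hermite ϖ l c : Matrix (Fin n) (Fin n) K) i j ∈ 𝒪[K] := fun i j =>
        Valued.integer.mem_iff.2 (hϖ.norm_hermiteMatrix_le l c i j)
      -- The cancellation that dictates the exponent (n-1)/2.
      have hw : (hermiteWeight n ϖ : ℂ) ^ (∑ i, l i) *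
          integralPower n K (((n : ℂ) - 1) / 2) (hermite ϖ l c) = 1 := by
        rw [integralPower, if_pos hint, absDet_hermite, ofReal_pow_cpow (norm_nonneg _),
          ← mul_pow]
        have : ((n : ℂ) - 1) / 2 = ((n - 1 : ℕ) : ℂ) / 2 := by rw [Nat.cast_sub hn, Nat.cast_one]
        rw [this, ofReal_cpow_half (norm_nonneg _), hermiteWeight, ← Complex.ofReal_mul, ← mul_pow,
          inv_mul_cancel₀ (Real.sqrt_pos.2 norm_uniformizer_pos).ne']
        simp
      simp only
      rw [cosetIwasawa_hermite, integralPower_out, latticeMk_powVec, map_prod,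
        eq_inv_mul_iff_mul_eq₀ hc]
      rw [← latticeMk_powVec]
      simp only [map_pow]
      rw [← mul_assoc, ← mul_assoc, mul_right_comm _ (integralPower _ _ _ _), hs,
        Complex.ofReal_pow, hw, one_mul]
    obtain ⟨h1, h2⟩ := hasSum_prod_pow _ hψ
    have h3 := hasSum_sigma_card_inv_mul (β := fun l : Fin n → ℕ => HermiteData n K l)
      (fun l => by
        rw [card_hermiteData]
        exact Finset.prod_ne_zero_iff.2 fun i _ => pow_ne_zero _ (residueCard_ne_zero hnorm)) h1 h2
    exact h3.congr_fun e
  · intro x hx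
    have : ¬ IsIntegralCoset x := fun h => by
      obtain ⟨l, c, rfl⟩ := hϖ.exists_hermite h
      exact hx ⟨⟨l, c⟩, rfl⟩
    have h2 : ¬ ∀ i j, (x.out : Matrix (Fin n) (Fin n) K) i j ∈ 𝒪[K] := fun h =>
      this fun i j => Valued.integer.mem_iff.1 (h i j)
    rw [integralPower, if_neg h2, zero_mul]

end SphericalSum

/-! ### Operators of bi-invariant functions without compact support. -/

section Operator

universe u

variable {n : ℕ} {K : Type*} [NontriviallyNormedField K] [IsUltrametricDist K]
  [LocallyCompactSpace K] {ϖ : Kˣ}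
  {V : Type u} [NormedAddCommGroup V] [InnerProductSpace ℂ V] [CompleteSpace V]

lemma doubleCoset_mk_mul_left {k : GL (Fin n) K} (hk : k ∈ maxCompact n K) (x : GL (Fin n) K) :
    DoubleCoset.mk (maxCompact n K) (maxCompact n K) (k * x) =
      DoubleCoset.mk (maxCompact n K) (maxCompact n K) x :=
  (DoubleCoset.eq _ _ _ _).2 ⟨k⁻¹, inv_mem hk, 1, one_mem _, by group⟩

lemma doubleCoset_mk_mul_right {k : GL (Fin n) K} (hk : k ∈ maxCompact n K) (x : GL (Fin n) K) :
    DoubleCoset.mk (maxCompact n K) (maxCompact n K) (x * k) =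
      DoubleCoset.mk (maxCompact n K) (maxCompact n K) x :=
  (DoubleCoset.eq _ _ _ _).2 ⟨1, one_mem _, k⁻¹, inv_mem hk, by group⟩

open Classical in
lemma isHecke_doubleCoset {f : GL (Fin n) K → ℂ}
    (hl : ∀ k ∈ maxCompact n K, ∀ x, f (k * x) = f x)
    (hr : ∀ k ∈ maxCompact n K, ∀ x, f (x * k) = f x)
    (D : DoubleCoset.Quotient (maxCompact n K : Set (GL (Fin n) K))
      (maxCompact n K : Set (GL (Fin n) K))) :
    IsHecke fun x => if DoubleCoset.mk (maxCompact n K) (maxCompact n K) x = D then f x else 0 where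
  compactSupport := by
    have hc : IsCompact ((fun p : GL (Fin n) K × GL (Fin n) K => p.1 * D.out * p.2) ''
        ((maxCompact n K : Set (GL (Fin n) K)) ×ˢ (maxCompact n K : Set (GL (Fin n) K)))) :=
      (isCompact_maxCompact.prod isCompact_maxCompact).image (by fun_prop)
    refine HasCompactSupport.of_support_subset_isCompact hc fun x hx => ?_
    have hx' := (ite_ne_right_iff.1 hx).1
    rw [← DoubleCoset.out_eq' _ _ D, eq_comm, DoubleCoset.eq] at hx'
    obtain ⟨k, hk, l, hl, e⟩ := hx'
    exact ⟨(k, l), ⟨hk, hl⟩, e.symm⟩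
  left_inv k hk x := by rw [doubleCoset_mk_mul_left hk, hl k hk]
  right_inv k hk x := by rw [doubleCoset_mk_mul_right hk, hr k hk]

namespace HilbertRep

variable (π : HilbertRep n K V)

/-- Every double coset acts as a scalar times the same operator `π.average`, so norm convergence
reduces to convergence of the scalars. -/
lemma hasOperator_of_hasSum {χ : Lattice n K →* ℂˣ} (hχ : π.IsSatakeParameter χ)
    {f : GL (Fin n) K → ℂ} (hl : ∀ k ∈ maxCompact n K, ∀ x, f (k * x) = f x)
    (hr : ∀ k ∈ maxCompact n K, ∀ x, f (x * k) = f x) {c : ℂ}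
    (h : HasSum (fun x : CosetSpace n K => f x.out *
      (sqrtModulus (cosetIwasawa x) * charHom χ (cosetIwasawa x))) c) :
    π.HasOperator f (c • π.average) := by
  classical
  choose F hF hFe using fun D => exists_heckeSubmodule_of_isHecke (isHecke_doubleCoset hl hr D)
  refine ⟨fun D => MonoidAlgebra.lift ℂ ℂ (LatticeGroup n K) (charHom χ)
    (satakeMap n K (F D)) • π.average, fun D v => ?_, HasSum.smul_const ?_ _⟩
  · have e : (fun x => (if DoubleCoset.mk (maxCompact n K) (maxCompact n K) x = D
        then f x else 0) • π.toHom x v) = fun x => F D (QuotientGroup.mk x) • π.toHom x v := by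
      funext x
      congr 1
      convert congrFun (hFe D) x
    rw [e]
    refine ⟨integrable_coset_smul (F D) (π.continuous_toHom_apply v), ?_⟩
    rw [integral_coset_toHom,
      (π.isSatakeParameter_iff χ).1 hχ (F D) (hF D) _ (π.average_mem v)]
    rfl
  · let p : CosetSpace n K → DoubleCoset.Quotient (maxCompact n K : Set (GL (Fin n) K))
        (maxCompact n K : Set (GL (Fin n) K)) := fun x =>
      DoubleCoset.mk (maxCompact n K) (maxCompact n K) x.out
    rw [← (Equiv.sigmaFiberEquiv p).hasSum_iff] at h
    -- The scalar of D is the finite sum over the cosets contained in D, so the series over double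
    -- cosets is a regrouping of the series over cosets.
    refine h.sigma fun D => ?_
    rw [lift_satakeMap, Finsupp.sum]
    have hFx : ∀ x : CosetSpace n K, F D x = if p x = D then f x.out else 0 := fun x => by
      have := congrFun (hFe D) x.out
      rw [QuotientGroup.out_eq'] at this
      rw [← this]
    refine (hasSum_subtype_iff_indicator (s := {x | p x = D}) (f := fun x : CosetSpace n K =>
      f x.out * (sqrtModulus (cosetIwasawa x) * charHom χ (cosetIwasawa x)))).2 ?_
    have e : Set.indicator {x | p x = D} (fun x : CosetSpace n K =>
        f x.out * (sqrtModulus (cosetIwasawa x) * charHom χ (cosetIwasawa x))) =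
        fun x => F D x * (sqrtModulus (cosetIwasawa x) * charHom χ (cosetIwasawa x)) := by
      funext x
      rw [hFx, Set.indicator_apply, ite_mul, zero_mul]
      rfl
    rw [e]
    refine hasSum_sum_of_ne_finset_zero fun x hx => ?_
    rw [Finsupp.notMem_support_iff.1 hx, zero_mul]

/-- The integrands agree pointwise: the factor |det|^s moves from the representation to the
function. -/
lemma hasOperator_twist_iff (s w : ℂ) (T : V →L[ℂ] V) :
    (π.twist s).HasOperator (integralPower n K w) T ↔
      π.HasOperator (integralPower n K (s + w)) T := by
  have e : ∀ (x : GL (Fin n) K) (v : V) (p : Prop) [Decidable p],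
      (if p then integralPower n K w x else 0) • (π.twist s).toHom x v =
        (if p then integralPower n K (s + w) x else 0) • π.toHom x v := by
    intro x v p _
    rw [twist_toHom_apply, smul_smul]
    congr 1
    simp only [integralPower]
    split_ifs
    · rw [Complex.cpow_add _ _ (absDet_ne_zero x), mul_comm]
    · exact zero_mul _
    · exact zero_mul _
  simp only [HasOperator, IsIntegral, e]

end HilbertRep

end Operator

/-! ### Traces of rank-one operators. -/

section RankOne

universe u

open InnerProductSpace

variable {V : Type u} [NormedAddCommGroup V] [InnerProductSpace ℂ V] [CompleteSpace V]

/-- The right side is positive and its square is T*T = ‖u‖² times the rank-one operator of w with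
itself. For w = 0 both operators vanish, whatever the value of the quotient. -/
lemma abs_rankOne (u w : V) :
    CFC.abs (rankOne ℂ u w) = (‖u‖ / ‖w‖) • rankOne ℂ w w := by
  refine CFC.sqrt_unique ?_ ?_
  · rw [ContinuousLinearMap.star_eq_adjoint, adjoint_rankOne, ContinuousLinearMap.mul_def,
      ContinuousLinearMap.mul_def, rankOne_comp_rankOne, ContinuousLinearMap.smul_comp,
      ContinuousLinearMap.comp_smul, rankOne_comp_rankOne, inner_self_eq_norm_sq_to_K,
      inner_self_eq_norm_sq_to_K, smul_smul]
    by_cases hw : w = 0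
    · simp [hw]
    · have hw' : ‖w‖ ≠ 0 := norm_ne_zero_iff.2 hw
      rw [← Complex.coe_smul, smul_smul]
      congr 1
      have : (‖w‖ : ℂ) ≠ 0 := Complex.ofReal_ne_zero.2 hw'
      push_cast
      field_simp
      exact mul_comm _ _
  · rw [ContinuousLinearMap.nonneg_iff_isPositive, ← Complex.coe_smul]
    refine (isPositive_rankOne_self w).smul_of_nonneg ?_
    rw [Complex.zero_le_real]
    positivity

/-- Both sums are instances of Parseval's identity, for the pairs (w, w) and (w, u). -/
lemma hasTrace_rankOne (u w : V) : HasTrace (rankOne ℂ u w) (inner ℂ w u) := by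
  refine ⟨fun ι b => ?_, fun ι b => ?_⟩
  · have h := ((b.summable_inner_mul_inner w w).mapL Complex.reCLM).mul_left (‖u‖ / ‖w‖)
    refine h.congr fun i => ?_
    rw [abs_rankOne, _root_.smul_apply, rankOne_apply, ← Complex.coe_smul,
      inner_smul_right, inner_smul_right]
    exact (Complex.re_ofReal_mul _ _).symm
  · refine (b.hasSum_inner_mul_inner w u).congr_fun fun i => ?_
    rw [rankOne_apply, inner_smul_right]

end RankOne

/-! ### The L-factor as a trace. -/

section LFactor

universe u

open InnerProductSpace

variable {n : ℕ} {K : Type*} [NontriviallyNormedField K] [IsUltrametricDist K]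
  [LocallyCompactSpace K] {ϖ : Kˣ}
  {V : Type u} [NormedAddCommGroup V] [InnerProductSpace ℂ V] [CompleteSpace V]

namespace HilbertRep

variable (π : HilbertRep n K V)

/-- The projection P onto the spherical line need not be orthogonal, so it is written with the
adjoint, as v ↦ ⟨P*v₀, v⟩ v₀ / ⟨v₀, v₀⟩; its trace is 1 because P v₀ = v₀. -/
lemma hasTrace_smul_average (hirr : π.IsIrreducible)
    [FiniteDimensional ℂ (π.fixed (maxCompact n K))] (hone : π.IsClassOne) (c : ℂ) :
    HasTrace (c • π.average) c := by
  obtain ⟨v₀, hv₀, hspan⟩ := π.exists_spherical_vector hirr hone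
  have hmem : v₀ ∈ π.fixed (maxCompact n K) := by
    rw [hspan]; exact Submodule.mem_span_singleton_self v₀
  have h0 : inner ℂ v₀ v₀ ≠ 0 := inner_self_ne_zero.2 hv₀
  have e : c • π.average = rankOne ℂ ((c / inner ℂ v₀ v₀) • v₀)
      (ContinuousLinearMap.adjoint π.average v₀) := by
    ext v
    rw [rankOne_apply, ContinuousLinearMap.adjoint_inner_left, _root_.smul_apply]
    have hv := π.average_mem v
    rw [hspan] at hv
    obtain ⟨a, ha⟩ := Submodule.mem_span_singleton.1 hv
    rw [← ha, inner_smul_right, smul_smul, smul_smul]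
    congr 1
    field_simp
  have ht := hasTrace_rankOne ((c / inner ℂ v₀ v₀) • v₀)
    (ContinuousLinearMap.adjoint π.average v₀)
  rw [← e, ContinuousLinearMap.adjoint_inner_left, map_smul, π.average_of_mem hmem,
    inner_smul_right, div_mul_cancel₀ _ h0] at ht
  exact ht

/-- The unramified L-factor as a trace, in the domain of absolute convergence. -/
theorem exists_hasOperator_hasTrace (hn : 1 ≤ n) (hϖ : IsUniformizer ϖ)
    (hnorm : ‖(ϖ : K)‖ = (residueCard K : ℝ)⁻¹) (hirr : π.IsIrreducible)
    [FiniteDimensional ℂ (π.fixed (maxCompact n K))] (hone : π.IsClassOne)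
    (h : ∀ j, ‖(π.satakeParameter (latticeGen ϖ j) : ℂ)‖ < 1) :
    ∃ T : V →L[ℂ] V, π.HasOperator (integralPower n K (((n : ℂ) - 1) / 2)) T ∧
      HasTrace T (π.LFactor ϖ) := by
  refine ⟨π.LFactor ϖ • π.average, ?_, π.hasTrace_smul_average hirr hone _⟩
  refine π.hasOperator_of_hasSum (π.isSatakeParameter_satakeParameter hϖ hnorm hirr hone)
    (fun k hk => integralPower_mul_left _ hk) (fun k hk => integralPower_mul_right _ hk) ?_
  rw [LFactor, ← Finset.prod_inv_distrib]
  exact hasSum_integralPower hn hϖ hnorm (charHom π.satakeParameter) h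

end HilbertRep

end LFactor

end

end LocalFactor

theorem corollary2p2 {K : Type*} [NontriviallyNormedField K] [IsUltrametricDist K]
    [LocallyCompactSpace K] (ϖ : Kˣ) (hϖ : LocalFactor.IsUniformizer ϖ)
    (hnorm : ‖(ϖ : K)‖ = (LocalFactor.residueCard K : ℝ)⁻¹)
    {n : ℕ} (hn : 1 ≤ n)
    {V : Type*} [NormedAddCommGroup V] [InnerProductSpace ℂ V] [CompleteSpace V]
    (π : LocalFactor.HilbertRep n K V)
    (hirr : π.IsIrreducible) (hadm : π.IsAdmissible) (hone : π.IsClassOne)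
    (s : ℂ) (hs : π.satakeNorm ϖ < (LocalFactor.residueCard K : ℝ) ^ s.re) :
    (∃ T : V →L[ℂ] V,
      (π.twist s).HasOperator (LocalFactor.integralPower n K (((n : ℂ) - 1) / 2)) T ∧
      LocalFactor.HasTrace T (π.twistedLFactor ϖ s)) ∧
    (∃ T : V →L[ℂ] V,
      π.HasOperator (LocalFactor.integralPower n K (s + ((n : ℂ) - 1) / 2)) T ∧
      LocalFactor.HasTrace T (π.twistedLFactor ϖ s)) := by
  have hfd : FiniteDimensional ℂ (π.fixed (LocalFactor.maxCompact n K)) :=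
    hadm _ LocalFactor.isOpen_maxCompact
  have hfd' : FiniteDimensional ℂ ((π.twist s).fixed (LocalFactor.maxCompact n K)) := by
    rw [π.fixed_twist]; exact hfd
  obtain ⟨T, hT, ht⟩ := (π.twist s).exists_hasOperator_hasTrace hn hϖ hnorm
    (π.isIrreducible_twist s hirr) (π.isClassOne_twist s hone)
    (π.norm_satakeParameter_twist_lt_one s hϖ hnorm hirr hone hs)
  -- One operator T serves both assertions.
  exact ⟨⟨T, hT, ht⟩, T, (π.hasOperator_twist_iff s _ T).1 hT, ht⟩
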